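/- Let $C = (C^1 \xrightarrow{d} C^2 \xrightarrow{d} C^3)$ be a 3-term cochain complex of abelian groups ($d\circ d=0$), with cohomology groups $H^1(C)=\ker(C^1\to C^2)$, $H^2(C)=\ker(C^2\to C^3)/\operatorname{im}(C^1\to C^2)$, $H^3(C)=C^3/\operatorname{im}(C^2\to C^3)$. Let $D(C)$ be the following strict symmetric monoidal bicategory. Its objects are the elements of $C^3$; a 1-morphism $x\to y$ is an element $c\in C^2$ with $y=x+dc$; a 2-morphism $c\Rightarrow c'$ between 1-morphisms $x\to y$ is an element $e\in C^1$ with $c'=c+de$. All compositions are given by addition, the tensor product is addition of objects, of 1-morphisms and of 2-morphisms, and the associativity, unit and symmetry constraints are identities. A cochain map $f\colon C\to C'$ induces a (strict) pseudofunctor $D(f)\colon D(C)\to D(C')$. For an abelian group $M$ write $M$, $M[1]$, $M[2]$ for $D$ of the complex with $M$ in degree $3$, $2$, $1$ respectively and zero elsewhere, and put $\operatorname{Split}(C)=H^3(C)\times H^2(C)[1]\times H^1(C)[2]$, the product symmetric monoidal bicategory; $f$ induces $\operatorname{Split}(f)\colon\operatorname{Split}(C)\to\operatorname{Split}(C')$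 through the maps on cohomology. An equivalence of symmetric monoidal bicategories consists of symmetric monoidal pseudofunctors in both directions together with symmetric monoidal pseudonatural transformations, with equivalences as components, between the two composites and the identities. Then: 1. For every $C$ there is an equivalence of symmetric monoidal bicategories $D(C)\simeq H^3(C)\times H^2(C)[1]\times H^1(C)[2]$. 2. These equivalences cannot be chosen naturally: there is no family of equivalences of symmetric monoidal bicategories $\Phi_C\colon D(C)\to \operatorname{Split}(C)$, one for each $C$, such that for every cochain map $f\colon C\to C'$ the pseudofunctors underlying $\Phi_{C'}\circ D(f)$ and $\operatorname{Split}(f)\circ\Phi_C$ are pseudonaturally equivalent. 3. Nevertheless there is a natural isomorphism $\pi_0(D(C))\cong H^3(C)$: writing $\pi_0(D(C))$ for the equivalence classes of objects of $D(C)$ with the addition induced by the tensor product, there are additive isomorphisms $\varphi_C\colon\pi_0(D(C))\to H^3(C)$, one for each $C$, with $\varphi_{C'}\circ\pi_0(D(f))=H^3(f)\circ\varphi_C$ for every cochain map $f\colon C\to C'$. -/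

import Mathlib

open CategoryTheory CategoryTheory.Bicategory

universe w v u w₁ v₁ u₁ w₂ v₂ u₂ w₃ v₃ u₃

namespace SymBicat

/-! ### Squares of invertible 2-cells -/

section Squares

variable {B : Type u} [Bicategory.{w, v} B]

/-- A 1-morphism is an equivalence if it is part of an adjoint equivalence. -/
def IsEquiv {a b : B} (f : a ⟶ b) : Prop := ∃ e : a ≌ b, e.hom = f

/-- Stack two squares `f ≫ t' ≅ t ≫ g` and `g ≫ s' ≅ s ≫ h` along `g`. -/
def sqV {a a' b b' c c' : B} {f : a ⟶ a'} {t : a ⟶ b} {t' : a' ⟶ b'} {g : b ⟶ b'}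
    {s : b ⟶ c} {s' : b' ⟶ c'} {h : c ⟶ c'}
    (p : f ≫ t' ≅ t ≫ g) (q : g ≫ s' ≅ s ≫ h) : f ≫ t' ≫ s' ≅ (t ≫ s) ≫ h :=
  (α_ _ _ _).symm ≪≫ p ▷ᵢ s' ≪≫ α_ _ _ _ ≪≫ t ◁ᵢ q ≪≫ (α_ _ _ _).symm

/-- Juxtapose two squares `f ≫ t' ≅ t ≫ g` and `f₂ ≫ t'' ≅ t' ≫ g₂` along `t'`. -/
def sqH {a a' a'' b b' b'' : B} {f : a ⟶ a'} {f₂ : a' ⟶ a''} {t : a ⟶ b} {t' : a' ⟶ b'}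
    {t'' : a'' ⟶ b''} {g : b ⟶ b'} {g₂ : b' ⟶ b''}
    (p : f ≫ t' ≅ t ≫ g) (q : f₂ ≫ t'' ≅ t' ≫ g₂) : (f ≫ f₂) ≫ t'' ≅ t ≫ g ≫ g₂ :=
  α_ _ _ _ ≪≫ f ◁ᵢ q ≪≫ (α_ _ _ _).symm ≪≫ p ▷ᵢ g₂ ≪≫ α_ _ _ _

/-- The square on `f` with identity sides. -/
def sqId {a a' : B} (f : a ⟶ a') : f ≫ 𝟙 a' ≅ 𝟙 a ≫ f := ρ_ f ≪≫ (λ_ f).symm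

/-- The square on `t` with identity top and bottom. -/
def sqOne {a b : B} (t : a ⟶ b) : 𝟙 a ≫ t ≅ t ≫ 𝟙 b := λ_ t ≪≫ (ρ_ t).symm

/-- The mate of a square whose sides are adjoint equivalences. -/
def sqMate {a a' b b' : B} {f : a ⟶ a'} {g : b ⟶ b'} (e : a ≌ b) (e' : a' ≌ b')
    (p : f ≫ e'.hom ≅ e.hom ≫ g) : g ≫ e'.inv ≅ e.inv ≫ f :=
  Iso.refl (g ≫ e'.inv) ≪⊗≫ e.counit.symm ▷ᵢ (g ≫ e'.inv) ≪⊗≫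
    e.inv ◁ᵢ (p.symm ▷ᵢ e'.inv) ≪⊗≫ (e.inv ≫ f) ◁ᵢ e'.unit.symm ≪⊗≫ Iso.refl (e.inv ≫ f)

/-- The modification axiom: 2-cells `m : t ≅ s`, `m' : t' ≅ s'` intertwine two squares with the
same top `f` and bottom `g`. -/
def Compat {a a' b b' : B} {f : a ⟶ a'} {g : b ⟶ b'} {t s : a ⟶ b} {t' s' : a' ⟶ b'}
    (p : f ≫ t' ≅ t ≫ g) (q : f ≫ s' ≅ s ≫ g) (m : t ≅ s) (m' : t' ≅ s') : Prop :=
  p ≪≫ m ▷ᵢ g = f ◁ᵢ m' ≪≫ q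

variable {C : Type u₁} [Bicategory.{w₁, v₁} C] (F : B ⥤ᵖ C)

/-- The image of a square under a pseudofunctor. -/
def sqMap {a a' b b' : B} {f : a ⟶ a'} {t : a ⟶ b} {t' : a' ⟶ b'} {g : b ⟶ b'}
    (p : f ≫ t' ≅ t ≫ g) : F.map f ≫ F.map t' ≅ F.map t ≫ F.map g :=
  (F.mapComp _ _).symm ≪≫ F.map₂Iso p ≪≫ F.mapComp _ _

def fun2 {a b c : B} (f : a ⟶ b) (g : b ⟶ c) : F.map f ≫ F.map g ≅ F.map (f ≫ g) :=
  (F.mapComp f g).symm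

def fun3 {a b c d : B} (f : a ⟶ b) (g : b ⟶ c) (h : c ⟶ d) :
    F.map f ≫ F.map g ≫ F.map h ≅ F.map (f ≫ g ≫ h) :=
  F.map f ◁ᵢ fun2 F g h ≪≫ fun2 F f (g ≫ h)

def funUnit {a b : B} (e : a ≌ b) : F.map e.hom ≫ F.map e.inv ≅ 𝟙 (F.obj a) :=
  fun2 F _ _ ≪≫ F.map₂Iso e.unit.symm ≪≫ F.mapId a

end Squares

/-! ### The tensor product -/

/-- A bicategory with a tensor product and a unit object. -/
class TensorBicat (B : Type u) [Bicategory.{w, v} B] where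
  tensor : (B × B) ⥤ᵖ B
  unit : B

section Tensor

variable {B : Type u} [Bicategory.{w, v} B] [TensorBicat B]

variable (B) in
def one : B := TensorBicat.unit

def tensorObj (a b : B) : B := (TensorBicat.tensor (B := B)).obj (a, b)

infixl:70 " ⊠ " => tensorObj

def tensorHom {a a' b b' : B} (f : a ⟶ a') (g : b ⟶ b') : a ⊠ b ⟶ a' ⊠ b' :=
  (TensorBicat.tensor (B := B)).map (Prod.mkHom f g)

infixl:85 " ⊠₁ " => tensorHom

def tensorHom₂ {a a' b b' : B} {f f' : a ⟶ a'} {g g' : b ⟶ b'} (η : f ⟶ f') (θ : g ⟶ g') :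
    f ⊠₁ g ⟶ f' ⊠₁ g' :=
  (TensorBicat.tensor (B := B)).map₂ (Prod.mkHom η θ)

def tensorIso {a a' b b' : B} {f f' : a ⟶ a'} {g g' : b ⟶ b'} (η : f ≅ f') (θ : g ≅ g') :
    f ⊠₁ g ≅ f' ⊠₁ g' :=
  (TensorBicat.tensor (B := B)).map₂Iso (Iso.prod η θ)

infixl:85 " ⊠₂ " => tensorIso

def tensorId (a b : B) : 𝟙 a ⊠₁ 𝟙 b ≅ 𝟙 (a ⊠ b) :=
  (TensorBicat.tensor (B := B)).mapId (a, b)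

def tensorComp {a a' a'' b b' b'' : B} (f : a ⟶ a') (f' : a' ⟶ a'') (g : b ⟶ b')
    (g' : b' ⟶ b'') : (f ≫ f') ⊠₁ (g ≫ g') ≅ f ⊠₁ g ≫ f' ⊠₁ g' :=
  (TensorBicat.tensor (B := B)).mapComp (Prod.mkHom f g) (Prod.mkHom f' g')

/-- Whiskering a 1-morphism by an object on the right: `f ⊗ c`. -/
abbrev whR {a a' : B} (f : a ⟶ a') (c : B) : a ⊠ c ⟶ a' ⊠ c := f ⊠₁ 𝟙 c

/-- Whiskering a 1-morphism by an object on the left: `a ⊗ f`. -/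
abbrev whL (a : B) {b b' : B} (f : b ⟶ b') : a ⊠ b ⟶ a ⊠ b' := 𝟙 a ⊠₁ f

infixl:85 " ▹ " => whR
infixr:85 " ◂ " => whL

def isoR {a a' : B} {f f' : a ⟶ a'} (η : f ≅ f') (c : B) : f ▹ c ≅ f' ▹ c := η ⊠₂ Iso.refl (𝟙 c)

def isoL (a : B) {b b' : B} {f f' : b ⟶ b'} (η : f ≅ f') : a ◂ f ≅ a ◂ f' := Iso.refl (𝟙 a) ⊠₂ η

def compR {a b c : B} (f : a ⟶ b) (g : b ⟶ c) (x : B) : f ▹ x ≫ g ▹ x ≅ (f ≫ g) ▹ x :=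
  (tensorComp f g (𝟙 x) (𝟙 x)).symm ≪≫ Iso.refl (f ≫ g) ⊠₂ λ_ (𝟙 x)

def compL (x : B) {a b c : B} (f : a ⟶ b) (g : b ⟶ c) : x ◂ f ≫ x ◂ g ≅ x ◂ (f ≫ g) :=
  (tensorComp (𝟙 x) (𝟙 x) f g).symm ≪≫ λ_ (𝟙 x) ⊠₂ Iso.refl (f ≫ g)

def compR3 {a b c d : B} (f : a ⟶ b) (g : b ⟶ c) (h : c ⟶ d) (x : B) :
    f ▹ x ≫ g ▹ x ≫ h ▹ x ≅ (f ≫ g ≫ h) ▹ x :=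
  f ▹ x ◁ᵢ compR g h x ≪≫ compR f (g ≫ h) x

def compL3 (x : B) {a b c d : B} (f : a ⟶ b) (g : b ⟶ c) (h : c ⟶ d) :
    x ◂ f ≫ x ◂ g ≫ x ◂ h ≅ x ◂ (f ≫ g ≫ h) :=
  x ◂ f ◁ᵢ compL x g h ≪≫ compL x f (g ≫ h)

def compR5 {a b c d e e' : B} (f : a ⟶ b) (g : b ⟶ c) (h : c ⟶ d) (k : d ⟶ e) (l : e ⟶ e')
    (x : B) : f ▹ x ≫ g ▹ x ≫ h ▹ x ≫ k ▹ x ≫ l ▹ x ≅ (f ≫ g ≫ h ≫ k ≫ l) ▹ x :=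
  f ▹ x ◁ᵢ (g ▹ x ◁ᵢ compR3 h k l x ≪≫ compR g (h ≫ k ≫ l) x) ≪≫ compR f (g ≫ h ≫ k ≫ l) x

def compL5 (x : B) {a b c d e e' : B} (f : a ⟶ b) (g : b ⟶ c) (h : c ⟶ d) (k : d ⟶ e)
    (l : e ⟶ e') : x ◂ f ≫ x ◂ g ≫ x ◂ h ≫ x ◂ k ≫ x ◂ l ≅ x ◂ (f ≫ g ≫ h ≫ k ≫ l) :=
  x ◂ f ◁ᵢ (x ◂ g ◁ᵢ compL3 x h k l ≪≫ compL x g (h ≫ k ≫ l)) ≪≫ compL x f (g ≫ h ≫ k ≫ l)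

/-- The interchange 2-cell. -/
def exch {a a' b b' : B} (f : a ⟶ a') (g : b ⟶ b') : f ▹ b ≫ a' ◂ g ≅ a ◂ g ≫ f ▹ b' :=
  (tensorComp _ _ _ _).symm ≪≫ (ρ_ f ≪≫ (λ_ f).symm) ⊠₂ (λ_ g ≪≫ (ρ_ g).symm) ≪≫
    tensorComp _ _ _ _

def unitR {a b : B} (e : a ≌ b) (x : B) : e.hom ▹ x ≫ e.inv ▹ x ≅ 𝟙 (a ⊠ x) :=
  compR _ _ x ≪≫ isoR e.unit.symm x ≪≫ tensorId a x

def unitL (x : B) {a b : B} (e : a ≌ b) : x ◂ e.hom ≫ x ◂ e.inv ≅ 𝟙 (x ⊠ a) :=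
  compL x _ _ ≪≫ isoL x e.unit.symm ≪≫ tensorId x a

def counitR {a b : B} (e : a ≌ b) (x : B) : e.inv ▹ x ≫ e.hom ▹ x ≅ 𝟙 (b ⊠ x) :=
  compR _ _ x ≪≫ isoR e.counit x ≪≫ tensorId b x

def counitL (x : B) {a b : B} (e : a ≌ b) : x ◂ e.inv ≫ x ◂ e.hom ≅ 𝟙 (x ⊠ b) :=
  compL x _ _ ≪≫ isoL x e.counit ≪≫ tensorId x b

/-- The tensor product of two squares. -/
def sqT {a a' b b' : B} {f : a ⟶ a'} {t : a ⟶ b} {t' : a' ⟶ b'} {g : b ⟶ b'}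
    {c c' d d' : B} {h : c ⟶ c'} {s : c ⟶ d} {s' : c' ⟶ d'} {k : d ⟶ d'}
    (p : f ≫ t' ≅ t ≫ g) (q : h ≫ s' ≅ s ≫ k) :
    f ⊠₁ h ≫ t' ⊠₁ s' ≅ t ⊠₁ s ≫ g ⊠₁ k :=
  (tensorComp _ _ _ _).symm ≪≫ p ⊠₂ q ≪≫ tensorComp _ _ _ _

/-- The square of the whiskered 1-morphisms `t ⊗ x`. -/
def sqR {a a' b b' : B} {f : a ⟶ a'} {t : a ⟶ b} {t' : a' ⟶ b'} {g : b ⟶ b'}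
    (p : f ≫ t' ≅ t ≫ g) {x x' : B} (k : x ⟶ x') : f ⊠₁ k ≫ t' ▹ x' ≅ t ▹ x ≫ g ⊠₁ k :=
  sqT p (sqId k)

/-- The square of the whiskered 1-morphisms `x ⊗ t`. -/
def sqL {x x' : B} (k : x ⟶ x') {a a' b b' : B} {f : a ⟶ a'} {t : a ⟶ b} {t' : a' ⟶ b'}
    {g : b ⟶ b'} (p : f ≫ t' ≅ t ≫ g) : k ⊠₁ f ≫ x' ◂ t' ≅ x ◂ t ≫ k ⊠₁ g :=
  sqT (sqId k) p

end Tensor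

/-! ### Symmetric monoidal bicategories -/

/-- The structure cells of a symmetric monoidal bicategory: tensor product and unit, pseudonatural
adjoint equivalences `asc` (associator), `lu`, `ru` (unitors) and `br` (braiding), and invertible
2-cells `pent` (pentagonator), `mid`, `lun`, `run` (2-unitors), `hexR`, `hexS` (hexagonators) and
`syl` (syllepsis). The 2-cells `ascN`, `luN`, `ruN`, `brN` are the pseudonaturality constraints. -/
class SymMonBicatData (B : Type u) [Bicategory.{w, v} B] extends TensorBicat B where
  asc (a b c : B) : a ⊠ b ⊠ c ≌ a ⊠ (b ⊠ c)
  ascN {a a' b b' c c' : B} (f : a ⟶ a') (g : b ⟶ b') (h : c ⟶ c') :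
    f ⊠₁ g ⊠₁ h ≫ (asc a' b' c').hom ≅ (asc a b c).hom ≫ f ⊠₁ (g ⊠₁ h)
  lu (a : B) : one B ⊠ a ≌ a
  luN {a a' : B} (f : a ⟶ a') : one B ◂ f ≫ (lu a').hom ≅ (lu a).hom ≫ f
  ru (a : B) : a ⊠ one B ≌ a
  ruN {a a' : B} (f : a ⟶ a') : f ▹ one B ≫ (ru a').hom ≅ (ru a).hom ≫ f
  pent (a b c d : B) :
    (asc a b c).hom ▹ d ≫ (asc a (b ⊠ c) d).hom ≫ a ◂ (asc b c d).hom ≅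
      (asc (a ⊠ b) c d).hom ≫ (asc a b (c ⊠ d)).hom
  mid (a b : B) : (asc a (one B) b).hom ≫ a ◂ (lu b).hom ≅ (ru a).hom ▹ b
  lun (a b : B) : (asc (one B) a b).hom ≫ (lu (a ⊠ b)).hom ≅ (lu a).hom ▹ b
  run (a b : B) : (asc a b (one B)).hom ≫ a ◂ (ru b).hom ≅ (ru (a ⊠ b)).hom
  br (a b : B) : a ⊠ b ≌ b ⊠ a
  brN {a a' b b' : B} (f : a ⟶ a') (g : b ⟶ b') :
    f ⊠₁ g ≫ (br a' b').hom ≅ (br a b).hom ≫ g ⊠₁ f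
  hexR (a b c : B) :
    (asc a b c).hom ≫ (br a (b ⊠ c)).hom ≫ (asc b c a).hom ≅
      (br a b).hom ▹ c ≫ (asc b a c).hom ≫ b ◂ (br a c).hom
  hexS (a b c : B) :
    (asc a b c).inv ≫ (br (a ⊠ b) c).hom ≫ (asc c a b).inv ≅
      a ◂ (br b c).hom ≫ (asc a c b).inv ≫ (br a c).hom ▹ b
  syl (a b : B) : (br a b).hom ≫ (br b a).hom ≅ 𝟙 (a ⊠ b)

section Derived

open SymMonBicatData

variable {B : Type u} [Bicategory.{w, v} B] [SymMonBicatData B]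

/-- The associator 1-morphism. -/
abbrev as (a b c : B) : a ⊠ b ⊠ c ⟶ a ⊠ (b ⊠ c) := (asc a b c).hom

/-- The inverse associator 1-morphism. -/
abbrev ai (a b c : B) : a ⊠ (b ⊠ c) ⟶ a ⊠ b ⊠ c := (asc a b c).inv

/-- The braiding 1-morphism. -/
abbrev bt (a b : B) : a ⊠ b ⟶ b ⊠ a := (br a b).hom

/-! Pseudonaturality of the associator, its inverse and the braiding in a single variable. -/

def asA {a a' : B} (f : a ⟶ a') (b c : B) : f ▹ b ▹ c ≫ as a' b c ≅ as a b c ≫ f ▹ (b ⊠ c) :=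
  ascN f (𝟙 b) (𝟙 c) ≪≫ as a b c ◁ᵢ (Iso.refl f ⊠₂ tensorId b c)

def asB (a : B) {b b' : B} (f : b ⟶ b') (c : B) :
    (a ◂ f) ▹ c ≫ as a b' c ≅ as a b c ≫ a ◂ (f ▹ c) :=
  ascN (𝟙 a) f (𝟙 c)

def asC (a b : B) {c c' : B} (f : c ⟶ c') :
    (a ⊠ b) ◂ f ≫ as a b c' ≅ as a b c ≫ a ◂ b ◂ f :=
  ((tensorId a b).symm ⊠₂ Iso.refl f) ▷ᵢ as a b c' ≪≫ ascN (𝟙 a) (𝟙 b) f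

def aiN {a a' b b' c c' : B} (f : a ⟶ a') (g : b ⟶ b') (h : c ⟶ c') :
    f ⊠₁ (g ⊠₁ h) ≫ ai a' b' c' ≅ ai a b c ≫ f ⊠₁ g ⊠₁ h :=
  sqMate (asc a b c) (asc a' b' c') (ascN f g h)

def aiA {a a' : B} (f : a ⟶ a') (b c : B) : f ▹ (b ⊠ c) ≫ ai a' b c ≅ ai a b c ≫ f ▹ b ▹ c :=
  sqMate (asc a b c) (asc a' b c) (asA f b c)

def aiB (a : B) {b b' : B} (f : b ⟶ b') (c : B) :
    a ◂ (f ▹ c) ≫ ai a b' c ≅ ai a b c ≫ (a ◂ f) ▹ c :=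
  sqMate (asc a b c) (asc a b' c) (asB a f c)

def aiC (a b : B) {c c' : B} (f : c ⟶ c') :
    a ◂ b ◂ f ≫ ai a b c' ≅ ai a b c ≫ (a ⊠ b) ◂ f :=
  sqMate (asc a b c) (asc a b c') (asC a b f)

def btA {a a' : B} (f : a ⟶ a') (b : B) : f ▹ b ≫ bt a' b ≅ bt a b ≫ b ◂ f := brN f (𝟙 b)

def btB (a : B) {b b' : B} (f : b ⟶ b') : a ◂ f ≫ bt a b' ≅ bt a b ≫ f ▹ a := brN (𝟙 a) f

/-! Mates of the pentagonator. -/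

def pentI₁ (a b c d : B) :
    ai (a ⊠ b) c d ≫ as a b c ▹ d ≅ as a b (c ⊠ d) ≫ a ◂ ai b c d ≫ ai a (b ⊠ c) d :=
  (ρ_ _).symm ≪≫ (ai (a ⊠ b) c d ≫ as a b c ▹ d) ◁ᵢ (asc a (b ⊠ c) d).unit ≪⊗≫
    (ai (a ⊠ b) c d ≫ as a b c ▹ d ≫ as a (b ⊠ c) d) ◁ᵢ
      ((unitL a (asc b c d)).symm ▷ᵢ ai a (b ⊠ c) d) ≪⊗≫
    ai (a ⊠ b) c d ◁ᵢ (pent a b c d ▷ᵢ (a ◂ ai b c d ≫ ai a (b ⊠ c) d)) ≪⊗≫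
    (asc (a ⊠ b) c d).counit ▷ᵢ (as a b (c ⊠ d) ≫ a ◂ ai b c d ≫ ai a (b ⊠ c) d) ≪⊗≫
    Iso.refl (as a b (c ⊠ d) ≫ a ◂ ai b c d ≫ ai a (b ⊠ c) d)

def pentI₂ (a b c d : B) :
    ai a (b ⊠ c) d ≫ ai a b c ▹ d ≫ as (a ⊠ b) c d ≅ a ◂ as b c d ≫ ai a b (c ⊠ d) :=
  (ρ_ _).symm ≪≫ (ai a (b ⊠ c) d ≫ ai a b c ▹ d ≫ as (a ⊠ b) c d) ◁ᵢ (asc a b (c ⊠ d)).unit ≪⊗≫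
    (ai a (b ⊠ c) d ≫ ai a b c ▹ d) ◁ᵢ ((pent a b c d).symm ▷ᵢ ai a b (c ⊠ d)) ≪⊗≫
    ai a (b ⊠ c) d ◁ᵢ
      (counitR (asc a b c) d ▷ᵢ (as a (b ⊠ c) d ≫ a ◂ as b c d ≫ ai a b (c ⊠ d))) ≪⊗≫
    (asc a (b ⊠ c) d).counit ▷ᵢ (a ◂ as b c d ≫ ai a b (c ⊠ d)) ≪⊗≫
    Iso.refl (a ◂ as b c d ≫ ai a b (c ⊠ d))

def pentI (a b c d : B) :
    a ◂ ai b c d ≫ ai a (b ⊠ c) d ≫ ai a b c ▹ d ≅ ai a b (c ⊠ d) ≫ ai (a ⊠ b) c d :=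
  (ρ_ _).symm ≪≫ (a ◂ ai b c d ≫ ai a (b ⊠ c) d ≫ ai a b c ▹ d) ◁ᵢ (asc (a ⊠ b) c d).unit ≪⊗≫
    a ◂ ai b c d ◁ᵢ (pentI₂ a b c d ▷ᵢ ai (a ⊠ b) c d) ≪⊗≫
    counitL a (asc b c d) ▷ᵢ (ai a b (c ⊠ d) ≫ ai (a ⊠ b) c d) ≪⊗≫
    Iso.refl (ai a b (c ⊠ d) ≫ ai (a ⊠ b) c d)

/-! The hexagonators solved for the braiding with a tensor product. -/

def hexR' (a b c : B) :
    bt a (b ⊠ c) ≅ ai a b c ≫ bt a b ▹ c ≫ as b a c ≫ b ◂ bt a c ≫ ai b c a :=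
  Iso.refl (bt a (b ⊠ c)) ≪⊗≫ (asc a b c).counit.symm ▷ᵢ bt a (b ⊠ c) ≪⊗≫
    (ai a b c ≫ as a b c ≫ bt a (b ⊠ c)) ◁ᵢ (asc b c a).unit ≪⊗≫
    ai a b c ◁ᵢ (hexR a b c ▷ᵢ ai b c a) ≪⊗≫
    Iso.refl (ai a b c ≫ bt a b ▹ c ≫ as b a c ≫ b ◂ bt a c ≫ ai b c a)

def hexS' (a b c : B) :
    bt (a ⊠ b) c ≅ as a b c ≫ a ◂ bt b c ≫ ai a c b ≫ bt a c ▹ b ≫ as c a b :=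
  Iso.refl (bt (a ⊠ b) c) ≪⊗≫ (asc a b c).unit ▷ᵢ bt (a ⊠ b) c ≪⊗≫
    (as a b c ≫ ai a b c ≫ bt (a ⊠ b) c) ◁ᵢ (asc c a b).counit.symm ≪⊗≫
    as a b c ◁ᵢ (hexS a b c ▷ᵢ as c a b) ≪⊗≫
    Iso.refl (as a b c ≫ a ◂ bt b c ≫ ai a c b ≫ bt a c ▹ b ≫ as c a b)

end Derived

open SymMonBicatData in
/-- A symmetric monoidal bicategory. -/
class SymMonBicat (B : Type u) [Bicategory.{w, v} B] extends SymMonBicatData B where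
  -- pseudonaturality of the associator, the unitors and the braiding
  ascN_naturality {a a' b b' c c' : B} {f f₂ : a ⟶ a'} {g g₂ : b ⟶ b'} {h h₂ : c ⟶ c'}
    (η : f ⟶ f₂) (θ : g ⟶ g₂) (ζ : h ⟶ h₂) :
    tensorHom₂ (tensorHom₂ η θ) ζ ▷ as a' b' c' ≫ (ascN f₂ g₂ h₂).hom =
      (ascN f g h).hom ≫ as a b c ◁ tensorHom₂ η (tensorHom₂ θ ζ)
  ascN_id (a b c : B) :
    ascN (𝟙 a) (𝟙 b) (𝟙 c) ≪≫
        as a b c ◁ᵢ (Iso.refl (𝟙 a) ⊠₂ tensorId b c ≪≫ tensorId a (b ⊠ c)) =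
      (tensorId a b ⊠₂ Iso.refl (𝟙 c) ≪≫ tensorId (a ⊠ b) c) ▷ᵢ as a b c ≪≫ sqOne (as a b c)
  ascN_comp {a a' a'' b b' b'' c c' c'' : B} (f : a ⟶ a') (f' : a' ⟶ a'') (g : b ⟶ b')
    (g' : b' ⟶ b'') (h : c ⟶ c') (h' : c' ⟶ c'') :
    ascN (f ≫ f') (g ≫ g') (h ≫ h') ≪≫ as a b c ◁ᵢ
        (Iso.refl (f ≫ f') ⊠₂ tensorComp g g' h h' ≪≫ tensorComp f f' (g ⊠₁ h) (g' ⊠₁ h')) =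
      (tensorComp f f' g g' ⊠₂ Iso.refl (h ≫ h') ≪≫
          tensorComp (f ⊠₁ g) (f' ⊠₁ g') h h') ▷ᵢ as a'' b'' c'' ≪≫
        sqH (ascN f g h) (ascN f' g' h')
  luN_naturality {a a' : B} {f f₂ : a ⟶ a'} (η : f ⟶ f₂) :
    tensorHom₂ (𝟙 (𝟙 (one B))) η ▷ (lu a').hom ≫ (luN f₂).hom = (luN f).hom ≫ (lu a).hom ◁ η
  luN_id (a : B) : luN (𝟙 a) = tensorId (one B) a ▷ᵢ (lu a).hom ≪≫ sqOne (lu a).hom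
  luN_comp {a a' a'' : B} (f : a ⟶ a') (f' : a' ⟶ a'') :
    luN (f ≫ f') = (compL (one B) f f').symm ▷ᵢ (lu a'').hom ≪≫ sqH (luN f) (luN f')
  ruN_naturality {a a' : B} {f f₂ : a ⟶ a'} (η : f ⟶ f₂) :
    tensorHom₂ η (𝟙 (𝟙 (one B))) ▷ (ru a').hom ≫ (ruN f₂).hom = (ruN f).hom ≫ (ru a).hom ◁ η
  ruN_id (a : B) : ruN (𝟙 a) = tensorId a (one B) ▷ᵢ (ru a).hom ≪≫ sqOne (ru a).hom
  ruN_comp {a a' a'' : B} (f : a ⟶ a') (f' : a' ⟶ a'') :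
    ruN (f ≫ f') = (compR f f' (one B)).symm ▷ᵢ (ru a'').hom ≪≫ sqH (ruN f) (ruN f')
  brN_naturality {a a' b b' : B} {f f₂ : a ⟶ a'} {g g₂ : b ⟶ b'} (η : f ⟶ f₂) (θ : g ⟶ g₂) :
    tensorHom₂ η θ ▷ bt a' b' ≫ (brN f₂ g₂).hom = (brN f g).hom ≫ bt a b ◁ tensorHom₂ θ η
  brN_id (a b : B) :
    brN (𝟙 a) (𝟙 b) ≪≫ bt a b ◁ᵢ tensorId b a = tensorId a b ▷ᵢ bt a b ≪≫ sqOne (bt a b)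
  brN_comp {a a' a'' b b' b'' : B} (f : a ⟶ a') (f' : a' ⟶ a'') (g : b ⟶ b') (g' : b' ⟶ b'') :
    brN (f ≫ f') (g ≫ g') ≪≫ bt a b ◁ᵢ tensorComp g g' f f' =
      tensorComp f f' g g' ▷ᵢ bt a'' b'' ≪≫ sqH (brN f g) (brN f' g')
  -- the invertible 2-cells are modifications
  pent_mod {a a' b b' c c' d d' : B} (f : a ⟶ a') (g : b ⟶ b') (h : c ⟶ c') (k : d ⟶ d') :
    Compat (sqV (sqR (ascN f g h) k) (sqV (ascN f (g ⊠₁ h) k) (sqL f (ascN g h k))))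
      (sqV (ascN (f ⊠₁ g) h k) (ascN f g (h ⊠₁ k))) (pent a b c d) (pent a' b' c' d')
  mid_mod {a a' b b' : B} (f : a ⟶ a') (g : b ⟶ b') :
    Compat (sqV (ascN f (𝟙 (one B)) g) (sqL f (luN g))) (sqR (ruN f) g) (mid a b) (mid a' b')
  lun_mod {a a' b b' : B} (f : a ⟶ a') (g : b ⟶ b') :
    Compat (sqV (ascN (𝟙 (one B)) f g) (luN (f ⊠₁ g))) (sqR (luN f) g) (lun a b) (lun a' b')
  run_mod {a a' b b' : B} (f : a ⟶ a') (g : b ⟶ b') :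
    Compat (sqV (ascN f g (𝟙 (one B))) (sqL f (ruN g))) (ruN (f ⊠₁ g)) (run a b) (run a' b')
  hexR_mod {a a' b b' c c' : B} (f : a ⟶ a') (g : b ⟶ b') (h : c ⟶ c') :
    Compat (sqV (ascN f g h) (sqV (brN f (g ⊠₁ h)) (ascN g h f)))
      (sqV (sqR (brN f g) h) (sqV (ascN g f h) (sqL g (brN f h)))) (hexR a b c) (hexR a' b' c')
  hexS_mod {a a' b b' c c' : B} (f : a ⟶ a') (g : b ⟶ b') (h : c ⟶ c') :
    Compat (sqV (aiN f g h) (sqV (brN (f ⊠₁ g) h) (aiN h f g)))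
      (sqV (sqL f (brN g h)) (sqV (aiN f h g) (sqR (brN f h) g))) (hexS a b c) (hexS a' b' c')
  syl_mod {a a' b b' : B} (f : a ⟶ a') (g : b ⟶ b') :
    Compat (sqV (brN f g) (brN g f)) (sqId (f ⊠₁ g)) (syl a b) (syl a' b')
  /-- The non-abelian 4-cocycle (associahedron) axiom. -/
  pent_cocycle (a b c d e : B) :
    ((compR3 _ _ _ e ≪≫ isoR (pent a b c d) e ≪≫ (compR _ _ e).symm) ▷ᵢ
        (as a (b ⊠ (c ⊠ d)) e ≫ a ◂ as b (c ⊠ d) e ≫ a ◂ b ◂ as c d e)) ≪⊗≫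
      as (a ⊠ b) c d ▹ e ◁ᵢ (pent a b (c ⊠ d) e ▷ᵢ a ◂ b ◂ as c d e) ≪⊗≫
      (as (a ⊠ b) c d ▹ e ≫ as (a ⊠ b) (c ⊠ d) e) ◁ᵢ (asC a b (as c d e)).symm ≪⊗≫
      pent (a ⊠ b) c d e ▷ᵢ as a b (c ⊠ (d ⊠ e)) ≪⊗≫
      Iso.refl (as (a ⊠ b ⊠ c) d e ≫ as (a ⊠ b) c (d ⊠ e) ≫ as a b (c ⊠ (d ⊠ e))) =
    Iso.refl ((as a b c ▹ d ▹ e ≫ as a (b ⊠ c) d ▹ e ≫ (a ◂ as b c d) ▹ e) ≫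
        as a (b ⊠ (c ⊠ d)) e ≫ a ◂ as b (c ⊠ d) e ≫ a ◂ b ◂ as c d e) ≪⊗≫
      (as a b c ▹ d ▹ e ≫ as a (b ⊠ c) d ▹ e) ◁ᵢ
        (asB a (as b c d) e ▷ᵢ (a ◂ as b (c ⊠ d) e ≫ a ◂ b ◂ as c d e)) ≪⊗≫
      (as a b c ▹ d ▹ e ≫ as a (b ⊠ c) d ▹ e ≫ as a (b ⊠ c ⊠ d) e) ◁ᵢ
        (compL3 a _ _ _ ≪≫ isoL a (pent b c d e) ≪≫ (compL a _ _).symm) ≪⊗≫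
      as a b c ▹ d ▹ e ◁ᵢ (pent a (b ⊠ c) d e ▷ᵢ a ◂ as b c (d ⊠ e)) ≪⊗≫
      asA (as a b c) d e ▷ᵢ (as a (b ⊠ c) (d ⊠ e) ≫ a ◂ as b c (d ⊠ e)) ≪⊗≫
      as (a ⊠ b ⊠ c) d e ◁ᵢ pent a b c (d ⊠ e)
  /-- Left normalization. -/
  pent_left (a b c : B) :
    pent a (one B) b c ▷ᵢ a ◂ (lu (b ⊠ c)).hom ≪⊗≫
      as (a ⊠ one B) b c ◁ᵢ mid a (b ⊠ c) ≪⊗≫ (asA (ru a).hom b c).symm =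
    Iso.refl ((as a (one B) b ▹ c ≫ as a (one B ⊠ b) c ≫ a ◂ as (one B) b c) ≫
        a ◂ (lu (b ⊠ c)).hom) ≪⊗≫
      (as a (one B) b ▹ c ≫ as a (one B ⊠ b) c) ◁ᵢ (compL a _ _ ≪≫ isoL a (lun b c)) ≪⊗≫
      as a (one B) b ▹ c ◁ᵢ (asB a (lu b).hom c).symm ≪⊗≫
      (compR _ _ c ≪≫ isoR (mid a b) c) ▷ᵢ as a b c
  /-- Right normalization. -/
  pent_right (a b c : B) :
    pent a b (one B) c ▷ᵢ a ◂ b ◂ (lu c).hom ≪⊗≫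
      as (a ⊠ b) (one B) c ◁ᵢ (asC a b (lu c).hom).symm ≪⊗≫ mid (a ⊠ b) c ▷ᵢ as a b c =
    Iso.refl ((as a b (one B) ▹ c ≫ as a (b ⊠ one B) c ≫ a ◂ as b (one B) c) ≫
        a ◂ b ◂ (lu c).hom) ≪⊗≫
      (as a b (one B) ▹ c ≫ as a (b ⊠ one B) c) ◁ᵢ (compL a _ _ ≪≫ isoL a (mid b c)) ≪⊗≫
      as a b (one B) ▹ c ◁ᵢ (asB a (ru b).hom c).symm ≪⊗≫
      (compR _ _ c ≪≫ isoR (run a b) c) ▷ᵢ as a b c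
  /-- Braiding one object past three. -/
  braid_one_three (a b c d : B) :
    (compR3 _ _ _ d ≪≫ isoR (hexR a b c).symm d ≪≫ (compR3 _ _ _ d).symm) ▷ᵢ
        (as b (c ⊠ a) d ≫ b ◂ as c a d ≫ b ◂ c ◂ bt a d) ≪⊗≫
      (as a b c ▹ d ≫ bt a (b ⊠ c) ▹ d) ◁ᵢ (pent b c a d ▷ᵢ b ◂ c ◂ bt a d) ≪⊗≫
      (as a b c ▹ d ≫ bt a (b ⊠ c) ▹ d ≫ as (b ⊠ c) a d) ◁ᵢ (asC b c (bt a d)).symm ≪⊗≫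
      as a b c ▹ d ◁ᵢ ((hexR a (b ⊠ c) d).symm ▷ᵢ as b c (d ⊠ a)) ≪⊗≫
      (as a b c ▹ d ≫ as a (b ⊠ c) d ≫ bt a (b ⊠ c ⊠ d)) ◁ᵢ (pent b c d a).symm ≪⊗≫
      (as a b c ▹ d ≫ as a (b ⊠ c) d) ◁ᵢ
        ((btB a (as b c d)).symm ▷ᵢ (as b (c ⊠ d) a ≫ b ◂ as c d a)) ≪⊗≫
      pent a b c d ▷ᵢ (bt a (b ⊠ (c ⊠ d)) ≫ as b (c ⊠ d) a ≫ b ◂ as c d a) =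
    Iso.refl ((bt a b ▹ c ▹ d ≫ as b a c ▹ d ≫ (b ◂ bt a c) ▹ d) ≫
        as b (c ⊠ a) d ≫ b ◂ as c a d ≫ b ◂ c ◂ bt a d) ≪⊗≫
      (bt a b ▹ c ▹ d ≫ as b a c ▹ d) ◁ᵢ
        (asB b (bt a c) d ▷ᵢ (b ◂ as c a d ≫ b ◂ c ◂ bt a d)) ≪⊗≫
      (bt a b ▹ c ▹ d ≫ as b a c ▹ d ≫ as b (a ⊠ c) d) ◁ᵢ
        (compL3 b _ _ _ ≪≫ isoL b (hexR a c d).symm ≪≫ (compL3 b _ _ _).symm) ≪⊗≫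
      bt a b ▹ c ▹ d ◁ᵢ (pent b a c d ▷ᵢ (b ◂ bt a (c ⊠ d) ≫ b ◂ as c d a)) ≪⊗≫
      asA (bt a b) c d ▷ᵢ (as b a (c ⊠ d) ≫ b ◂ bt a (c ⊠ d) ≫ b ◂ as c d a) ≪⊗≫
      as (a ⊠ b) c d ◁ᵢ ((hexR a b (c ⊠ d)).symm ▷ᵢ b ◂ as c d a) ≪⊗≫
      Iso.refl ((as (a ⊠ b) c d ≫ as a b (c ⊠ d)) ≫
        bt a (b ⊠ (c ⊠ d)) ≫ as b (c ⊠ d) a ≫ b ◂ as c d a)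
  /-- Braiding three objects past one. -/
  braid_three_one (a b c d : B) :
    (compL3 a _ _ _ ≪≫ isoL a (hexS b c d).symm ≪≫ (compL3 a _ _ _).symm) ▷ᵢ
        (ai a (d ⊠ b) c ≫ ai a d b ▹ c ≫ bt a d ▹ b ▹ c) ≪⊗≫
      (a ◂ ai b c d ≫ a ◂ bt (b ⊠ c) d) ◁ᵢ (pentI a d b c ▷ᵢ bt a d ▹ b ▹ c) ≪⊗≫
      (a ◂ ai b c d ≫ a ◂ bt (b ⊠ c) d ≫ ai a d (b ⊠ c)) ◁ᵢ (aiA (bt a d) b c).symm ≪⊗≫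
      a ◂ ai b c d ◁ᵢ ((hexS a (b ⊠ c) d).symm ▷ᵢ ai (d ⊠ a) b c) ≪⊗≫
      (a ◂ ai b c d ≫ ai a (b ⊠ c) d ≫ bt (a ⊠ (b ⊠ c)) d) ◁ᵢ (pentI d a b c).symm ≪⊗≫
      (a ◂ ai b c d ≫ ai a (b ⊠ c) d) ◁ᵢ
        ((btA (ai a b c) d).symm ▷ᵢ (ai d (a ⊠ b) c ≫ ai d a b ▹ c)) ≪⊗≫
      pentI a b c d ▷ᵢ (bt (a ⊠ b ⊠ c) d ≫ ai d (a ⊠ b) c ≫ ai d a b ▹ c) =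
    Iso.refl ((a ◂ b ◂ bt c d ≫ a ◂ ai b d c ≫ a ◂ (bt b d ▹ c)) ≫
        ai a (d ⊠ b) c ≫ ai a d b ▹ c ≫ bt a d ▹ b ▹ c) ≪⊗≫
      (a ◂ b ◂ bt c d ≫ a ◂ ai b d c) ◁ᵢ
        (aiB a (bt b d) c ▷ᵢ (ai a d b ▹ c ≫ bt a d ▹ b ▹ c)) ≪⊗≫
      (a ◂ b ◂ bt c d ≫ a ◂ ai b d c ≫ ai a (b ⊠ d) c) ◁ᵢ
        (compR3 _ _ _ c ≪≫ isoR (hexS a b d).symm c ≪≫ (compR3 _ _ _ c).symm) ≪⊗≫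
      a ◂ b ◂ bt c d ◁ᵢ (pentI a b d c ▷ᵢ (bt (a ⊠ b) d ▹ c ≫ ai d a b ▹ c)) ≪⊗≫
      aiC a b (bt c d) ▷ᵢ (ai (a ⊠ b) d c ≫ bt (a ⊠ b) d ▹ c ≫ ai d a b ▹ c) ≪⊗≫
      ai a b (c ⊠ d) ◁ᵢ ((hexS (a ⊠ b) c d).symm ▷ᵢ ai d a b ▹ c) ≪⊗≫
      Iso.refl ((ai a b (c ⊠ d) ≫ ai (a ⊠ b) c d) ≫
        bt (a ⊠ b ⊠ c) d ≫ ai d (a ⊠ b) c ≫ ai d a b ▹ c)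
  /-- Braiding two objects past two. -/
  braid_two_two (a b c d : B) :
    hexR' (a ⊠ b) c d ≪⊗≫
      ai (a ⊠ b) c d ◁ᵢ ((isoR (hexS' a b c) d ≪≫ (compR5 _ _ _ _ _ d).symm) ▷ᵢ
        (as c (a ⊠ b) d ≫ c ◂ bt (a ⊠ b) d ≫ ai c d (a ⊠ b))) ≪⊗≫
      (ai (a ⊠ b) c d ≫ as a b c ▹ d ≫ (a ◂ bt b c) ▹ d ≫ ai a c b ▹ d ≫ bt a c ▹ b ▹ d ≫
          as c a b ▹ d ≫ as c (a ⊠ b) d) ◁ᵢ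
        ((isoL c (hexS' a b d) ≪≫ (compL5 c _ _ _ _ _).symm) ▷ᵢ ai c d (a ⊠ b)) ≪⊗≫
      pentI₁ a b c d ▷ᵢ ((a ◂ bt b c) ▹ d ≫ ai a c b ▹ d ≫ bt a c ▹ b ▹ d ≫
          as c a b ▹ d ≫ as c (a ⊠ b) d ≫ c ◂ as a b d ≫ c ◂ a ◂ bt b d ≫ c ◂ ai a d b ≫
          c ◂ (bt a d ▹ b) ≫ c ◂ as d a b ≫ ai c d (a ⊠ b)) ≪⊗≫
      (as a b (c ⊠ d) ≫ a ◂ ai b c d) ◁ᵢ ((aiB a (bt b c) d).symm ▷ᵢ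
        (ai a c b ▹ d ≫ bt a c ▹ b ▹ d ≫
          as c a b ▹ d ≫ as c (a ⊠ b) d ≫ c ◂ as a b d ≫ c ◂ a ◂ bt b d ≫ c ◂ ai a d b ≫
          c ◂ (bt a d ▹ b) ≫ c ◂ as d a b ≫ ai c d (a ⊠ b))) ≪⊗≫
      (as a b (c ⊠ d) ≫ a ◂ ai b c d ≫ a ◂ (bt b c ▹ d) ≫ ai a (c ⊠ b) d ≫ ai a c b ▹ d ≫
          bt a c ▹ b ▹ d) ◁ᵢ (pent c a b d ▷ᵢ
        (c ◂ a ◂ bt b d ≫ c ◂ ai a d b ≫ c ◂ (bt a d ▹ b) ≫ c ◂ as d a b ≫ ai c d (a ⊠ b))) ≪⊗≫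
      (as a b (c ⊠ d) ≫ a ◂ ai b c d ≫ a ◂ (bt b c ▹ d) ≫ ai a (c ⊠ b) d ≫ ai a c b ▹ d) ◁ᵢ
        (asA (bt a c) b d ▷ᵢ (as c a (b ⊠ d) ≫
          c ◂ a ◂ bt b d ≫ c ◂ ai a d b ≫ c ◂ (bt a d ▹ b) ≫ c ◂ as d a b ≫
          ai c d (a ⊠ b))) ≪⊗≫
      (as a b (c ⊠ d) ≫ a ◂ ai b c d ≫ a ◂ (bt b c ▹ d)) ◁ᵢ (pentI₂ a c b d ▷ᵢ
        (bt a c ▹ (b ⊠ d) ≫ as c a (b ⊠ d) ≫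
          c ◂ a ◂ bt b d ≫ c ◂ ai a d b ≫ c ◂ (bt a d ▹ b) ≫ c ◂ as d a b ≫
          ai c d (a ⊠ b))) ≪⊗≫
      (as a b (c ⊠ d) ≫ a ◂ ai b c d ≫ a ◂ (bt b c ▹ d) ≫ a ◂ as c b d ≫ ai a c (b ⊠ d) ≫
          bt a c ▹ (b ⊠ d)) ◁ᵢ ((asC c a (bt b d)).symm ▷ᵢ
        (c ◂ ai a d b ≫ c ◂ (bt a d ▹ b) ≫ c ◂ as d a b ≫ ai c d (a ⊠ b))) ≪⊗≫
      (as a b (c ⊠ d) ≫ a ◂ ai b c d ≫ a ◂ (bt b c ▹ d) ≫ a ◂ as c b d ≫ ai a c (b ⊠ d)) ◁ᵢ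
        (exch (bt a c) (bt b d) ▷ᵢ (as c a (d ⊠ b) ≫
          c ◂ ai a d b ≫ c ◂ (bt a d ▹ b) ≫ c ◂ as d a b ≫ ai c d (a ⊠ b))) ≪⊗≫
      (as a b (c ⊠ d) ≫ a ◂ ai b c d ≫ a ◂ (bt b c ▹ d) ≫ a ◂ as c b d) ◁ᵢ
        ((aiC a c (bt b d)).symm ▷ᵢ (bt a c ▹ (d ⊠ b) ≫ as c a (d ⊠ b) ≫
          c ◂ ai a d b ≫ c ◂ (bt a d ▹ b) ≫ c ◂ as d a b ≫ ai c d (a ⊠ b))) ≪⊗≫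
      Iso.refl (as a b (c ⊠ d) ≫ a ◂ ai b c d ≫ a ◂ (bt b c ▹ d) ≫ a ◂ as c b d ≫
        a ◂ c ◂ bt b d ≫ ai a c (d ⊠ b) ≫ bt a c ▹ (d ⊠ b) ≫ as c a (d ⊠ b) ≫
        c ◂ ai a d b ≫ c ◂ (bt a d ▹ b) ≫ c ◂ as d a b ≫ ai c d (a ⊠ b)) =
    hexS' a b (c ⊠ d) ≪⊗≫
      as a b (c ⊠ d) ◁ᵢ ((isoL a (hexR' b c d) ≪≫ (compL5 a _ _ _ _ _).symm) ▷ᵢ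
        (ai a (c ⊠ d) b ≫ bt a (c ⊠ d) ▹ b ≫ as (c ⊠ d) a b)) ≪⊗≫
      (as a b (c ⊠ d) ≫ a ◂ ai b c d ≫ a ◂ (bt b c ▹ d) ≫ a ◂ as c b d ≫ a ◂ c ◂ bt b d ≫
          a ◂ ai c d b ≫ ai a (c ⊠ d) b) ◁ᵢ
        ((isoR (hexR' a c d) b ≪≫ (compR5 _ _ _ _ _ b).symm) ▷ᵢ as (c ⊠ d) a b) ≪⊗≫
      (as a b (c ⊠ d) ≫ a ◂ ai b c d ≫ a ◂ (bt b c ▹ d) ≫ a ◂ as c b d ≫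
          a ◂ c ◂ bt b d) ◁ᵢ (pentI a c d b ▷ᵢ
        (bt a c ▹ d ▹ b ≫ as c a d ▹ b ≫ (c ◂ bt a d) ▹ b ≫ ai c d a ▹ b ≫
          as (c ⊠ d) a b)) ≪⊗≫
      (as a b (c ⊠ d) ≫ a ◂ ai b c d ≫ a ◂ (bt b c ▹ d) ≫ a ◂ as c b d ≫
          a ◂ c ◂ bt b d ≫ ai a c (d ⊠ b)) ◁ᵢ ((aiA (bt a c) d b).symm ▷ᵢ
        (as c a d ▹ b ≫ (c ◂ bt a d) ▹ b ≫ ai c d a ▹ b ≫ as (c ⊠ d) a b)) ≪⊗≫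
      (as a b (c ⊠ d) ≫ a ◂ ai b c d ≫ a ◂ (bt b c ▹ d) ≫ a ◂ as c b d ≫
          a ◂ c ◂ bt b d ≫ ai a c (d ⊠ b) ≫ bt a c ▹ (d ⊠ b)) ◁ᵢ (pentI₁ c a d b ▷ᵢ
        ((c ◂ bt a d) ▹ b ≫ ai c d a ▹ b ≫ as (c ⊠ d) a b)) ≪⊗≫
      (as a b (c ⊠ d) ≫ a ◂ ai b c d ≫ a ◂ (bt b c ▹ d) ≫ a ◂ as c b d ≫
          a ◂ c ◂ bt b d ≫ ai a c (d ⊠ b) ≫ bt a c ▹ (d ⊠ b) ≫ as c a (d ⊠ b) ≫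
          c ◂ ai a d b) ◁ᵢ ((aiB c (bt a d) b).symm ▷ᵢ (ai c d a ▹ b ≫ as (c ⊠ d) a b)) ≪⊗≫
      (as a b (c ⊠ d) ≫ a ◂ ai b c d ≫ a ◂ (bt b c ▹ d) ≫ a ◂ as c b d ≫
          a ◂ c ◂ bt b d ≫ ai a c (d ⊠ b) ≫ bt a c ▹ (d ⊠ b) ≫ as c a (d ⊠ b) ≫
          c ◂ ai a d b ≫ c ◂ (bt a d ▹ b)) ◁ᵢ pentI₂ c d a b ≪⊗≫
      Iso.refl (as a b (c ⊠ d) ≫ a ◂ ai b c d ≫ a ◂ (bt b c ▹ d) ≫ a ◂ as c b d ≫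
        a ◂ c ◂ bt b d ≫ ai a c (d ⊠ b) ≫ bt a c ▹ (d ⊠ b) ≫ as c a (d ⊠ b) ≫
        c ◂ ai a d b ≫ c ◂ (bt a d ▹ b) ≫ c ◂ as d a b ≫ ai c d (a ⊠ b))
  /-- The two derivations of the Yang–Baxter 2-cell agree. -/
  yang_baxter (a b c : B) :
    (hexR a b c).symm ▷ᵢ (ai b c a ≫ bt b c ▹ a ≫ as c b a) ≪⊗≫
      (as a b c ≫ bt a (b ⊠ c)) ◁ᵢ ((asc b c a).unit.symm ▷ᵢ (bt b c ▹ a ≫ as c b a)) ≪⊗≫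
      as a b c ◁ᵢ ((btB a (bt b c)).symm ▷ᵢ as c b a) ≪⊗≫
      (as a b c ≫ a ◂ bt b c) ◁ᵢ (hexR' a c b ▷ᵢ as c b a) ≪⊗≫
      (as a b c ≫ a ◂ bt b c ≫ ai a c b ≫ bt a c ▹ b ≫ as c a b ≫ c ◂ bt a b) ◁ᵢ
        (asc c b a).counit ≪⊗≫
      Iso.refl ((as a b c ≫ a ◂ bt b c ≫ ai a c b ≫ bt a c ▹ b ≫ as c a b) ≫ c ◂ bt a b) =
    Iso.refl ((bt a b ▹ c ≫ as b a c ≫ b ◂ bt a c) ≫ ai b c a ≫ bt b c ▹ a ≫ as c b a) ≪⊗≫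
      bt a b ▹ c ◁ᵢ (hexS' b a c).symm ≪⊗≫ btA (bt a b) c ≪⊗≫ hexS' a b c ▷ᵢ c ◂ bt a b
  -- the syllepsis axioms
  syl_left (a b c : B) :
    syl a (b ⊠ c) =
    hexR' a b c ▷ᵢ bt (b ⊠ c) a ≪⊗≫
      (ai a b c ≫ bt a b ▹ c ≫ as b a c ≫ b ◂ bt a c ≫ ai b c a) ◁ᵢ hexS' b c a ≪⊗≫
      (ai a b c ≫ bt a b ▹ c ≫ as b a c ≫ b ◂ bt a c) ◁ᵢ
        ((asc b c a).counit ▷ᵢ (b ◂ bt c a ≫ ai b a c ≫ bt b a ▹ c ≫ as a b c)) ≪⊗≫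
      (ai a b c ≫ bt a b ▹ c ≫ as b a c) ◁ᵢ
        ((compL b _ _ ≪≫ isoL b (syl a c) ≪≫ tensorId b (a ⊠ c)) ▷ᵢ
          (ai b a c ≫ bt b a ▹ c ≫ as a b c)) ≪⊗≫
      (ai a b c ≫ bt a b ▹ c) ◁ᵢ ((asc b a c).unit.symm ▷ᵢ (bt b a ▹ c ≫ as a b c)) ≪⊗≫
      ai a b c ◁ᵢ
        ((compR _ _ c ≪≫ isoR (syl a b) c ≪≫ tensorId (a ⊠ b) c) ▷ᵢ as a b c) ≪⊗≫
      (asc a b c).counit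
  syl_right (a b c : B) :
    syl (a ⊠ b) c =
    hexS' a b c ▷ᵢ bt c (a ⊠ b) ≪⊗≫
      (as a b c ≫ a ◂ bt b c ≫ ai a c b ≫ bt a c ▹ b ≫ as c a b) ◁ᵢ hexR' c a b ≪⊗≫
      (as a b c ≫ a ◂ bt b c ≫ ai a c b ≫ bt a c ▹ b) ◁ᵢ
        ((asc c a b).unit.symm ▷ᵢ (bt c a ▹ b ≫ as a c b ≫ a ◂ bt c b ≫ ai a b c)) ≪⊗≫
      (as a b c ≫ a ◂ bt b c ≫ ai a c b) ◁ᵢ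
        ((compR _ _ b ≪≫ isoR (syl a c) b ≪≫ tensorId (a ⊠ c) b) ▷ᵢ
          (as a c b ≫ a ◂ bt c b ≫ ai a b c)) ≪⊗≫
      (as a b c ≫ a ◂ bt b c) ◁ᵢ ((asc a c b).counit ▷ᵢ (a ◂ bt c b ≫ ai a b c)) ≪⊗≫
      as a b c ◁ᵢ
        ((compL a _ _ ≪≫ isoL a (syl b c) ≪≫ tensorId a (b ⊠ c)) ▷ᵢ ai a b c) ≪⊗≫
      (asc a b c).unit.symm
  /-- The symmetry axiom. -/
  syl_symm (a b : B) :
    syl a b ▷ᵢ bt a b ≪≫ λ_ (bt a b) =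
      α_ (bt a b) (bt b a) (bt a b) ≪≫ bt a b ◁ᵢ syl b a ≪≫ ρ_ (bt a b)

/-! ### Symmetric monoidal pseudofunctors -/

open SymMonBicatData

section Functors

variable {M : Type u₁} [Bicategory.{w₁, v₁} M] {N : Type u₂} [Bicategory.{w₂, v₂} N]
  {P : Type u₃} [Bicategory.{w₃, v₃} P]

/-- The structure cells of a symmetric monoidal pseudofunctor: a pseudofunctor with 1-morphisms
`χ : F x ⊗ F y ⟶ F (x ⊗ y)`, with pseudonaturality constraints `χN`, and `ι : 1 ⟶ F 1`, and
invertible 2-cells `ω`, `γ`, `δ`, `υ` comparing associators, unitors and braidings. -/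
structure SymMonFunctorData (M : Type u₁) [Bicategory.{w₁, v₁} M] [SymMonBicatData M]
    (N : Type u₂) [Bicategory.{w₂, v₂} N] [SymMonBicatData N] extends M ⥤ᵖ N where
  χ (x y : M) : obj x ⊠ obj y ⟶ obj (x ⊠ y)
  χN {x x' y y' : M} (f : x ⟶ x') (g : y ⟶ y') :
    map f ⊠₁ map g ≫ χ x' y' ≅ χ x y ≫ map (f ⊠₁ g)
  ι : one N ⟶ obj (one M)
  ω (x y z : M) :
    χ x y ▹ obj z ≫ χ (x ⊠ y) z ≫ map (as x y z) ≅
      as (obj x) (obj y) (obj z) ≫ obj x ◂ χ y z ≫ χ x (y ⊠ z)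
  γ (x : M) : ι ▹ obj x ≫ χ (one M) x ≫ map (lu x).hom ≅ (lu (obj x)).hom
  δ (x : M) : obj x ◂ ι ≫ χ x (one M) ≫ map (ru x).hom ≅ (ru (obj x)).hom
  υ (x y : M) : χ x y ≫ map (bt x y) ≅ bt (obj x) (obj y) ≫ χ y x

namespace SymMonFunctorData

section

variable [SymMonBicatData M] [SymMonBicatData N] (F : SymMonFunctorData M N)

def χA {x x' : M} (f : x ⟶ x') (y : M) :
    F.map f ▹ F.obj y ≫ F.χ x' y ≅ F.χ x y ≫ F.map (f ▹ y) :=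
  (Iso.refl (F.map f) ⊠₂ (F.mapId y).symm) ▷ᵢ F.χ x' y ≪≫ F.χN f (𝟙 y)

def χB (x : M) {y y' : M} (f : y ⟶ y') :
    F.obj x ◂ F.map f ≫ F.χ x y' ≅ F.χ x y ≫ F.map (x ◂ f) :=
  ((F.mapId x).symm ⊠₂ Iso.refl (F.map f)) ▷ᵢ F.χ x y' ≪≫ F.χN (𝟙 x) f

/-- The square on `ι`. -/
def ιN : 𝟙 (one N) ≫ F.ι ≅ F.ι ≫ F.map (𝟙 (one M)) :=
  sqOne F.ι ≪≫ F.ι ◁ᵢ (F.mapId (one M)).symm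

/-- The mate of `ω` for the inverse associators. -/
def ωI (x y z : M) :
    F.obj x ◂ F.χ y z ≫ F.χ x (y ⊠ z) ≫ F.map (ai x y z) ≅
      ai (F.obj x) (F.obj y) (F.obj z) ≫ F.χ x y ▹ F.obj z ≫ F.χ (x ⊠ y) z :=
  Iso.refl (F.obj x ◂ F.χ y z ≫ F.χ x (y ⊠ z) ≫ F.map (ai x y z)) ≪⊗≫
    (asc (F.obj x) (F.obj y) (F.obj z)).counit.symm ▷ᵢ
      (F.obj x ◂ F.χ y z ≫ F.χ x (y ⊠ z) ≫ F.map (ai x y z)) ≪⊗≫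
    ai (F.obj x) (F.obj y) (F.obj z) ◁ᵢ ((F.ω x y z).symm ▷ᵢ F.map (ai x y z)) ≪⊗≫
    (ai (F.obj x) (F.obj y) (F.obj z) ≫ F.χ x y ▹ F.obj z ≫ F.χ (x ⊠ y) z) ◁ᵢ
      funUnit F.toPseudofunctor (asc x y z) ≪⊗≫
    Iso.refl (ai (F.obj x) (F.obj y) (F.obj z) ≫ F.χ x y ▹ F.obj z ≫ F.χ (x ⊠ y) z)

end

section

variable [SymMonBicatData M]

def idω (x y z : M) :
    𝟙 (x ⊠ y) ▹ z ≫ 𝟙 (x ⊠ y ⊠ z) ≫ as x y z ≅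
      as x y z ≫ x ◂ 𝟙 (y ⊠ z) ≫ 𝟙 (x ⊠ (y ⊠ z)) :=
  tensorId (x ⊠ y) z ▷ᵢ (𝟙 _ ≫ as x y z) ≪⊗≫
    as x y z ◁ᵢ ((tensorId x (y ⊠ z)).symm ▷ᵢ 𝟙 (x ⊠ (y ⊠ z)))

def idγ (x : M) : 𝟙 (one M) ▹ x ≫ 𝟙 (one M ⊠ x) ≫ (lu x).hom ≅ (lu x).hom :=
  tensorId (one M) x ▷ᵢ (𝟙 _ ≫ (lu x).hom) ≪⊗≫ Iso.refl (lu x).hom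

def idδ (x : M) : x ◂ 𝟙 (one M) ≫ 𝟙 (x ⊠ one M) ≫ (ru x).hom ≅ (ru x).hom :=
  tensorId x (one M) ▷ᵢ (𝟙 _ ≫ (ru x).hom) ≪⊗≫ Iso.refl (ru x).hom

end

/-- The identity. -/
def id (M : Type u₁) [Bicategory.{w₁, v₁} M] [SymMonBicatData M] : SymMonFunctorData M M where
  toPseudofunctor := Pseudofunctor.id M
  χ x y := 𝟙 (x ⊠ y)
  χN f g := sqId (f ⊠₁ g)
  ι := 𝟙 (one M)
  ω x y z := idω x y z
  γ x := idγ x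
  δ x := idδ x
  υ x y := sqOne (bt x y)

section

variable [SymMonBicatData M] [SymMonBicatData N] [SymMonBicatData P]
  (F : SymMonFunctorData M N) (G : SymMonFunctorData N P)

def compω (x y z : M) :
    (G.χ (F.obj x) (F.obj y) ≫ G.map (F.χ x y)) ▹ G.obj (F.obj z) ≫
        (G.χ (F.obj (x ⊠ y)) (F.obj z) ≫ G.map (F.χ (x ⊠ y) z)) ≫ G.map (F.map (as x y z)) ≅
      as (G.obj (F.obj x)) (G.obj (F.obj y)) (G.obj (F.obj z)) ≫
        G.obj (F.obj x) ◂ (G.χ (F.obj y) (F.obj z) ≫ G.map (F.χ y z)) ≫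
          G.χ (F.obj x) (F.obj (y ⊠ z)) ≫ G.map (F.χ x (y ⊠ z)) :=
  (compR (G.χ (F.obj x) (F.obj y)) (G.map (F.χ x y)) (G.obj (F.obj z))).symm ▷ᵢ
      ((G.χ (F.obj (x ⊠ y)) (F.obj z) ≫ G.map (F.χ (x ⊠ y) z)) ≫
        G.map (F.map (as x y z))) ≪⊗≫
    G.χ (F.obj x) (F.obj y) ▹ G.obj (F.obj z) ◁ᵢ (G.χA (F.χ x y) (F.obj z) ▷ᵢ
      (G.map (F.χ (x ⊠ y) z) ≫ G.map (F.map (as x y z)))) ≪⊗≫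
    (G.χ (F.obj x) (F.obj y) ▹ G.obj (F.obj z) ≫ G.χ (F.obj x ⊠ F.obj y) (F.obj z)) ◁ᵢ
      (fun3 G.toPseudofunctor _ _ _ ≪≫ G.map₂Iso (F.ω x y z) ≪≫
        (fun3 G.toPseudofunctor _ _ _).symm) ≪⊗≫
    G.ω (F.obj x) (F.obj y) (F.obj z) ▷ᵢ
      (G.map (F.obj x ◂ F.χ y z) ≫ G.map (F.χ x (y ⊠ z))) ≪⊗≫
    (as (G.obj (F.obj x)) (G.obj (F.obj y)) (G.obj (F.obj z)) ≫
        G.obj (F.obj x) ◂ G.χ (F.obj y) (F.obj z)) ◁ᵢ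
      ((G.χB (F.obj x) (F.χ y z)).symm ▷ᵢ G.map (F.χ x (y ⊠ z))) ≪⊗≫
    as (G.obj (F.obj x)) (G.obj (F.obj y)) (G.obj (F.obj z)) ◁ᵢ
      (compL (G.obj (F.obj x)) (G.χ (F.obj y) (F.obj z)) (G.map (F.χ y z)) ▷ᵢ
        (G.χ (F.obj x) (F.obj (y ⊠ z)) ≫ G.map (F.χ x (y ⊠ z))))

def compγ (x : M) :
    (G.ι ≫ G.map F.ι) ▹ G.obj (F.obj x) ≫
        (G.χ (F.obj (one M)) (F.obj x) ≫ G.map (F.χ (one M) x)) ≫ G.map (F.map (lu x).hom) ≅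
      (lu (G.obj (F.obj x))).hom :=
  (compR G.ι (G.map F.ι) (G.obj (F.obj x))).symm ▷ᵢ
      ((G.χ (F.obj (one M)) (F.obj x) ≫ G.map (F.χ (one M) x)) ≫
        G.map (F.map (lu x).hom)) ≪⊗≫
    G.ι ▹ G.obj (F.obj x) ◁ᵢ (G.χA F.ι (F.obj x) ▷ᵢ
      (G.map (F.χ (one M) x) ≫ G.map (F.map (lu x).hom))) ≪⊗≫
    (G.ι ▹ G.obj (F.obj x) ≫ G.χ (one N) (F.obj x)) ◁ᵢ
      (fun3 G.toPseudofunctor _ _ _ ≪≫ G.map₂Iso (F.γ x)) ≪⊗≫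
    G.γ (F.obj x)

def compδ (x : M) :
    G.obj (F.obj x) ◂ (G.ι ≫ G.map F.ι) ≫
        (G.χ (F.obj x) (F.obj (one M)) ≫ G.map (F.χ x (one M))) ≫ G.map (F.map (ru x).hom) ≅
      (ru (G.obj (F.obj x))).hom :=
  (compL (G.obj (F.obj x)) G.ι (G.map F.ι)).symm ▷ᵢ
      ((G.χ (F.obj x) (F.obj (one M)) ≫ G.map (F.χ x (one M))) ≫
        G.map (F.map (ru x).hom)) ≪⊗≫
    G.obj (F.obj x) ◂ G.ι ◁ᵢ (G.χB (F.obj x) F.ι ▷ᵢ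
      (G.map (F.χ x (one M)) ≫ G.map (F.map (ru x).hom))) ≪⊗≫
    (G.obj (F.obj x) ◂ G.ι ≫ G.χ (F.obj x) (one N)) ◁ᵢ
      (fun3 G.toPseudofunctor _ _ _ ≪≫ G.map₂Iso (F.δ x)) ≪⊗≫
    G.δ (F.obj x)

def compυ (x y : M) :
    (G.χ (F.obj x) (F.obj y) ≫ G.map (F.χ x y)) ≫ G.map (F.map (bt x y)) ≅
      bt (G.obj (F.obj x)) (G.obj (F.obj y)) ≫ G.χ (F.obj y) (F.obj x) ≫ G.map (F.χ y x) :=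
  α_ _ _ _ ≪≫
    G.χ (F.obj x) (F.obj y) ◁ᵢ
      (fun2 G.toPseudofunctor _ _ ≪≫ G.map₂Iso (F.υ x y) ≪≫
        (fun2 G.toPseudofunctor _ _).symm) ≪⊗≫
    G.υ (F.obj x) (F.obj y) ▷ᵢ G.map (F.χ y x) ≪≫ α_ _ _ _

end

/-- The composite, `F` first. -/
def comp [SymMonBicatData M] [SymMonBicatData N] [SymMonBicatData P]
    (F : SymMonFunctorData M N) (G : SymMonFunctorData N P) : SymMonFunctorData M P where
  toPseudofunctor := F.toPseudofunctor.comp G.toPseudofunctor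
  χ x y := G.χ (F.obj x) (F.obj y) ≫ G.map (F.χ x y)
  χN f g := sqV (G.χN (F.map f) (F.map g)) (sqMap G.toPseudofunctor (F.χN f g))
  ι := G.ι ≫ G.map F.ι
  ω x y z := compω F G x y z
  γ x := compγ F G x
  δ x := compδ F G x
  υ x y := compυ F G x y

end SymMonFunctorData

/-- A symmetric monoidal pseudofunctor (symmetric monoidal homomorphism). -/
structure SymMonFunctor (M : Type u₁) [Bicategory.{w₁, v₁} M] [SymMonBicat M]
    (N : Type u₂) [Bicategory.{w₂, v₂} N] [SymMonBicat N] extends SymMonFunctorData M N where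
  χ_equiv (x y : M) : IsEquiv (χ x y)
  ι_equiv : IsEquiv ι
  -- pseudonaturality of `χ`
  χN_naturality {x x' y y' : M} {f f₂ : x ⟶ x'} {g g₂ : y ⟶ y'} (η : f ⟶ f₂) (θ : g ⟶ g₂) :
    tensorHom₂ (map₂ η) (map₂ θ) ▷ χ x' y' ≫ (χN f₂ g₂).hom =
      (χN f g).hom ≫ χ x y ◁ map₂ (tensorHom₂ η θ)
  χN_id (x y : M) :
    χN (𝟙 x) (𝟙 y) ≪≫
        χ x y ◁ᵢ (toPseudofunctor.map₂Iso (tensorId x y) ≪≫ mapId (x ⊠ y)) =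
      (mapId x ⊠₂ mapId y ≪≫ tensorId (obj x) (obj y)) ▷ᵢ χ x y ≪≫ sqOne (χ x y)
  χN_comp {x x' x'' y y' y'' : M} (f : x ⟶ x') (f' : x' ⟶ x'') (g : y ⟶ y') (g' : y' ⟶ y'') :
    χN (f ≫ f') (g ≫ g') ≪≫ χ x y ◁ᵢ
        (toPseudofunctor.map₂Iso (tensorComp f f' g g') ≪≫ mapComp (f ⊠₁ g) (f' ⊠₁ g')) =
      (mapComp f f' ⊠₂ mapComp g g' ≪≫ tensorComp (map f) (map f') (map g) (map g')) ▷ᵢ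
          χ x'' y'' ≪≫
        sqH (χN f g) (χN f' g')
  -- `ω`, `γ`, `δ` and `υ` are modifications
  ω_mod {x x' y y' z z' : M} (f : x ⟶ x') (g : y ⟶ y') (h : z ⟶ z') :
    Compat
      (sqV (sqR (χN f g) (map h)) (sqV (χN (f ⊠₁ g) h) (sqMap toPseudofunctor (ascN f g h))))
      (sqV (ascN (map f) (map g) (map h)) (sqV (sqL (map f) (χN g h)) (χN f (g ⊠₁ h))))
      (ω x y z) (ω x' y' z')
  γ_mod {x x' : M} (f : x ⟶ x') :
    Compat
      (sqV (sqR toSymMonFunctorData.ιN (map f))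
        (sqV (χN (𝟙 (one M)) f) (sqMap toPseudofunctor (luN f))))
      (luN (map f)) (γ x) (γ x')
  δ_mod {x x' : M} (f : x ⟶ x') :
    Compat
      (sqV (sqL (map f) toSymMonFunctorData.ιN)
        (sqV (χN f (𝟙 (one M))) (sqMap toPseudofunctor (ruN f))))
      (ruN (map f)) (δ x) (δ x')
  υ_mod {x x' y y' : M} (f : x ⟶ x') (g : y ⟶ y') :
    Compat (sqV (χN f g) (sqMap toPseudofunctor (brN f g)))
      (sqV (brN (map f) (map g)) (χN g f)) (υ x y) (υ x' y')
  /-- Compatibility with the pentagonators. -/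
  pent_coh (x y z t : M) :
    (χ x y ▹ obj z ▹ obj t ≫ χ (x ⊠ y) z ▹ obj t ≫ χ (x ⊠ y ⊠ z) t) ◁ᵢ
        (fun3 toPseudofunctor _ _ _ ≪≫ toPseudofunctor.map₂Iso (pent x y z t) ≪≫
          (fun2 toPseudofunctor _ _).symm) ≪⊗≫
      χ x y ▹ obj z ▹ obj t ◁ᵢ (ω (x ⊠ y) z t ▷ᵢ map (as x y (z ⊠ t))) ≪⊗≫
      asA (χ x y) (obj z) (obj t) ▷ᵢ
        (obj (x ⊠ y) ◂ χ z t ≫ χ (x ⊠ y) (z ⊠ t) ≫ map (as x y (z ⊠ t))) ≪⊗≫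
      as (obj x ⊠ obj y) (obj z) (obj t) ◁ᵢ (exch (χ x y) (χ z t) ▷ᵢ
        (χ (x ⊠ y) (z ⊠ t) ≫ map (as x y (z ⊠ t)))) ≪⊗≫
      (as (obj x ⊠ obj y) (obj z) (obj t) ≫ (obj x ⊠ obj y) ◂ χ z t) ◁ᵢ ω x y (z ⊠ t) ≪⊗≫
      as (obj x ⊠ obj y) (obj z) (obj t) ◁ᵢ (asC (obj x) (obj y) (χ z t) ▷ᵢ
        (obj x ◂ χ y (z ⊠ t) ≫ χ x (y ⊠ (z ⊠ t)))) ≪⊗≫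
      Iso.refl ((as (obj x ⊠ obj y) (obj z) (obj t) ≫ as (obj x) (obj y) (obj z ⊠ obj t)) ≫
        obj x ◂ obj y ◂ χ z t ≫ obj x ◂ χ y (z ⊠ t) ≫ χ x (y ⊠ (z ⊠ t))) =
    Iso.refl ((χ x y ▹ obj z ▹ obj t ≫ χ (x ⊠ y) z ▹ obj t ≫ χ (x ⊠ y ⊠ z) t) ≫
        map (as x y z ▹ t) ≫ map (as x (y ⊠ z) t) ≫ map (x ◂ as y z t)) ≪⊗≫
      (χ x y ▹ obj z ▹ obj t ≫ χ (x ⊠ y) z ▹ obj t) ◁ᵢ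
        ((toSymMonFunctorData.χA (as x y z) t).symm ▷ᵢ
          (map (as x (y ⊠ z) t) ≫ map (x ◂ as y z t))) ≪⊗≫
      (compR3 _ _ _ (obj t) ≪≫ isoR (ω x y z) (obj t) ≪≫ (compR3 _ _ _ (obj t)).symm) ▷ᵢ
        (χ (x ⊠ (y ⊠ z)) t ≫ map (as x (y ⊠ z) t) ≫ map (x ◂ as y z t)) ≪⊗≫
      (as (obj x) (obj y) (obj z) ▹ obj t ≫ (obj x ◂ χ y z) ▹ obj t) ◁ᵢ
        (ω x (y ⊠ z) t ▷ᵢ map (x ◂ as y z t)) ≪⊗≫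
      (as (obj x) (obj y) (obj z) ▹ obj t ≫ (obj x ◂ χ y z) ▹ obj t ≫
          as (obj x) (obj (y ⊠ z)) (obj t) ≫ obj x ◂ χ (y ⊠ z) t) ◁ᵢ
        (toSymMonFunctorData.χB x (as y z t)).symm ≪⊗≫
      as (obj x) (obj y) (obj z) ▹ obj t ◁ᵢ (asB (obj x) (χ y z) (obj t) ▷ᵢ
        (obj x ◂ χ (y ⊠ z) t ≫ obj x ◂ map (as y z t) ≫ χ x (y ⊠ (z ⊠ t)))) ≪⊗≫
      (as (obj x) (obj y) (obj z) ▹ obj t ≫ as (obj x) (obj y ⊠ obj z) (obj t)) ◁ᵢ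
        ((compL3 (obj x) _ _ _ ≪≫ isoL (obj x) (ω y z t) ≪≫ (compL3 (obj x) _ _ _).symm) ▷ᵢ
          χ x (y ⊠ (z ⊠ t))) ≪⊗≫
      pent (obj x) (obj y) (obj z) (obj t) ▷ᵢ
        (obj x ◂ obj y ◂ χ z t ≫ obj x ◂ χ y (z ⊠ t) ≫ χ x (y ⊠ (z ⊠ t)))
  /-- Compatibility with the 2-unitors. -/
  mid_coh (x y : M) :
    ((obj x ◂ ι) ▹ obj y ≫ χ x (one M) ▹ obj y ≫ χ (x ⊠ one M) y) ◁ᵢ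
        (fun2 toPseudofunctor _ _ ≪≫ toPseudofunctor.map₂Iso (mid x y)) ≪⊗≫
      ((obj x ◂ ι) ▹ obj y ≫ χ x (one M) ▹ obj y) ◁ᵢ
        (toSymMonFunctorData.χA (ru x).hom y).symm ≪⊗≫
      (compR3 _ _ _ (obj y) ≪≫ isoR (δ x) (obj y)) ▷ᵢ χ x y =
    Iso.refl (((obj x ◂ ι) ▹ obj y ≫ χ x (one M) ▹ obj y ≫ χ (x ⊠ one M) y) ≫
        map (as x (one M) y) ≫ map (x ◂ (lu y).hom)) ≪⊗≫
      (obj x ◂ ι) ▹ obj y ◁ᵢ (ω x (one M) y ▷ᵢ map (x ◂ (lu y).hom)) ≪⊗≫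
      ((obj x ◂ ι) ▹ obj y ≫ as (obj x) (obj (one M)) (obj y) ≫ obj x ◂ χ (one M) y) ◁ᵢ
        (toSymMonFunctorData.χB x (lu y).hom).symm ≪⊗≫
      asB (obj x) ι (obj y) ▷ᵢ (obj x ◂ χ (one M) y ≫ obj x ◂ map (lu y).hom ≫ χ x y) ≪⊗≫
      as (obj x) (one N) (obj y) ◁ᵢ
        ((compL3 (obj x) _ _ _ ≪≫ isoL (obj x) (γ y)) ▷ᵢ χ x y) ≪⊗≫
      mid (obj x) (obj y) ▷ᵢ χ x y
  /-- Compatibility with the first hexagonators. -/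
  hexR_coh (x y z : M) :
    (χ x y ▹ obj z ≫ χ (x ⊠ y) z) ◁ᵢ
        (fun3 toPseudofunctor _ _ _ ≪≫ toPseudofunctor.map₂Iso (hexR x y z) ≪≫
          (fun3 toPseudofunctor _ _ _).symm) ≪⊗≫
      χ x y ▹ obj z ◁ᵢ ((toSymMonFunctorData.χA (bt x y) z).symm ▷ᵢ
        (map (as y x z) ≫ map (y ◂ bt x z))) ≪⊗≫
      (compR _ _ (obj z) ≪≫ isoR (υ x y) (obj z) ≪≫ (compR _ _ (obj z)).symm) ▷ᵢ
        (χ (y ⊠ x) z ≫ map (as y x z) ≫ map (y ◂ bt x z)) ≪⊗≫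
      bt (obj x) (obj y) ▹ obj z ◁ᵢ (ω y x z ▷ᵢ map (y ◂ bt x z)) ≪⊗≫
      (bt (obj x) (obj y) ▹ obj z ≫ as (obj y) (obj x) (obj z) ≫ obj y ◂ χ x z) ◁ᵢ
        (toSymMonFunctorData.χB y (bt x z)).symm ≪⊗≫
      (bt (obj x) (obj y) ▹ obj z ≫ as (obj y) (obj x) (obj z)) ◁ᵢ
        ((compL (obj y) _ _ ≪≫ isoL (obj y) (υ x z) ≪≫ (compL (obj y) _ _).symm) ▷ᵢ
          χ y (z ⊠ x)) ≪⊗≫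
      Iso.refl ((bt (obj x) (obj y) ▹ obj z ≫ as (obj y) (obj x) (obj z) ≫
        obj y ◂ bt (obj x) (obj z)) ≫ obj y ◂ χ z x ≫ χ y (z ⊠ x)) =
    Iso.refl ((χ x y ▹ obj z ≫ χ (x ⊠ y) z) ≫
        map (as x y z) ≫ map (bt x (y ⊠ z)) ≫ map (as y z x)) ≪⊗≫
      ω x y z ▷ᵢ (map (bt x (y ⊠ z)) ≫ map (as y z x)) ≪⊗≫
      (as (obj x) (obj y) (obj z) ≫ obj x ◂ χ y z) ◁ᵢ (υ x (y ⊠ z) ▷ᵢ map (as y z x)) ≪⊗≫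
      as (obj x) (obj y) (obj z) ◁ᵢ (btB (obj x) (χ y z) ▷ᵢ
        (χ (y ⊠ z) x ≫ map (as y z x))) ≪⊗≫
      (as (obj x) (obj y) (obj z) ≫ bt (obj x) (obj y ⊠ obj z)) ◁ᵢ ω y z x ≪⊗≫
      hexR (obj x) (obj y) (obj z) ▷ᵢ (obj y ◂ χ z x ≫ χ y (z ⊠ x))
  /-- Compatibility with the second hexagonators. -/
  hexS_coh (x y z : M) :
    (obj x ◂ χ y z ≫ χ x (y ⊠ z)) ◁ᵢ
        (fun3 toPseudofunctor _ _ _ ≪≫ toPseudofunctor.map₂Iso (hexS x y z) ≪≫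
          (fun3 toPseudofunctor _ _ _).symm) ≪⊗≫
      obj x ◂ χ y z ◁ᵢ ((toSymMonFunctorData.χB x (bt y z)).symm ▷ᵢ
        (map (ai x z y) ≫ map (bt x z ▹ y))) ≪⊗≫
      (compL (obj x) _ _ ≪≫ isoL (obj x) (υ y z) ≪≫ (compL (obj x) _ _).symm) ▷ᵢ
        (χ x (z ⊠ y) ≫ map (ai x z y) ≫ map (bt x z ▹ y)) ≪⊗≫
      obj x ◂ bt (obj y) (obj z) ◁ᵢ
        (toSymMonFunctorData.ωI x z y ▷ᵢ map (bt x z ▹ y)) ≪⊗≫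
      (obj x ◂ bt (obj y) (obj z) ≫ ai (obj x) (obj z) (obj y) ≫ χ x z ▹ obj y) ◁ᵢ
        (toSymMonFunctorData.χA (bt x z) y).symm ≪⊗≫
      (obj x ◂ bt (obj y) (obj z) ≫ ai (obj x) (obj z) (obj y)) ◁ᵢ
        ((compR _ _ (obj y) ≪≫ isoR (υ x z) (obj y) ≪≫ (compR _ _ (obj y)).symm) ▷ᵢ
          χ (z ⊠ x) y) ≪⊗≫
      Iso.refl ((obj x ◂ bt (obj y) (obj z) ≫ ai (obj x) (obj z) (obj y) ≫
        bt (obj x) (obj z) ▹ obj y) ≫ χ z x ▹ obj y ≫ χ (z ⊠ x) y) =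
    Iso.refl ((obj x ◂ χ y z ≫ χ x (y ⊠ z)) ≫
        map (ai x y z) ≫ map (bt (x ⊠ y) z) ≫ map (ai z x y)) ≪⊗≫
      toSymMonFunctorData.ωI x y z ▷ᵢ (map (bt (x ⊠ y) z) ≫ map (ai z x y)) ≪⊗≫
      (ai (obj x) (obj y) (obj z) ≫ χ x y ▹ obj z) ◁ᵢ (υ (x ⊠ y) z ▷ᵢ map (ai z x y)) ≪⊗≫
      ai (obj x) (obj y) (obj z) ◁ᵢ (btA (χ x y) (obj z) ▷ᵢ
        (χ z (x ⊠ y) ≫ map (ai z x y))) ≪⊗≫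
      (ai (obj x) (obj y) (obj z) ≫ bt (obj x ⊠ obj y) (obj z)) ◁ᵢ
        toSymMonFunctorData.ωI z x y ≪⊗≫
      hexS (obj x) (obj y) (obj z) ▷ᵢ (χ z x ▹ obj y ≫ χ (z ⊠ x) y)
  /-- Compatibility with the syllepses. -/
  syl_coh (x y : M) :
    χ x y ◁ᵢ (fun2 toPseudofunctor _ _ ≪≫ toPseudofunctor.map₂Iso (syl x y) ≪≫
        mapId (x ⊠ y)) ≪⊗≫ Iso.refl (χ x y) =
    Iso.refl (χ x y ≫ map (bt x y) ≫ map (bt y x)) ≪⊗≫ υ x y ▷ᵢ map (bt y x) ≪⊗≫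
      bt (obj x) (obj y) ◁ᵢ υ y x ≪⊗≫ syl (obj x) (obj y) ▷ᵢ χ x y ≪⊗≫ Iso.refl (χ x y)

/-! ### Symmetric monoidal transformations and equivalences -/

/-- A symmetric monoidal transformation. Only the structure cells of its source and target enter,
so that they may be composites. -/
structure SymMonTrans [SymMonBicatData M] [SymMonBicatData N] (F G : SymMonFunctorData M N) extends
    Pseudofunctor.StrongTrans F.toPseudofunctor G.toPseudofunctor where
  m₂ (x y : M) : F.χ x y ≫ app (x ⊠ y) ≅ app x ⊠₁ app y ≫ G.χ x y
  m₀ : F.ι ≫ app (one M) ≅ G.ι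
  m₂_mod {x x' y y' : M} (f : x ⟶ x') (g : y ⟶ y') :
    Compat (sqV (F.χN f g) (naturality (f ⊠₁ g)))
      (sqV (sqT (naturality f) (naturality g)) (G.χN f g)) (m₂ x y) (m₂ x' y')
  /-- Compatibility with the associativity constraints. -/
  ω_coh (x y z : M) :
    F.ω x y z ▷ᵢ app (x ⊠ (y ⊠ z)) ≪⊗≫
      (as (F.obj x) (F.obj y) (F.obj z) ≫ F.obj x ◂ F.χ y z) ◁ᵢ m₂ x (y ⊠ z) ≪⊗≫
      as (F.obj x) (F.obj y) (F.obj z) ◁ᵢ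
        (sqT (sqOne (app x)) (m₂ y z) ▷ᵢ G.χ x (y ⊠ z)) ≪⊗≫
      (ascN (app x) (app y) (app z)).symm ▷ᵢ (G.obj x ◂ G.χ y z ≫ G.χ x (y ⊠ z)) ≪⊗≫
      Iso.refl (app x ⊠₁ app y ⊠₁ app z ≫ as (G.obj x) (G.obj y) (G.obj z) ≫
        G.obj x ◂ G.χ y z ≫ G.χ x (y ⊠ z)) =
    Iso.refl ((F.χ x y ▹ F.obj z ≫ F.χ (x ⊠ y) z ≫ F.map (as x y z)) ≫
        app (x ⊠ (y ⊠ z))) ≪⊗≫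
      (F.χ x y ▹ F.obj z ≫ F.χ (x ⊠ y) z) ◁ᵢ naturality (as x y z) ≪⊗≫
      F.χ x y ▹ F.obj z ◁ᵢ (m₂ (x ⊠ y) z ▷ᵢ G.map (as x y z)) ≪⊗≫
      sqT (m₂ x y) (sqOne (app z)) ▷ᵢ (G.χ (x ⊠ y) z ≫ G.map (as x y z)) ≪⊗≫
      app x ⊠₁ app y ⊠₁ app z ◁ᵢ G.ω x y z
  /-- Compatibility with the left unit constraints. -/
  γ_coh (x : M) :
    F.γ x ▷ᵢ app x ≪≫ (luN (app x)).symm =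
    Iso.refl ((F.ι ▹ F.obj x ≫ F.χ (one M) x ≫ F.map (lu x).hom) ≫ app x) ≪⊗≫
      (F.ι ▹ F.obj x ≫ F.χ (one M) x) ◁ᵢ naturality (lu x).hom ≪⊗≫
      F.ι ▹ F.obj x ◁ᵢ (m₂ (one M) x ▷ᵢ G.map (lu x).hom) ≪⊗≫
      sqT (m₀ ≪≫ (λ_ G.ι).symm) (sqOne (app x)) ▷ᵢ
        (G.χ (one M) x ≫ G.map (lu x).hom) ≪⊗≫
      one N ◂ app x ◁ᵢ G.γ x
  /-- Compatibility with the right unit constraints. -/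
  δ_coh (x : M) :
    F.δ x ▷ᵢ app x ≪≫ (ruN (app x)).symm =
    Iso.refl ((F.obj x ◂ F.ι ≫ F.χ x (one M) ≫ F.map (ru x).hom) ≫ app x) ≪⊗≫
      (F.obj x ◂ F.ι ≫ F.χ x (one M)) ◁ᵢ naturality (ru x).hom ≪⊗≫
      F.obj x ◂ F.ι ◁ᵢ (m₂ x (one M) ▷ᵢ G.map (ru x).hom) ≪⊗≫
      sqT (sqOne (app x)) (m₀ ≪≫ (λ_ G.ι).symm) ▷ᵢ
        (G.χ x (one M) ≫ G.map (ru x).hom) ≪⊗≫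
      app x ▹ one N ◁ᵢ G.δ x
  /-- Compatibility with the braiding constraints. -/
  υ_coh (x y : M) :
    F.υ x y ▷ᵢ app (y ⊠ x) ≪⊗≫ bt (F.obj x) (F.obj y) ◁ᵢ m₂ y x ≪⊗≫
      (brN (app x) (app y)).symm ▷ᵢ G.χ y x ≪⊗≫
      Iso.refl (app x ⊠₁ app y ≫ bt (G.obj x) (G.obj y) ≫ G.χ y x) =
    Iso.refl ((F.χ x y ≫ F.map (bt x y)) ≫ app (y ⊠ x)) ≪⊗≫
      F.χ x y ◁ᵢ naturality (bt x y) ≪⊗≫ m₂ x y ▷ᵢ G.map (bt x y) ≪⊗≫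
      app x ⊠₁ app y ◁ᵢ G.υ x y

/-- An equivalence of symmetric monoidal bicategories: symmetric monoidal pseudofunctors in both
directions whose composites are equivalent to the identities by symmetric monoidal
transformations. -/
structure SymMonEquivalence (M : Type u₁) [Bicategory.{w₁, v₁} M] [SymMonBicat M]
    (N : Type u₂) [Bicategory.{w₂, v₂} N] [SymMonBicat N] where
  F : SymMonFunctor M N
  G : SymMonFunctor N M
  unit : SymMonTrans (SymMonFunctorData.id M) (F.toSymMonFunctorData.comp G.toSymMonFunctorData)
  unit_equiv (x : M) : IsEquiv (unit.app x)
  counit : SymMonTrans (G.toSymMonFunctorData.comp F.toSymMonFunctorData) (SymMonFunctorData.id N)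
  counit_equiv (y : N) : IsEquiv (counit.app y)

end Functors

/-! ### The symmetric monoidal bicategory of a 3-term cochain complex -/

/-- The bicategory `D` of a complex `C¹ ⟶ C² ⟶ C³` of abelian groups (`C¹ = S.X₁`, `C² = S.X₂`,
`C³ = S.X₃`): its objects are the elements of `C³`. -/
@[ext]
structure CochainBicat (S : ShortComplex Ab.{u}) where
  val : S.X₃

namespace CochainBicat

variable {S : ShortComplex Ab.{u}}

/-- A 1-morphism `x ⟶ y` is an element `c` of `C²` with `y = x + d c`. -/
@[ext]
structure Hom₁ (x y : CochainBicat S) where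
  val : S.X₂
  prop : y.val = x.val + S.g.hom val

/-- A 2-morphism `f ⟶ g` is an element `e` of `C¹` with `g = f + d e`. -/
@[ext]
structure Hom₂ {x y : CochainBicat S} (f g : Hom₁ x y) where
  val : S.X₁
  prop : g.val = f.val + S.f.hom val

section Construction

/-- Composition of 1-morphisms is addition in `C²`. -/
@[reducible] def catStruct : CategoryStruct (CochainBicat S) where
  Hom := Hom₁
  id x := ⟨0, by simp⟩
  comp f g := ⟨f.val + g.val, by rw [g.prop, f.prop, map_add, add_assoc]⟩

attribute [local instance] catStruct

/-- Vertical composition of 2-morphisms is addition in `C¹`. -/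
@[reducible] def homCat (x y : CochainBicat S) : Category (x ⟶ y) where
  Hom f g := Hom₂ f g
  id f := ⟨0, by simp⟩
  comp η θ := ⟨η.val + θ.val, by rw [θ.prop, η.prop, map_add, add_assoc]⟩
  id_comp η := Hom₂.ext (zero_add _)
  comp_id η := Hom₂.ext (add_zero _)
  assoc η θ ζ := Hom₂.ext (add_assoc _ _ _)

attribute [local instance] homCat

lemma sandwich (e : S.X₁) : 0 + (e + 0) = e := by rw [zero_add, add_zero]

/-- The identity 2-isomorphism between equal 1-morphisms. -/
def preIso {x y : CochainBicat S} {f g : x ⟶ y} (h : Hom₁.val g = Hom₁.val f) : f ≅ g where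
  hom := Hom₂.mk 0 (by rw [h, map_zero, add_zero])
  inv := Hom₂.mk 0 (by rw [h, map_zero, add_zero])
  hom_inv_id := Hom₂.ext (add_zero 0)
  inv_hom_id := Hom₂.ext (add_zero 0)

/-- The bicategory structure: horizontal composition of 2-morphisms is addition in `C¹`;
associators and unitors are identities. -/
instance : Bicategory (CochainBicat S) where
  toCategoryStruct := catStruct
  homCategory := homCat
  whiskerLeft f _ _ η := Hom₂.mk (Hom₂.val η)
    ((congrArg (Hom₁.val f + ·) (Hom₂.prop η)).trans (add_assoc _ _ _).symm)
  whiskerRight η h := Hom₂.mk (Hom₂.val η)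
    ((congrArg (· + Hom₁.val h) (Hom₂.prop η)).trans (add_right_comm _ _ _))
  associator _ _ _ := preIso (add_assoc _ _ _).symm
  leftUnitor _ := preIso (zero_add _).symm
  rightUnitor _ := preIso (add_zero _).symm
  whiskerLeft_id _ _ := rfl
  whiskerLeft_comp _ _ _ _ _ _ := rfl
  id_whiskerLeft _ := Hom₂.ext (sandwich _).symm
  comp_whiskerLeft _ _ _ _ _ := Hom₂.ext (sandwich _).symm
  id_whiskerRight _ _ := rfl
  comp_whiskerRight _ _ _ := rfl
  whiskerRight_id _ := Hom₂.ext (sandwich _).symm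
  whiskerRight_comp _ _ _ := Hom₂.ext (sandwich _).symm
  whisker_assoc _ _ _ _ _ := Hom₂.ext (sandwich _).symm
  whisker_exchange _ _ := Hom₂.ext (add_comm _ _)
  pentagon _ _ _ _ := Hom₂.ext (zero_add _)
  triangle _ _ := Hom₂.ext (zero_add _)

end Construction

/-- The element of `C²` underlying a 1-morphism. -/
def v₁ {x y : CochainBicat S} (f : x ⟶ y) : S.X₂ := Hom₁.val f

/-- The element of `C¹` underlying a 2-morphism. -/
def v₂ {x y : CochainBicat S} {f g : x ⟶ y} (η : f ⟶ g) : S.X₁ := Hom₂.val η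

/-- The 1-morphism given by an element of `C²`. -/
def mk₁ {x y : CochainBicat S} (c : S.X₂) (h : y.val = x.val + S.g.hom c) : x ⟶ y := Hom₁.mk c h

/-- The 2-morphism given by an element of `C¹`. -/
def mk₂ {x y : CochainBicat S} {f g : x ⟶ y} (e : S.X₁) (h : v₁ g = v₁ f + S.f.hom e) : f ⟶ g :=
  Hom₂.mk e h

lemma v₁_prop {x y : CochainBicat S} (f : x ⟶ y) : y.val = x.val + S.g.hom (v₁ f) := Hom₁.prop f

lemma v₂_prop {x y : CochainBicat S} {f g : x ⟶ y} (η : f ⟶ g) :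
    v₁ g = v₁ f + S.f.hom (v₂ η) := Hom₂.prop η

lemma hom₂_ext {x y : CochainBicat S} {f g : x ⟶ y} {η θ : f ⟶ g} (h : v₂ η = v₂ θ) : η = θ :=
  Hom₂.ext h

lemma iso_ext {x y : CochainBicat S} {f g : x ⟶ y} {η θ : f ≅ g}
    (h : v₂ η.hom = v₂ θ.hom) : η = θ := Iso.ext (Hom₂.ext h)

@[simp] lemma mk₁_val {x y : CochainBicat S} (c : S.X₂) (h : y.val = x.val + S.g.hom c) :
    v₁ (mk₁ c h : x ⟶ y) = c := rfl
@[simp] lemma mk₂_val {x y : CochainBicat S} {f g : x ⟶ y} (e : S.X₁)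
    (h : v₁ g = v₁ f + S.f.hom e) : v₂ (mk₂ e h : f ⟶ g) = e := rfl
@[simp] lemma id_val (x : CochainBicat S) : v₁ (𝟙 x) = 0 := rfl
@[simp] lemma comp_val {x y z : CochainBicat S} (f : x ⟶ y) (g : y ⟶ z) :
    v₁ (f ≫ g) = v₁ f + v₁ g := rfl
@[simp] lemma id₂_val {x y : CochainBicat S} (f : x ⟶ y) : v₂ (𝟙 f) = 0 := rfl
@[simp] lemma comp₂_val {x y : CochainBicat S} {f g h : x ⟶ y} (η : f ⟶ g) (θ : g ⟶ h) :
    v₂ (η ≫ θ) = v₂ η + v₂ θ := rfl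
@[simp] lemma whiskerLeft_val {x y z : CochainBicat S} (f : x ⟶ y) {g h : y ⟶ z} (η : g ⟶ h) :
    v₂ (f ◁ η) = v₂ η := rfl
@[simp] lemma whiskerRight_val {x y z : CochainBicat S} {f g : x ⟶ y} (η : f ⟶ g) (h : y ⟶ z) :
    v₂ (η ▷ h) = v₂ η := rfl
@[simp] lemma associator_hom_val {x y z t : CochainBicat S} (f : x ⟶ y) (g : y ⟶ z)
    (h : z ⟶ t) : v₂ (α_ f g h).hom = 0 := rfl
@[simp] lemma associator_inv_val {x y z t : CochainBicat S} (f : x ⟶ y) (g : y ⟶ z)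
    (h : z ⟶ t) : v₂ (α_ f g h).inv = 0 := rfl
@[simp] lemma leftUnitor_hom_val {x y : CochainBicat S} (f : x ⟶ y) : v₂ (λ_ f).hom = 0 := rfl
@[simp] lemma leftUnitor_inv_val {x y : CochainBicat S} (f : x ⟶ y) : v₂ (λ_ f).inv = 0 := rfl
@[simp] lemma rightUnitor_hom_val {x y : CochainBicat S} (f : x ⟶ y) : v₂ (ρ_ f).hom = 0 := rfl
@[simp] lemma rightUnitor_inv_val {x y : CochainBicat S} (f : x ⟶ y) : v₂ (ρ_ f).inv = 0 := rfl

/-- The identity 2-isomorphism between 1-morphisms with the same underlying element of `C²`. -/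
def eqIso {x y : CochainBicat S} {f g : x ⟶ y} (h : v₁ g = v₁ f) : f ≅ g where
  hom := mk₂ 0 (by simp [h])
  inv := mk₂ 0 (by simp [h])
  hom_inv_id := hom₂_ext (add_zero 0)
  inv_hom_id := hom₂_ext (add_zero 0)

@[simp] lemma eqIso_hom_val {x y : CochainBicat S} {f g : x ⟶ y} (h : v₁ g = v₁ f) :
    v₂ (eqIso h).hom = 0 := rfl
@[simp] lemma eqIso_inv_val {x y : CochainBicat S} {f g : x ⟶ y} (h : v₁ g = v₁ f) :
    v₂ (eqIso h).inv = 0 := rfl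

/-- The tensor product is addition on objects, 1-morphisms and 2-morphisms. -/
instance : TensorBicat (CochainBicat S) where
  tensor :=
    { obj := fun p => ⟨p.1.val + p.2.val⟩
      map := fun f => mk₁ (v₁ f.1 + v₁ f.2) (by
        rw [v₁_prop f.1, v₁_prop f.2, map_add]; exact add_add_add_comm _ _ _ _)
      map₂ := fun η => mk₂ (v₂ η.1 + v₂ η.2) (by
        rw [mk₁_val, mk₁_val, v₂_prop η.1, v₂_prop η.2, map_add]
        exact add_add_add_comm _ _ _ _)
      map₂_id := fun _ => hom₂_ext (add_zero _)
      map₂_comp := fun _ _ => hom₂_ext (add_add_add_comm _ _ _ _)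
      mapId := fun _ => eqIso (by simp)
      mapComp := fun _ _ => eqIso (by simp [add_add_add_comm])
      map₂_whisker_left := fun _ _ _ _ => hom₂_ext (sandwich _).symm
      map₂_whisker_right := fun _ _ => hom₂_ext (sandwich _).symm
      map₂_associator := fun _ _ _ => hom₂_ext (by
        change (0 : S.X₁) + 0 = 0 + (0 + (0 + (0 + 0))); simp)
      map₂_left_unitor := fun _ => hom₂_ext (by change (0 : S.X₁) + 0 = 0 + (0 + 0); simp)
      map₂_right_unitor := fun _ => hom₂_ext (by change (0 : S.X₁) + 0 = 0 + (0 + 0); simp) }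
  unit := ⟨0⟩

@[simp] lemma tensorObj_val (x y : CochainBicat S) : (x ⊠ y).val = x.val + y.val := rfl
@[simp] lemma one_val : (one (CochainBicat S)).val = 0 := rfl
@[simp] lemma tensorHom_val {x x' y y' : CochainBicat S} (f : x ⟶ x') (g : y ⟶ y') :
    v₁ (f ⊠₁ g) = v₁ f + v₁ g := rfl
@[simp] lemma tensorHom₂_val {x x' y y' : CochainBicat S} {f f' : x ⟶ x'} {g g' : y ⟶ y'}
    (η : f ⟶ f') (θ : g ⟶ g') : v₂ (tensorHom₂ η θ) = v₂ η + v₂ θ := rfl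
@[simp] lemma tensorIso_hom_val {x x' y y' : CochainBicat S} {f f' : x ⟶ x'} {g g' : y ⟶ y'}
    (η : f ≅ f') (θ : g ≅ g') :
    v₂ (η ⊠₂ θ).hom = v₂ η.hom + v₂ θ.hom := rfl
@[simp] lemma tensorIso_inv_val {x x' y y' : CochainBicat S} {f f' : x ⟶ x'} {g g' : y ⟶ y'}
    (η : f ≅ f') (θ : g ≅ g') :
    v₂ (η ⊠₂ θ).inv = v₂ η.inv + v₂ θ.inv := rfl
@[simp] lemma tensorId_hom_val (x y : CochainBicat S) :
    v₂ (tensorId x y).hom = 0 := rfl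
@[simp] lemma tensorId_inv_val (x y : CochainBicat S) :
    v₂ (tensorId x y).inv = 0 := rfl
@[simp] lemma tensorComp_hom_val {x x' x'' y y' y'' : CochainBicat S} (f : x ⟶ x')
    (f' : x' ⟶ x'') (g : y ⟶ y') (g' : y' ⟶ y'') :
    v₂ (tensorComp f f' g g').hom = 0 := rfl
@[simp] lemma tensorComp_inv_val {x x' x'' y y' y'' : CochainBicat S} (f : x ⟶ x')
    (f' : x' ⟶ x'') (g : y ⟶ y') (g' : y' ⟶ y'') :
    v₂ (tensorComp f f' g g').inv = 0 := rfl

/-- The identity equivalence between objects with the same underlying element of `C³`. -/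
def eqEquiv {x y : CochainBicat S} (h : y.val = x.val) : x ≌ y where
  hom := mk₁ 0 (by simp [h])
  inv := mk₁ 0 (by simp [h])
  unit := eqIso (by simp)
  counit := eqIso (by simp)
  left_triangle := iso_ext (by
    simp only [leftZigzagIso, bicategoricalIsoComp, Iso.trans_hom, comp₂_val]
    simp [BicategoricalCoherence.iso]
    try exact add_zero (0 : S.X₁))

@[simp] lemma eqEquiv_hom_val {x y : CochainBicat S} (h : y.val = x.val) :
    v₁ (eqEquiv h).hom = 0 := rfl
@[simp] lemma eqEquiv_inv_val {x y : CochainBicat S} (h : y.val = x.val) :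
    v₁ (eqEquiv h).inv = 0 := rfl
@[simp] lemma eqEquiv_unit_hom_val {x y : CochainBicat S} (h : y.val = x.val) :
    v₂ (eqEquiv h).unit.hom = 0 := rfl
@[simp] lemma eqEquiv_unit_inv_val {x y : CochainBicat S} (h : y.val = x.val) :
    v₂ (eqEquiv h).unit.inv = 0 := rfl
@[simp] lemma eqEquiv_counit_hom_val {x y : CochainBicat S} (h : y.val = x.val) :
    v₂ (eqEquiv h).counit.hom = 0 := rfl
@[simp] lemma eqEquiv_counit_inv_val {x y : CochainBicat S} (h : y.val = x.val) :
    v₂ (eqEquiv h).counit.inv = 0 := rfl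

/-- The associator. -/
def asc' (a b c : CochainBicat S) : a ⊠ b ⊠ c ≌ a ⊠ (b ⊠ c) :=
  eqEquiv (add_assoc _ _ _).symm

/-- The left unitor. -/
def lu' (a : CochainBicat S) : one (CochainBicat S) ⊠ a ≌ a := eqEquiv (zero_add _).symm

/-- The right unitor. -/
def ru' (a : CochainBicat S) : a ⊠ one (CochainBicat S) ≌ a := eqEquiv (add_zero _).symm

/-- The braiding. -/
def br' (a b : CochainBicat S) : a ⊠ b ≌ b ⊠ a := eqEquiv (add_comm _ _)

@[simp] lemma asc'_hom_val (a b c : CochainBicat S) : v₁ (asc' a b c).hom = 0 := rfl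
@[simp] lemma asc'_inv_val (a b c : CochainBicat S) : v₁ (asc' a b c).inv = 0 := rfl
@[simp] lemma lu'_hom_val (a : CochainBicat S) : v₁ (lu' a).hom = 0 := rfl
@[simp] lemma ru'_hom_val (a : CochainBicat S) : v₁ (ru' a).hom = 0 := rfl
@[simp] lemma br'_hom_val (a b : CochainBicat S) : v₁ (br' a b).hom = 0 := rfl

/-- All structure cells are identities. -/
instance : SymMonBicatData (CochainBicat S) where
  asc := asc'
  ascN f g h := eqIso (by simp [add_assoc])
  lu := lu'
  luN f := eqIso (by simp)
  ru := ru'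
  ruN f := eqIso (by simp)
  pent a b c d := eqIso (by simp)
  mid a b := eqIso (by simp)
  lun a b := eqIso (by simp)
  run a b := eqIso (by simp)
  br := br'
  brN f g := eqIso (by simp [add_comm])
  hexR a b c := eqIso (by simp)
  hexS a b c := eqIso (by simp)
  syl a b := eqIso (by simp)

end CochainBicat

namespace CochainBicat

variable {S : ShortComplex Ab.{u}}

/-! Underlying elements of the structure cells, for the verification of the axioms. -/

@[simp] lemma inv_v {x y : CochainBicat S} {f g : x ⟶ y} (η : f ≅ g) :
    v₂ η.inv = -v₂ η.hom :=
  eq_neg_of_add_eq_zero_right (congrArg v₂ η.hom_inv_id)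

@[simp] lemma bicategoricalIsoComp_v {x y : CochainBicat S} {f g h i : x ⟶ y}
    [BicategoricalCoherence g h] (η : f ≅ g) (θ : h ≅ i) :
    v₂ (η ≪⊗≫ θ).hom = v₂ η.hom + (v₂ (⊗𝟙 : g ≅ h).hom + v₂ θ.hom) := rfl

@[simp] lemma asc_hom_val (a b c : CochainBicat S) : v₁ (asc a b c).hom = 0 := rfl
@[simp] lemma asc_inv_val (a b c : CochainBicat S) : v₁ (asc a b c).inv = 0 := rfl
@[simp] lemma lu_hom_val (a : CochainBicat S) : v₁ (lu a).hom = 0 := rfl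
@[simp] lemma ru_hom_val (a : CochainBicat S) : v₁ (ru a).hom = 0 := rfl
@[simp] lemma br_hom_val (a b : CochainBicat S) : v₁ (br a b).hom = 0 := rfl
@[simp] lemma asc_unit_v (a b c : CochainBicat S) : v₂ (asc a b c).unit.hom = 0 := rfl
@[simp] lemma asc_counit_v (a b c : CochainBicat S) : v₂ (asc a b c).counit.hom = 0 := rfl
@[simp] lemma pent_v (a b c d : CochainBicat S) : v₂ (pent a b c d).hom = 0 := rfl
@[simp] lemma mid_v (a b : CochainBicat S) : v₂ (mid a b).hom = 0 := rfl
@[simp] lemma lun_v (a b : CochainBicat S) : v₂ (lun a b).hom = 0 := rfl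
@[simp] lemma run_v (a b : CochainBicat S) : v₂ (run a b).hom = 0 := rfl
@[simp] lemma hexR_v (a b c : CochainBicat S) : v₂ (hexR a b c).hom = 0 := rfl
@[simp] lemma hexS_v (a b c : CochainBicat S) : v₂ (hexS a b c).hom = 0 := rfl
@[simp] lemma syl_v (a b : CochainBicat S) : v₂ (syl a b).hom = 0 := rfl
@[simp] lemma ascN_v {a a' b b' c c' : CochainBicat S} (f : a ⟶ a') (g : b ⟶ b')
    (h : c ⟶ c') : v₂ (ascN f g h).hom = 0 := rfl
@[simp] lemma luN_v {a a' : CochainBicat S} (f : a ⟶ a') : v₂ (luN f).hom = 0 := rfl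
@[simp] lemma ruN_v {a a' : CochainBicat S} (f : a ⟶ a') : v₂ (ruN f).hom = 0 := rfl
@[simp] lemma brN_v {a a' b b' : CochainBicat S} (f : a ⟶ a') (g : b ⟶ b') :
    v₂ (brN f g).hom = 0 := rfl

@[simp] lemma sqV_v {a a' b b' c c' : CochainBicat S} {f : a ⟶ a'} {t : a ⟶ b} {t' : a' ⟶ b'} {g : b ⟶ b'}
    {s : b ⟶ c} {s' : b' ⟶ c'} {h : c ⟶ c'} (p : f ≫ t' ≅ t ≫ g) (q : g ≫ s' ≅ s ≫ h) :
    v₂ (sqV p q).hom = v₂ p.hom + v₂ q.hom := by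
  simp [sqV]
@[simp] lemma sqH_v {a a' a'' b b' b'' : CochainBicat S} {f : a ⟶ a'} {f₂ : a' ⟶ a''} {t : a ⟶ b}
    {t' : a' ⟶ b'} {t'' : a'' ⟶ b''} {g : b ⟶ b'} {g₂ : b' ⟶ b''} (p : f ≫ t' ≅ t ≫ g)
    (q : f₂ ≫ t'' ≅ t' ≫ g₂) :
    v₂ (sqH p q).hom = v₂ q.hom + v₂ p.hom := by
  simp [sqH]
@[simp] lemma sqId_v {a a' : CochainBicat S} (f : a ⟶ a') :
    v₂ (sqId f).hom = 0 := by
  simp [sqId]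
@[simp] lemma sqOne_v {a a' : CochainBicat S} (f : a ⟶ a') :
    v₂ (sqOne f).hom = 0 := by
  simp [sqOne]
@[simp] lemma sqMate_v {a a' b b' : CochainBicat S} {f : a ⟶ a'} {g : b ⟶ b'} (e : a ≌ b) (e' : a' ≌ b')
    (p : f ≫ e'.hom ≅ e.hom ≫ g) :
    v₂ (sqMate e e' p).hom = -v₂ e.counit.hom + (-v₂ p.hom + -v₂ e'.unit.hom) := by
  simp [sqMate]
@[simp] lemma sqT_v {a a' b b' : CochainBicat S} {f : a ⟶ a'} {t : a ⟶ b} {t' : a' ⟶ b'} {g : b ⟶ b'}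
    {c c' d d' : CochainBicat S} {h : c ⟶ c'} {s : c ⟶ d} {s' : c' ⟶ d'} {k : d ⟶ d'}
    (p : f ≫ t' ≅ t ≫ g) (q : h ≫ s' ≅ s ≫ k) :
    v₂ (sqT p q).hom = v₂ p.hom + v₂ q.hom := by
  simp [sqT]
@[simp] lemma sqR_v {a a' b b' : CochainBicat S} {f : a ⟶ a'} {t : a ⟶ b} {t' : a' ⟶ b'} {g : b ⟶ b'}
    (p : f ≫ t' ≅ t ≫ g) {x x' : CochainBicat S} (k : x ⟶ x') :
    v₂ (sqR p k).hom = v₂ p.hom := by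
  simp [sqR]
@[simp] lemma sqL_v {x x' : CochainBicat S} (k : x ⟶ x') {a a' b b' : CochainBicat S} {f : a ⟶ a'} {t : a ⟶ b} {t' : a' ⟶ b'} {g : b ⟶ b'}
    (p : f ≫ t' ≅ t ≫ g) :
    v₂ (sqL k p).hom = v₂ p.hom := by
  simp [sqL]
@[simp] lemma isoR_v {a a' : CochainBicat S} {f f' : a ⟶ a'} (η : f ≅ f') (c : CochainBicat S) :
    v₂ (isoR η c).hom = v₂ η.hom := by
  simp [isoR]
@[simp] lemma isoL_v (c : CochainBicat S) {a a' : CochainBicat S} {f f' : a ⟶ a'} (η : f ≅ f') :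
    v₂ (isoL c η).hom = v₂ η.hom := by
  simp [isoL]
@[simp] lemma compR_v {a b c : CochainBicat S} (f : a ⟶ b) (g : b ⟶ c) (x : CochainBicat S) :
    v₂ (compR f g x).hom = 0 := by
  simp [compR]
@[simp] lemma compL_v (x : CochainBicat S) {a b c : CochainBicat S} (f : a ⟶ b) (g : b ⟶ c) :
    v₂ (compL x f g).hom = 0 := by
  simp [compL]
@[simp] lemma compR3_v {a b c d : CochainBicat S} (f : a ⟶ b) (g : b ⟶ c) (h : c ⟶ d)
    (x : CochainBicat S) :
    v₂ (compR3 f g h x).hom = 0 := by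
  simp [compR3]
@[simp] lemma compL3_v (x : CochainBicat S) {a b c d : CochainBicat S} (f : a ⟶ b) (g : b ⟶ c) (h : c ⟶ d) :
    v₂ (compL3 x f g h).hom = 0 := by
  simp [compL3]
@[simp] lemma compR5_v {a b c d e e' : CochainBicat S} (f : a ⟶ b) (g : b ⟶ c)
    (h : c ⟶ d) (k : d ⟶ e) (l : e ⟶ e') (x : CochainBicat S) :
    v₂ (compR5 f g h k l x).hom = 0 := by
  simp [compR5]
@[simp] lemma compL5_v (x : CochainBicat S) {a b c d e e' : CochainBicat S} (f : a ⟶ b) (g : b ⟶ c)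
    (h : c ⟶ d) (k : d ⟶ e) (l : e ⟶ e') :
    v₂ (compL5 x f g h k l).hom = 0 := by
  simp [compL5]
@[simp] lemma exch_v {a a' b b' : CochainBicat S} (f : a ⟶ a') (g : b ⟶ b') :
    v₂ (exch f g).hom = 0 := by
  simp [exch]
@[simp] lemma unitL_v (x : CochainBicat S) {a b : CochainBicat S} (e : a ≌ b) :
    v₂ (unitL x e).hom = -v₂ e.unit.hom := by
  simp [unitL]
@[simp] lemma counitR_v {a b : CochainBicat S} (e : a ≌ b) (x : CochainBicat S) :
    v₂ (counitR e x).hom = v₂ e.counit.hom := by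
  simp [counitR]
@[simp] lemma counitL_v (x : CochainBicat S) {a b : CochainBicat S} (e : a ≌ b) :
    v₂ (counitL x e).hom = v₂ e.counit.hom := by
  simp [counitL]
@[simp] lemma asA_v {a a' : CochainBicat S} (f : a ⟶ a') (b c : CochainBicat S) :
    v₂ (asA f b c).hom = 0 := by
  simp [asA]
@[simp] lemma asB_v (a : CochainBicat S) {b b' : CochainBicat S} (f : b ⟶ b') (c : CochainBicat S) :
    v₂ (asB a f c).hom = 0 := by
  simp [asB]
@[simp] lemma asC_v (a b : CochainBicat S) {c c' : CochainBicat S} (f : c ⟶ c') :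
    v₂ (asC a b f).hom = 0 := by
  simp [asC]
@[simp] lemma aiA_v {a a' : CochainBicat S} (f : a ⟶ a') (b c : CochainBicat S) :
    v₂ (aiA f b c).hom = 0 := by
  simp [aiA]
@[simp] lemma aiB_v (a : CochainBicat S) {b b' : CochainBicat S} (f : b ⟶ b') (c : CochainBicat S) :
    v₂ (aiB a f c).hom = 0 := by
  simp [aiB]
@[simp] lemma aiC_v (a b : CochainBicat S) {c c' : CochainBicat S} (f : c ⟶ c') :
    v₂ (aiC a b f).hom = 0 := by
  simp [aiC]
@[simp] lemma aiN_v {a a' b b' c c' : CochainBicat S} (f : a ⟶ a') (g : b ⟶ b') (h : c ⟶ c') :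
    v₂ (aiN f g h).hom = 0 := by
  simp [aiN]
@[simp] lemma btA_v {a a' : CochainBicat S} (f : a ⟶ a') (b : CochainBicat S) :
    v₂ (btA f b).hom = 0 := by
  simp [btA]
@[simp] lemma btB_v (a : CochainBicat S) {b b' : CochainBicat S} (f : b ⟶ b') :
    v₂ (btB a f).hom = 0 := by
  simp [btB]
@[simp] lemma pentI₁_v (a b c d : CochainBicat S) :
    v₂ (pentI₁ a b c d).hom = 0 := by
  simp [pentI₁]
@[simp] lemma pentI₂_v (a b c d : CochainBicat S) :
    v₂ (pentI₂ a b c d).hom = 0 := by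
  simp [pentI₂]
@[simp] lemma pentI_v (a b c d : CochainBicat S) :
    v₂ (pentI a b c d).hom = 0 := by
  simp [pentI]
@[simp] lemma hexR'_v (a b c : CochainBicat S) :
    v₂ (hexR' a b c).hom = 0 := by
  simp [hexR']
@[simp] lemma hexS'_v (a b c : CochainBicat S) :
    v₂ (hexS' a b c).hom = 0 := by
  simp [hexS']

set_option maxHeartbeats 2000000 in
instance : SymMonBicat (CochainBicat S) where
  ascN_naturality η θ ζ := hom₂_ext (by simp [add_assoc])
  ascN_id a b c := iso_ext (by simp)
  ascN_comp f f' g g' h h' := iso_ext (by simp)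
  luN_naturality η := hom₂_ext (by simp)
  luN_id a := iso_ext (by simp)
  luN_comp f f' := iso_ext (by simp)
  ruN_naturality η := hom₂_ext (by simp)
  ruN_id a := iso_ext (by simp)
  ruN_comp f f' := iso_ext (by simp)
  brN_naturality η θ := hom₂_ext (by simp [add_comm])
  brN_id a b := iso_ext (by simp)
  brN_comp f f' g g' := iso_ext (by simp)
  pent_mod f g h k := iso_ext (by simp)
  mid_mod f g := iso_ext (by simp)
  lun_mod f g := iso_ext (by simp)
  run_mod f g := iso_ext (by simp)
  hexR_mod f g h := iso_ext (by simp)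
  hexS_mod f g h := iso_ext (by simp)
  syl_mod f g := iso_ext (by simp)
  pent_cocycle a b c d e := iso_ext (by simp)
  pent_left a b c := iso_ext (by simp)
  pent_right a b c := iso_ext (by simp)
  braid_one_three a b c d := iso_ext (by simp)
  braid_three_one a b c d := iso_ext (by simp)
  braid_two_two a b c d := iso_ext (by
    simp only [bicategoricalIsoComp_v, BicategoricalCoherence.whiskerRight_iso,
      BicategoricalCoherence.whiskerLeft_iso, BicategoricalCoherence.refl_iso,
      BicategoricalCoherence.assoc_iso, BicategoricalCoherence.assoc'_iso, Iso.trans_hom,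
      Iso.symm_hom, Iso.refl_hom, whiskerRightIso_hom, whiskerLeftIso_hom, comp₂_val, id₂_val,
      whiskerLeft_val, whiskerRight_val, associator_hom_val, inv_v, neg_zero, add_zero, hexR'_v,
      hexS'_v, isoR_v, isoL_v, compR5_v, compL5_v, pentI₁_v, pentI₂_v, pentI_v, pent_v, asA_v,
      asC_v, aiA_v, aiB_v, aiC_v, exch_v])
  yang_baxter a b c := iso_ext (by simp)
  syl_left a b c := iso_ext (by simp)
  syl_right a b c := iso_ext (by simp)
  syl_symm a b := iso_ext (by simp)

end CochainBicat

/-! ### Products of symmetric monoidal bicategories -/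

section Product

variable {M N : Type u} [Bicategory.{w, v} M] [Bicategory.{w, v} N]

/-- A pair of adjoint equivalences is an adjoint equivalence in the product. -/
def prodEquiv {a a' : M} {b b' : N} (e : a ≌ a') (e' : b ≌ b') : (a, b) ≌ (a', b') where
  hom := Prod.mkHom e.hom e'.hom
  inv := Prod.mkHom e.inv e'.inv
  unit := Iso.prod e.unit e'.unit
  counit := Iso.prod e.counit e'.counit
  left_triangle := Iso.ext (Prod.ext (congrArg Iso.hom e.left_triangle)
    (congrArg Iso.hom e'.left_triangle))

lemma tensorHom₂_comp [TensorBicat M] {a a' b b' : M} {f f' f'' : a ⟶ a'} {g g' g'' : b ⟶ b'}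
    (η : f ⟶ f') (η' : f' ⟶ f'') (θ : g ⟶ g') (θ' : g' ⟶ g'') :
    tensorHom₂ (η ≫ η') (θ ≫ θ') = tensorHom₂ η θ ≫ tensorHom₂ η' θ' :=
  (TensorBicat.tensor (B := M)).map₂_comp (f := Prod.mkHom f g) (g := Prod.mkHom f' g')
    (h := Prod.mkHom f'' g'') (Prod.mkHom η θ) (Prod.mkHom η' θ')

/-- The componentwise tensor product. -/
instance [TensorBicat M] [TensorBicat N] : TensorBicat (M × N) where
  tensor :=
    { obj := fun p => (p.1.1 ⊠ p.2.1, p.1.2 ⊠ p.2.2)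
      map := fun f => Prod.mkHom (f.1.1 ⊠₁ f.2.1) (f.1.2 ⊠₁ f.2.2)
      map₂ := fun η => Prod.mkHom (tensorHom₂ η.1.1 η.2.1) (tensorHom₂ η.1.2 η.2.2)
      map₂_id := fun _ => Prod.ext (TensorBicat.tensor.map₂_id _) (TensorBicat.tensor.map₂_id _)
      map₂_comp := fun η θ => Prod.ext
        (tensorHom₂_comp η.1.1 θ.1.1 η.2.1 θ.2.1) (tensorHom₂_comp η.1.2 θ.1.2 η.2.2 θ.2.2)
      mapId := fun p => Iso.prod (tensorId p.1.1 p.2.1) (tensorId p.1.2 p.2.2)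
      mapComp := fun f g => Iso.prod (tensorComp f.1.1 g.1.1 f.2.1 g.2.1)
        (tensorComp f.1.2 g.1.2 f.2.2 g.2.2)
      map₂_whisker_left := fun f g h η => Prod.ext
        (TensorBicat.tensor.map₂_whisker_left (Prod.mkHom f.1.1 f.2.1)
          (g := Prod.mkHom g.1.1 g.2.1) (h := Prod.mkHom h.1.1 h.2.1) (Prod.mkHom η.1.1 η.2.1))
        (TensorBicat.tensor.map₂_whisker_left (Prod.mkHom f.1.2 f.2.2)
          (g := Prod.mkHom g.1.2 g.2.2) (h := Prod.mkHom h.1.2 h.2.2) (Prod.mkHom η.1.2 η.2.2))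
      map₂_whisker_right := fun {_ _ _ f g} η h => Prod.ext
        (TensorBicat.tensor.map₂_whisker_right (f := Prod.mkHom f.1.1 f.2.1)
          (g := Prod.mkHom g.1.1 g.2.1) (Prod.mkHom η.1.1 η.2.1) (Prod.mkHom h.1.1 h.2.1))
        (TensorBicat.tensor.map₂_whisker_right (f := Prod.mkHom f.1.2 f.2.2)
          (g := Prod.mkHom g.1.2 g.2.2) (Prod.mkHom η.1.2 η.2.2) (Prod.mkHom h.1.2 h.2.2))
      map₂_associator := fun f g h => Prod.ext
        (TensorBicat.tensor.map₂_associator (Prod.mkHom f.1.1 f.2.1) (Prod.mkHom g.1.1 g.2.1)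
          (Prod.mkHom h.1.1 h.2.1))
        (TensorBicat.tensor.map₂_associator (Prod.mkHom f.1.2 f.2.2) (Prod.mkHom g.1.2 g.2.2)
          (Prod.mkHom h.1.2 h.2.2))
      map₂_left_unitor := fun f => Prod.ext
        (TensorBicat.tensor.map₂_left_unitor (Prod.mkHom f.1.1 f.2.1))
        (TensorBicat.tensor.map₂_left_unitor (Prod.mkHom f.1.2 f.2.2))
      map₂_right_unitor := fun f => Prod.ext
        (TensorBicat.tensor.map₂_right_unitor (Prod.mkHom f.1.1 f.2.1))
        (TensorBicat.tensor.map₂_right_unitor (Prod.mkHom f.1.2 f.2.2)) }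
  unit := (one M, one N)

section

variable [SymMonBicatData M] [SymMonBicatData N]

def prodAsc (a b c : M × N) : a ⊠ b ⊠ c ≌ a ⊠ (b ⊠ c) :=
  prodEquiv (asc a.1 b.1 c.1) (asc a.2 b.2 c.2)

def prodLu (a : M × N) : one (M × N) ⊠ a ≌ a := prodEquiv (lu a.1) (lu a.2)

def prodRu (a : M × N) : a ⊠ one (M × N) ≌ a := prodEquiv (ru a.1) (ru a.2)

def prodBr (a b : M × N) : a ⊠ b ≌ b ⊠ a := prodEquiv (br a.1 b.1) (br a.2 b.2)

end

/-- Componentwise structure cells. -/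
instance [SymMonBicatData M] [SymMonBicatData N] : SymMonBicatData (M × N) where
  asc := prodAsc
  ascN f g h := Iso.prod (ascN f.1 g.1 h.1) (ascN f.2 g.2 h.2)
  lu := prodLu
  luN f := Iso.prod (luN f.1) (luN f.2)
  ru := prodRu
  ruN f := Iso.prod (ruN f.1) (ruN f.2)
  pent a b c d := Iso.prod (pent a.1 b.1 c.1 d.1) (pent a.2 b.2 c.2 d.2)
  mid a b := Iso.prod (mid a.1 b.1) (mid a.2 b.2)
  lun a b := Iso.prod (lun a.1 b.1) (lun a.2 b.2)
  run a b := Iso.prod (run a.1 b.1) (run a.2 b.2)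
  br := prodBr
  brN f g := Iso.prod (brN f.1 g.1) (brN f.2 g.2)
  hexR a b c := Iso.prod (hexR a.1 b.1 c.1) (hexR a.2 b.2 c.2)
  hexS a b c := Iso.prod (hexS a.1 b.1 c.1) (hexS a.2 b.2 c.2)
  syl a b := Iso.prod (syl a.1 b.1) (syl a.2 b.2)

lemma isoProd_ext {a b : M × N} {f g : a ⟶ b} {η θ : f ≅ g}
    (h : (⟨η.hom.1, η.inv.1, congrArg Prod.fst η.hom_inv_id, congrArg Prod.fst η.inv_hom_id⟩ :
      f.1 ≅ g.1) = ⟨θ.hom.1, θ.inv.1, congrArg Prod.fst θ.hom_inv_id,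
        congrArg Prod.fst θ.inv_hom_id⟩)
    (h' : (⟨η.hom.2, η.inv.2, congrArg Prod.snd η.hom_inv_id, congrArg Prod.snd η.inv_hom_id⟩ :
      f.2 ≅ g.2) = ⟨θ.hom.2, θ.inv.2, congrArg Prod.snd θ.hom_inv_id,
        congrArg Prod.snd θ.inv_hom_id⟩) : η = θ :=
  Iso.ext (Prod.ext (congrArg Iso.hom h) (congrArg Iso.hom h'))

set_option maxHeartbeats 2000000 in
instance [SymMonBicat M] [SymMonBicat N] : SymMonBicat (M × N) where
  ascN_naturality η θ ζ := Prod.ext (SymMonBicat.ascN_naturality η.1 θ.1 ζ.1)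
    (SymMonBicat.ascN_naturality η.2 θ.2 ζ.2)
  ascN_id a b c := isoProd_ext (SymMonBicat.ascN_id a.1 b.1 c.1)
    (SymMonBicat.ascN_id a.2 b.2 c.2)
  ascN_comp f f' g g' h h' := isoProd_ext (SymMonBicat.ascN_comp f.1 f'.1 g.1 g'.1 h.1 h'.1)
    (SymMonBicat.ascN_comp f.2 f'.2 g.2 g'.2 h.2 h'.2)
  luN_naturality η := Prod.ext (SymMonBicat.luN_naturality η.1)
    (SymMonBicat.luN_naturality η.2)
  luN_id a := isoProd_ext (SymMonBicat.luN_id a.1)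
    (SymMonBicat.luN_id a.2)
  luN_comp f f' := isoProd_ext (SymMonBicat.luN_comp f.1 f'.1)
    (SymMonBicat.luN_comp f.2 f'.2)
  ruN_naturality η := Prod.ext (SymMonBicat.ruN_naturality η.1)
    (SymMonBicat.ruN_naturality η.2)
  ruN_id a := isoProd_ext (SymMonBicat.ruN_id a.1)
    (SymMonBicat.ruN_id a.2)
  ruN_comp f f' := isoProd_ext (SymMonBicat.ruN_comp f.1 f'.1)
    (SymMonBicat.ruN_comp f.2 f'.2)
  brN_naturality η θ := Prod.ext (SymMonBicat.brN_naturality η.1 θ.1)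
    (SymMonBicat.brN_naturality η.2 θ.2)
  brN_id a b := isoProd_ext (SymMonBicat.brN_id a.1 b.1)
    (SymMonBicat.brN_id a.2 b.2)
  brN_comp f f' g g' := isoProd_ext (SymMonBicat.brN_comp f.1 f'.1 g.1 g'.1)
    (SymMonBicat.brN_comp f.2 f'.2 g.2 g'.2)
  pent_mod f g h k := isoProd_ext (SymMonBicat.pent_mod f.1 g.1 h.1 k.1)
    (SymMonBicat.pent_mod f.2 g.2 h.2 k.2)
  mid_mod f g := isoProd_ext (SymMonBicat.mid_mod f.1 g.1)
    (SymMonBicat.mid_mod f.2 g.2)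
  lun_mod f g := isoProd_ext (SymMonBicat.lun_mod f.1 g.1)
    (SymMonBicat.lun_mod f.2 g.2)
  run_mod f g := isoProd_ext (SymMonBicat.run_mod f.1 g.1)
    (SymMonBicat.run_mod f.2 g.2)
  hexR_mod f g h := isoProd_ext (SymMonBicat.hexR_mod f.1 g.1 h.1)
    (SymMonBicat.hexR_mod f.2 g.2 h.2)
  hexS_mod f g h := isoProd_ext (SymMonBicat.hexS_mod f.1 g.1 h.1)
    (SymMonBicat.hexS_mod f.2 g.2 h.2)
  syl_mod f g := isoProd_ext (SymMonBicat.syl_mod f.1 g.1)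
    (SymMonBicat.syl_mod f.2 g.2)
  pent_cocycle a b c d e := isoProd_ext (SymMonBicat.pent_cocycle a.1 b.1 c.1 d.1 e.1)
    (SymMonBicat.pent_cocycle a.2 b.2 c.2 d.2 e.2)
  pent_left a b c := isoProd_ext (SymMonBicat.pent_left a.1 b.1 c.1)
    (SymMonBicat.pent_left a.2 b.2 c.2)
  pent_right a b c := isoProd_ext (SymMonBicat.pent_right a.1 b.1 c.1)
    (SymMonBicat.pent_right a.2 b.2 c.2)
  braid_one_three a b c d := isoProd_ext (SymMonBicat.braid_one_three a.1 b.1 c.1 d.1)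
    (SymMonBicat.braid_one_three a.2 b.2 c.2 d.2)
  braid_three_one a b c d := isoProd_ext (SymMonBicat.braid_three_one a.1 b.1 c.1 d.1)
    (SymMonBicat.braid_three_one a.2 b.2 c.2 d.2)
  braid_two_two a b c d := isoProd_ext (SymMonBicat.braid_two_two a.1 b.1 c.1 d.1)
    (SymMonBicat.braid_two_two a.2 b.2 c.2 d.2)
  yang_baxter a b c := isoProd_ext (SymMonBicat.yang_baxter a.1 b.1 c.1)
    (SymMonBicat.yang_baxter a.2 b.2 c.2)
  syl_left a b c := isoProd_ext (SymMonBicat.syl_left a.1 b.1 c.1)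
    (SymMonBicat.syl_left a.2 b.2 c.2)
  syl_right a b c := isoProd_ext (SymMonBicat.syl_right a.1 b.1 c.1)
    (SymMonBicat.syl_right a.2 b.2 c.2)
  syl_symm a b := isoProd_ext (SymMonBicat.syl_symm a.1 b.1)
    (SymMonBicat.syl_symm a.2 b.2)

end Product

section ProductMap

variable {M : Type u} [Bicategory.{w, v} M] {N : Type u} [Bicategory.{w, v} N]
  {M' : Type u₁} [Bicategory.{w₁, v₁} M'] {N' : Type u₁} [Bicategory.{w₁, v₁} N']

/-- The product of two pseudofunctors. -/
def prodMap (F : M ⥤ᵖ M') (G : N ⥤ᵖ N') : (M × N) ⥤ᵖ (M' × N') where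
  obj p := (F.obj p.1, G.obj p.2)
  map f := Prod.mkHom (F.map f.1) (G.map f.2)
  map₂ η := Prod.mkHom (F.map₂ η.1) (G.map₂ η.2)
  map₂_id f := Prod.ext (F.map₂_id f.1) (G.map₂_id f.2)
  map₂_comp η θ := Prod.ext (F.map₂_comp η.1 θ.1) (G.map₂_comp η.2 θ.2)
  mapId p := Iso.prod (F.mapId p.1) (G.mapId p.2)
  mapComp f g := Iso.prod (F.mapComp f.1 g.1) (G.mapComp f.2 g.2)
  map₂_whisker_left f _ _ η :=
    Prod.ext (F.map₂_whisker_left f.1 η.1) (G.map₂_whisker_left f.2 η.2)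
  map₂_whisker_right η h :=
    Prod.ext (F.map₂_whisker_right η.1 h.1) (G.map₂_whisker_right η.2 h.2)
  map₂_associator f g h :=
    Prod.ext (F.map₂_associator f.1 g.1 h.1) (G.map₂_associator f.2 g.2 h.2)
  map₂_left_unitor f := Prod.ext (F.map₂_left_unitor f.1) (G.map₂_left_unitor f.2)
  map₂_right_unitor f := Prod.ext (F.map₂_right_unitor f.1) (G.map₂_right_unitor f.2)

end ProductMap

/-! ### Functoriality in the complex -/

section Complexes

variable {S S' : ShortComplex Ab.{u}}

lemma map_g (f : S ⟶ S') (c : S.X₂) : f.τ₃.hom (S.g.hom c) = S'.g.hom (f.τ₂.hom c) :=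
  (ConcreteCategory.congr_hom f.comm₂₃ c).symm

lemma map_f (f : S ⟶ S') (e : S.X₁) : f.τ₂.hom (S.f.hom e) = S'.f.hom (f.τ₁.hom e) :=
  (ConcreteCategory.congr_hom f.comm₁₂ e).symm

/-- The strict pseudofunctor induced by a cochain map. -/
def CochainBicat.map (f : S ⟶ S') : CochainBicat S ⥤ᵖ CochainBicat S' where
  obj x := ⟨f.τ₃.hom x.val⟩
  map h := mk₁ (f.τ₂.hom (v₁ h)) (by rw [v₁_prop h, map_add, map_g])
  map₂ η := mk₂ (f.τ₁.hom (v₂ η)) (by rw [mk₁_val, mk₁_val, v₂_prop η, map_add, map_f])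
  map₂_id _ := hom₂_ext (by simp)
  map₂_comp _ _ := hom₂_ext (by simp)
  mapId _ := eqIso (by simp)
  mapComp _ _ := eqIso (by simp)
  map₂_whisker_left _ _ _ _ := hom₂_ext (sandwich _).symm
  map₂_whisker_right _ _ := hom₂_ext (sandwich _).symm
  map₂_associator _ _ _ := hom₂_ext (by
    change f.τ₁.hom 0 = 0 + (0 + (0 + (0 + 0))); simp)
  map₂_left_unitor _ := hom₂_ext (by change f.τ₁.hom 0 = 0 + (0 + 0); simp)
  map₂_right_unitor _ := hom₂_ext (by change f.τ₁.hom 0 = 0 + (0 + 0); simp)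

/-! ### Cohomology and the split bicategory -/

/-- `H¹ = ker (C¹ ⟶ C²)`. -/
abbrev H1 (S : ShortComplex Ab.{u}) : Type u := S.f.hom.ker

/-- `H² = ker (C² ⟶ C³) / im (C¹ ⟶ C²)`. -/
abbrev H2 (S : ShortComplex Ab.{u}) : Type u := S.g.hom.ker ⧸ S.abToCycles.range

/-- `H³ = C³ / im (C² ⟶ C³)`. -/
abbrev H3 (S : ShortComplex Ab.{u}) : Type u := S.X₃ ⧸ S.g.hom.range

def H1map (f : S ⟶ S') : H1 S →+ H1 S' :=
  (f.τ₁.hom.comp S.f.hom.ker.subtype).codRestrict _ fun e => by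
    change S'.f.hom (f.τ₁.hom e.1) = 0
    rw [← map_f, show S.f.hom e.1 = 0 from e.2, map_zero]

/-- The map induced on the kernels of `C² ⟶ C³`. -/
def cyclesMap (f : S ⟶ S') : S.g.hom.ker →+ S'.g.hom.ker :=
  (f.τ₂.hom.comp S.g.hom.ker.subtype).codRestrict _ fun c => by
    change S'.g.hom (f.τ₂.hom c.1) = 0
    rw [← map_g, show S.g.hom c.1 = 0 from c.2, map_zero]

def H2map (f : S ⟶ S') : H2 S →+ H2 S' :=
  QuotientAddGroup.map _ _ (cyclesMap f) (by
    rintro _ ⟨e, rfl⟩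
    exact ⟨f.τ₁.hom e, Subtype.ext (map_f f e).symm⟩)

def H3map (f : S ⟶ S') : H3 S →+ H3 S' :=
  QuotientAddGroup.map _ _ f.τ₃.hom (by
    rintro _ ⟨c, rfl⟩
    exact ⟨f.τ₂.hom c, (map_g f c).symm⟩)

/-- The complex with the group `A` in degree 3 and zero elsewhere. -/
abbrev conc3 (A : Type u) [AddCommGroup A] : ShortComplex Ab.{u} :=
  ShortComplex.mk (X₁ := .of PUnit) (X₂ := .of PUnit) (X₃ := .of A) 0 0 rfl

/-- The complex with the group `A` in degree 2 and zero elsewhere. -/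
abbrev conc2 (A : Type u) [AddCommGroup A] : ShortComplex Ab.{u} :=
  ShortComplex.mk (X₁ := .of PUnit) (X₂ := .of A) (X₃ := .of PUnit) 0 0 rfl

/-- The complex with the group `A` in degree 1 and zero elsewhere. -/
abbrev conc1 (A : Type u) [AddCommGroup A] : ShortComplex Ab.{u} :=
  ShortComplex.mk (X₁ := .of A) (X₂ := .of PUnit) (X₃ := .of PUnit) 0 0 rfl

variable {A A' : Type u} [AddCommGroup A] [AddCommGroup A']

def conc3Map (φ : A →+ A') : conc3 A ⟶ conc3 A' where
  τ₁ := 0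
  τ₂ := 0
  τ₃ := AddCommGrpCat.ofHom φ

def conc2Map (φ : A →+ A') : conc2 A ⟶ conc2 A' where
  τ₁ := 0
  τ₂ := AddCommGrpCat.ofHom φ
  τ₃ := 0

def conc1Map (φ : A →+ A') : conc1 A ⟶ conc1 A' where
  τ₁ := AddCommGrpCat.ofHom φ
  τ₂ := 0
  τ₃ := 0

/-- The discrete symmetric monoidal bicategory on an abelian group `A`. -/
abbrev Disc (A : Type u) [AddCommGroup A] : Type u := CochainBicat (conc3 A)

/-- `A[1]`: one object, with `A` as the group of its 1-endomorphisms and only identity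
2-morphisms. -/
abbrev Shift1 (A : Type u) [AddCommGroup A] : Type u := CochainBicat (conc2 A)

/-- `A[2]`: one object and one 1-morphism, with `A` as the group of its 2-endomorphisms. -/
abbrev Shift2 (A : Type u) [AddCommGroup A] : Type u := CochainBicat (conc1 A)

/-- The product `H³ × H²[1] × H¹[2]`. -/
abbrev Split (S : ShortComplex Ab.{u}) : Type u := Disc (H3 S) × Shift1 (H2 S) × Shift2 (H1 S)

/-- The pseudofunctor `H³ × H²[1] × H¹[2] ⟶ H'³ × H'²[1] × H'¹[2]` induced by a cochain map. -/
def Split.map (f : S ⟶ S') : Split S ⥤ᵖ Split S' :=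
  prodMap (CochainBicat.map (conc3Map (H3map f)))
    (prodMap (CochainBicat.map (conc2Map (H2map f))) (CochainBicat.map (conc1Map (H1map f))))

end Complexes

/-! ### The monoid of equivalence classes of objects -/

section Pi0

variable {B : Type u} [Bicategory.{w, v} B]

noncomputable def equivSymm {a b : B} (e : a ≌ b) : b ≌ a :=
  Bicategory.Equivalence.mkOfAdjointifyCounit e.counit.symm e.unit.symm

noncomputable def equivTrans {a b c : B} (e : a ≌ b) (e' : b ≌ c) : a ≌ c :=
  Bicategory.Equivalence.mkOfAdjointifyCounit (f := e.hom ≫ e'.hom) (g := e'.inv ≫ e.inv)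
    (e.unit ≪⊗≫ e.hom ◁ᵢ (e'.unit ▷ᵢ e.inv) ≪⊗≫ Iso.refl ((e.hom ≫ e'.hom) ≫ e'.inv ≫ e.inv))
    (Iso.refl ((e'.inv ≫ e.inv) ≫ e.hom ≫ e'.hom) ≪⊗≫ e'.inv ◁ᵢ (e.counit ▷ᵢ e'.hom) ≪⊗≫
      e'.counit)

noncomputable def equivMap {C : Type u₁} [Bicategory.{w₁, v₁} C] (F : B ⥤ᵖ C) {a b : B}
    (e : a ≌ b) : F.obj a ≌ F.obj b :=
  Bicategory.Equivalence.mkOfAdjointifyCounit (f := F.map e.hom) (g := F.map e.inv)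
    ((F.mapId a).symm ≪≫ F.map₂Iso e.unit ≪≫ F.mapComp _ _)
    ((F.mapComp _ _).symm ≪≫ F.map₂Iso e.counit ≪≫ F.mapId b)

variable (B) in
/-- Equivalence of objects. -/
def equivSetoid : Setoid B where
  r a b := Nonempty (a ≌ b)
  iseqv :=
    { refl := fun a => ⟨Bicategory.Equivalence.id a⟩
      symm := fun ⟨e⟩ => ⟨equivSymm e⟩
      trans := fun ⟨e⟩ ⟨e'⟩ => ⟨equivTrans e e'⟩ }

variable (B) in
/-- `π₀`: the equivalence classes of objects. -/
def Pi0 : Type u := Quotient (equivSetoid B)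

/-- The map induced on `π₀` by a pseudofunctor. -/
def Pi0.map {C : Type u₁} [Bicategory.{w₁, v₁} C] (F : B ⥤ᵖ C) : Pi0 B → Pi0 C :=
  Quotient.map' F.obj fun _ _ ⟨e⟩ => ⟨equivMap F e⟩

noncomputable def equivTensor [TensorBicat B] {a a' b b' : B} (e : a ≌ a') (e' : b ≌ b') :
    a ⊠ b ≌ a' ⊠ b' :=
  equivMap TensorBicat.tensor (prodEquiv e e')

/-- The addition on `π₀` is induced by the tensor product. -/
instance [TensorBicat B] : Add (Pi0 B) where
  add := Quotient.map₂ tensorObj fun _ _ ⟨e⟩ _ _ ⟨e'⟩ => ⟨equivTensor e e'⟩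

instance [TensorBicat B] : Zero (Pi0 B) where
  zero := Quotient.mk _ (one B)

instance [SymMonBicatData B] : AddCommMonoid (Pi0 B) where
  add_assoc := by
    rintro ⟨a⟩ ⟨b⟩ ⟨c⟩
    exact Quotient.sound ⟨asc a b c⟩
  zero_add := by
    rintro ⟨a⟩
    exact Quotient.sound ⟨lu a⟩
  add_zero := by
    rintro ⟨a⟩
    exact Quotient.sound ⟨ru a⟩
  add_comm := by
    rintro ⟨a⟩ ⟨b⟩
    exact Quotient.sound ⟨br a b⟩
  nsmul := nsmulRec

end Pi0

end SymBicat

/-! Splitting. Over `ℤ` every complex is formal: a subgroup of a divisible group has divisible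
quotient, so each abelian group has a divisible resolution of length one. Embed `H¹` and `H²` in
divisible groups `E₁` and `E₂` and consider the complex `Q` given by `E₁ ⟶ E₁/H¹ × E₂ ⟶ H³ × E₂/H²`,
whose cohomology is again `H¹`, `H²`, `H³`. Divisibility extends the embeddings to a
quasi-isomorphism `C ⟶ Q`, and the cohomology groups with zero differential map to `Q` by an evident
quasi-isomorphism. So `D(C)` and `Split(C)` are both equivalent to `D(Q)`.

Such a quasi-isomorphism need not have an inverse among cochain maps, so the passage from `D(C)` to
`Split(C)` is a genuine pseudofunctor, built by choosing preimages in `Q` up to coboundaries. A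
`Realization` records the weights in `Q` of all cells, and a `Comparison` records the coboundaries
by which a pseudofunctor changes these weights. Weights are additive under every composition, and a
2-morphism is determined by its weight. The weight of each structure cell is zero, or the correction
of its target minus the correction of its source. Hence each coherence axiom becomes an identity in
the abelian group `Q₁` whose terms telescope. Two pseudofunctors with comparisons are connected by a
symmetric monoidal transformation (`Comparison.trans`). Applied to the two composites and the
identities, this gives the equivalence (`Realization.equivalence`).

Non-naturality. The complex `ℤ ⟶ ℤ ⟶ 0` with differential `2` is quasi-isomorphic to `ℤ/2` in degree
2. Its map to `ℤ` in degree 1, the identity on `C¹`, is zero on cohomology but represents the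
nonzero class of `Ext¹(ℤ/2, ℤ)`. A pseudonatural square for this map would have constraints in `ℤ`
that are, up to a constant, additive on doubled 1-morphisms. As the 1-morphism `1 + 1` is
trivialized by the 2-morphism `1`, naturality would make the image of `1` even, and the equivalence
on the target carries this back to `1` itself (`multTwoMap_not_natural`).

Components. A 1-morphism `x ⟶ y` is exactly a witness that `y - x` is a coboundary, and all of them
are equivalences, so `π₀` is `H³` with no choices made (`pi0Equiv`). -/

namespace SymBicat

open SymMonBicatData

/-! ### Weights of symmetric monoidal bicategories in a three-term complex -/

section Realizations

universe uQ

variable {Q₁ Q₂ Q₃ : Type uQ} [AddCommGroup Q₁] [AddCommGroup Q₂] [AddCommGroup Q₃]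

/-- A realization of a symmetric monoidal bicategory in a complex `Q₁ ⟶ Q₂ ⟶ Q₃` of abelian groups:
weights of objects, 1-morphisms and 2-morphisms that turn all compositions and the tensor product
into addition and vanish on the structure cells, in a way that is essentially surjective on
objects and on 1-morphisms and bijective on 2-morphisms. -/
structure Realization (B : Type u) [Bicategory.{w, v} B] [SymMonBicatData B]
    (d₁ : Q₁ →+ Q₂) (d₂ : Q₂ →+ Q₃) where
  w₀ : B → Q₃
  w₁ {x y : B} : (x ⟶ y) → Q₂
  w₂ {x y : B} {f g : x ⟶ y} : (f ⟶ g) → Q₁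
  d_d (q : Q₁) : d₂ (d₁ q) = 0
  w₁_prop {x y : B} (f : x ⟶ y) : w₀ y = w₀ x + d₂ (w₁ f)
  w₂_prop {x y : B} {f g : x ⟶ y} (η : f ⟶ g) : w₁ g = w₁ f + d₁ (w₂ η)
  w₁_id (x : B) : w₁ (𝟙 x) = 0
  w₁_comp {x y z : B} (f : x ⟶ y) (g : y ⟶ z) : w₁ (f ≫ g) = w₁ f + w₁ g
  w₂_id {x y : B} (f : x ⟶ y) : w₂ (𝟙 f) = 0
  w₂_comp {x y : B} {f g h : x ⟶ y} (η : f ⟶ g) (θ : g ⟶ h) : w₂ (η ≫ θ) = w₂ η + w₂ θ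
  w₂_whiskerLeft {x y z : B} (f : x ⟶ y) {g h : y ⟶ z} (η : g ⟶ h) : w₂ (f ◁ η) = w₂ η
  w₂_whiskerRight {x y z : B} {f g : x ⟶ y} (η : f ⟶ g) (h : y ⟶ z) : w₂ (η ▷ h) = w₂ η
  w₂_associator {x y z t : B} (f : x ⟶ y) (g : y ⟶ z) (h : z ⟶ t) : w₂ (α_ f g h).hom = 0
  w₂_leftUnitor {x y : B} (f : x ⟶ y) : w₂ (λ_ f).hom = 0
  w₂_rightUnitor {x y : B} (f : x ⟶ y) : w₂ (ρ_ f).hom = 0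
  w₀_tensor (x y : B) : w₀ (x ⊠ y) = w₀ x + w₀ y
  w₀_one : w₀ (one B) = 0
  w₁_tensor {x x' y y' : B} (f : x ⟶ x') (g : y ⟶ y') : w₁ (f ⊠₁ g) = w₁ f + w₁ g
  w₂_tensor {x x' y y' : B} {f f' : x ⟶ x'} {g g' : y ⟶ y'} (η : f ⟶ f') (θ : g ⟶ g') :
    w₂ (tensorHom₂ η θ) = w₂ η + w₂ θ
  w₂_tensorId (x y : B) : w₂ (tensorId x y).hom = 0
  w₂_tensorComp {x x' x'' y y' y'' : B} (f : x ⟶ x') (f' : x' ⟶ x'') (g : y ⟶ y')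
    (g' : y' ⟶ y'') : w₂ (tensorComp f f' g g').hom = 0
  w₁_asc (a b c : B) : w₁ (asc a b c).hom = 0
  w₁_asc_inv (a b c : B) : w₁ (asc a b c).inv = 0
  w₂_asc_unit (a b c : B) : w₂ (asc a b c).unit.hom = 0
  w₂_asc_counit (a b c : B) : w₂ (asc a b c).counit.hom = 0
  w₁_lu (a : B) : w₁ (lu a).hom = 0
  w₁_ru (a : B) : w₁ (ru a).hom = 0
  w₁_br (a b : B) : w₁ (br a b).hom = 0
  w₂_ascN {a a' b b' c c' : B} (f : a ⟶ a') (g : b ⟶ b') (h : c ⟶ c') : w₂ (ascN f g h).hom = 0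
  w₂_luN {a a' : B} (f : a ⟶ a') : w₂ (luN f).hom = 0
  w₂_ruN {a a' : B} (f : a ⟶ a') : w₂ (ruN f).hom = 0
  w₂_brN {a a' b b' : B} (f : a ⟶ a') (g : b ⟶ b') : w₂ (brN f g).hom = 0
  w₂_pent (a b c d : B) : w₂ (pent a b c d).hom = 0
  w₂_mid (a b : B) : w₂ (mid a b).hom = 0
  w₂_hexR (a b c : B) : w₂ (hexR a b c).hom = 0
  w₂_hexS (a b c : B) : w₂ (hexS a b c).hom = 0
  w₂_syl (a b : B) : w₂ (syl a b).hom = 0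
  -- Only 2-morphisms are matched exactly. Below them a weight is attained up to a coboundary, as an
  -- equivalence of bicategories reaches objects and 1-morphisms only up to an invertible cell.
  faithful {x y : B} {f g : x ⟶ y} {η θ : f ⟶ g} : w₂ η = w₂ θ → η = θ
  full₂ {x y : B} (f g : x ⟶ y) (q : Q₁) : w₁ g = w₁ f + d₁ q → ∃ η : f ⟶ g, w₂ η = q
  full₁ (x y : B) (q : Q₂) : w₀ y = w₀ x + d₂ q → ∃ (f : x ⟶ y) (p : Q₁), w₁ f = q + d₁ p
  surj₀ (q : Q₃) : ∃ (x : B) (p : Q₂), w₀ x = q + d₂ p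

namespace Realization

attribute [simp] w₁_id w₁_comp w₂_id w₂_comp w₂_whiskerLeft w₂_whiskerRight w₂_associator
  w₂_leftUnitor w₂_rightUnitor w₀_tensor w₀_one w₁_tensor w₂_tensor w₂_tensorId w₂_tensorComp
  w₁_asc w₁_asc_inv w₂_asc_unit w₂_asc_counit w₁_lu w₁_ru w₁_br w₂_ascN w₂_luN w₂_ruN w₂_brN
  w₂_pent w₂_mid w₂_hexR w₂_hexS w₂_syl d_d

variable {B : Type u} [Bicategory.{w, v} B] [SymMonBicatData B]
  {d₁ : Q₁ →+ Q₂} {d₂ : Q₂ →+ Q₃} (R : Realization B d₁ d₂)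

/-- This reduces every axiom between invertible 2-morphisms to an equation in `Q₁`. -/
lemma iso_ext {x y : B} {f g : x ⟶ y} {η θ : f ≅ g} (h : R.w₂ η.hom = R.w₂ θ.hom) : η = θ :=
  Iso.ext (R.faithful h)

@[simp] lemma w₂_inv {x y : B} {f g : x ⟶ y} (η : f ≅ g) : R.w₂ η.inv = -R.w₂ η.hom :=
  eq_neg_of_add_eq_zero_right (by rw [← w₂_comp, η.hom_inv_id, w₂_id])

lemma exists_iso {x y : B} (f g : x ⟶ y) (q : Q₁) (h : R.w₁ g = R.w₁ f + d₁ q) :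
    ∃ η : f ≅ g, R.w₂ η.hom = q := by
  obtain ⟨η, hη⟩ := R.full₂ f g q h
  obtain ⟨θ, hθ⟩ := R.full₂ g f (-q) (by rw [h, map_neg, add_neg_cancel_right])
  exact ⟨⟨η, θ, R.faithful (by simp [hη, hθ]), R.faithful (by simp [hη, hθ])⟩, hη⟩

/-- The invertible 2-morphism of given weight. -/
noncomputable def iso {x y : B} {f g : x ⟶ y} (q : Q₁) (h : R.w₁ g = R.w₁ f + d₁ q) : f ≅ g :=
  (R.exists_iso f g q h).choose

@[simp] lemma w₂_iso {x y : B} {f g : x ⟶ y} (q : Q₁) (h : R.w₁ g = R.w₁ f + d₁ q) :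
    R.w₂ (R.iso q h).hom = q :=
  (R.exists_iso f g q h).choose_spec

/-- Every 1-morphism of a realized bicategory is an equivalence. -/
lemma isEquiv (R : Realization B d₁ d₂) {x y : B} (f : x ⟶ y) : IsEquiv f := by
  obtain ⟨g, p, hg⟩ := R.full₁ y x (-R.w₁ f) (by rw [R.w₁_prop f, map_neg, add_neg_cancel_right])
  -- The weight of `g` is `-w₁ f + d₁ p`, so both composites have weight `d₁ p`. The unit therefore
  -- has weight `p` and the counit `-p`, and the counit is then adjusted to satisfy the triangle
  -- identity.
  exact ⟨Bicategory.Equivalence.mkOfAdjointifyCounit (f := f) (g := g)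
    (R.iso p (by simp [hg])) (R.iso (-p) (by simp [hg])), rfl⟩

-- The inserted coherence `⊗𝟙` unfolds into associators, unitors and identities, so in each use
-- `simp` finds that its weight is zero.
@[simp] lemma w₂_bicategoricalIsoComp {x y : B} {f g h i : x ⟶ y} [BicategoricalCoherence g h]
    (η : f ≅ g) (θ : h ≅ i) :
    R.w₂ (η ≪⊗≫ θ).hom = R.w₂ η.hom + (R.w₂ (⊗𝟙 : g ≅ h).hom + R.w₂ θ.hom) := by
  simp [bicategoricalIsoComp]

@[simp] lemma w₂_tensorIso {x x' y y' : B} {f f' : x ⟶ x'} {g g' : y ⟶ y'} (η : f ≅ f')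
    (θ : g ≅ g') : R.w₂ (η ⊠₂ θ).hom = R.w₂ η.hom + R.w₂ θ.hom :=
  R.w₂_tensor η.hom θ.hom

@[simp] lemma w₂_sqV {a a' b b' c c' : B} {f : a ⟶ a'} {t : a ⟶ b} {t' : a' ⟶ b'} {g : b ⟶ b'}
    {s : b ⟶ c} {s' : b' ⟶ c'} {h : c ⟶ c'} (p : f ≫ t' ≅ t ≫ g) (q : g ≫ s' ≅ s ≫ h) :
    R.w₂ (sqV p q).hom = R.w₂ p.hom + R.w₂ q.hom := by
  simp [sqV]

@[simp] lemma w₂_sqH {a a' a'' b b' b'' : B} {f : a ⟶ a'} {f₂ : a' ⟶ a''} {t : a ⟶ b}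
    {t' : a' ⟶ b'} {t'' : a'' ⟶ b''} {g : b ⟶ b'} {g₂ : b' ⟶ b''} (p : f ≫ t' ≅ t ≫ g)
    (q : f₂ ≫ t'' ≅ t' ≫ g₂) : R.w₂ (sqH p q).hom = R.w₂ q.hom + R.w₂ p.hom := by
  simp [sqH]

@[simp] lemma w₂_sqId {a a' : B} (f : a ⟶ a') : R.w₂ (sqId f).hom = 0 := by
  simp [sqId]

@[simp] lemma w₂_sqOne {a a' : B} (f : a ⟶ a') : R.w₂ (sqOne f).hom = 0 := by
  simp [sqOne]

@[simp] lemma w₂_sqT {a a' b b' : B} {f : a ⟶ a'} {t : a ⟶ b} {t' : a' ⟶ b'} {g : b ⟶ b'}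
    {c c' d d' : B} {h : c ⟶ c'} {s : c ⟶ d} {s' : c' ⟶ d'} {k : d ⟶ d'}
    (p : f ≫ t' ≅ t ≫ g) (q : h ≫ s' ≅ s ≫ k) :
    R.w₂ (sqT p q).hom = R.w₂ p.hom + R.w₂ q.hom := by
  simp [sqT]

@[simp] lemma w₂_sqR {a a' b b' : B} {f : a ⟶ a'} {t : a ⟶ b} {t' : a' ⟶ b'} {g : b ⟶ b'}
    (p : f ≫ t' ≅ t ≫ g) {x x' : B} (k : x ⟶ x') : R.w₂ (sqR p k).hom = R.w₂ p.hom := by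
  simp [sqR]

@[simp] lemma w₂_sqL {x x' : B} (k : x ⟶ x') {a a' b b' : B} {f : a ⟶ a'} {t : a ⟶ b}
    {t' : a' ⟶ b'} {g : b ⟶ b'} (p : f ≫ t' ≅ t ≫ g) :
    R.w₂ (sqL k p).hom = R.w₂ p.hom := by
  simp [sqL]

@[simp] lemma w₂_isoR {a a' : B} {f f' : a ⟶ a'} (η : f ≅ f') (c : B) :
    R.w₂ (isoR η c).hom = R.w₂ η.hom := by
  simp [isoR]

@[simp] lemma w₂_isoL (c : B) {a a' : B} {f f' : a ⟶ a'} (η : f ≅ f') :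
    R.w₂ (isoL c η).hom = R.w₂ η.hom := by
  simp [isoL]

@[simp] lemma w₂_compR {a b c : B} (f : a ⟶ b) (g : b ⟶ c) (x : B) :
    R.w₂ (compR f g x).hom = 0 := by
  simp [compR]

@[simp] lemma w₂_compL (x : B) {a b c : B} (f : a ⟶ b) (g : b ⟶ c) :
    R.w₂ (compL x f g).hom = 0 := by
  simp [compL]

@[simp] lemma w₂_compR3 {a b c d : B} (f : a ⟶ b) (g : b ⟶ c) (h : c ⟶ d) (x : B) :
    R.w₂ (compR3 f g h x).hom = 0 := by
  simp [compR3]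

@[simp] lemma w₂_compL3 (x : B) {a b c d : B} (f : a ⟶ b) (g : b ⟶ c) (h : c ⟶ d) :
    R.w₂ (compL3 x f g h).hom = 0 := by
  simp [compL3]

@[simp] lemma w₂_exch {a a' b b' : B} (f : a ⟶ a') (g : b ⟶ b') : R.w₂ (exch f g).hom = 0 := by
  simp [exch]

@[simp] lemma w₂_asA {a a' : B} (f : a ⟶ a') (b c : B) : R.w₂ (asA f b c).hom = 0 := by
  simp [asA]

@[simp] lemma w₂_asB (a : B) {b b' : B} (f : b ⟶ b') (c : B) : R.w₂ (asB a f c).hom = 0 := by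
  simp [asB]

@[simp] lemma w₂_asC (a b : B) {c c' : B} (f : c ⟶ c') : R.w₂ (asC a b f).hom = 0 := by
  simp [asC]

@[simp] lemma w₂_btA {a a' : B} (f : a ⟶ a') (b : B) : R.w₂ (btA f b).hom = 0 := by
  simp [btA]

@[simp] lemma w₂_btB (a : B) {b b' : B} (f : b ⟶ b') : R.w₂ (btB a f).hom = 0 := by
  simp [btB]

end Realization

/-! ### Cochains comparing weights along a symmetric monoidal pseudofunctor -/

variable {M : Type u₁} [Bicategory.{w₁, v₁} M] {N : Type u₂} [Bicategory.{w₂, v₂} N]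
  {P : Type u₃} [Bicategory.{w₃, v₃} P]
  {d₁ : Q₁ →+ Q₂} {d₂ : Q₂ →+ Q₃}

/-- A comparison of the weights of the source and the target of a symmetric monoidal
pseudofunctor between realized bicategories: the weights of cells and of their images differ by
the coboundary of the cochain `q₀`, `q₁`, `qχ`, `qι`. -/
structure Comparison [SymMonBicatData M] [SymMonBicatData N] (R : Realization M d₁ d₂)
    (R' : Realization N d₁ d₂) (F : SymMonFunctorData M N) where
  q₀ (x : M) : Q₂
  q₁ {x y : M} (f : x ⟶ y) : Q₁
  qχ (x y : M) : Q₁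
  qι : Q₁
  w₀_obj (x : M) : R'.w₀ (F.obj x) = R.w₀ x + d₂ (q₀ x)
  w₁_map {x y : M} (f : x ⟶ y) : R'.w₁ (F.map f) = R.w₁ f + q₀ y - q₀ x + d₁ (q₁ f)
  -- One rule gives this and all later 2-cell equations. Assign the correction `q₁ f` to `F.map f`,
  -- `qχ x y` to `χ x y`, `qι` to `ι`, and zero to the structure 1-morphisms of `N`. The weight of a
  -- 2-cell is then that of its counterpart in `M`, plus the correction of its target, minus that of
  -- its source.
  w₂_map₂ {x y : M} {f g : x ⟶ y} (η : f ⟶ g) : R'.w₂ (F.map₂ η) = R.w₂ η + q₁ g - q₁ f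
  w₂_mapId (x : M) : R'.w₂ (F.mapId x).hom = -q₁ (𝟙 x)
  w₂_mapComp {x y z : M} (f : x ⟶ y) (g : y ⟶ z) :
    R'.w₂ (F.mapComp f g).hom = q₁ f + q₁ g - q₁ (f ≫ g)
  w₁_χ (x y : M) : R'.w₁ (F.χ x y) = q₀ (x ⊠ y) - q₀ x - q₀ y + d₁ (qχ x y)
  w₁_ι : R'.w₁ F.ι = q₀ (one M) + d₁ qι
  w₂_χN {x x' y y' : M} (f : x ⟶ x') (g : y ⟶ y') :
    R'.w₂ (F.χN f g).hom = qχ x y + q₁ (f ⊠₁ g) - q₁ f - q₁ g - qχ x' y'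
  w₂_ω (x y z : M) :
    R'.w₂ (F.ω x y z).hom =
      qχ y z + qχ x (y ⊠ z) - qχ x y - qχ (x ⊠ y) z - q₁ (as x y z)
  w₂_γ (x : M) : R'.w₂ (F.γ x).hom = -qι - qχ (one M) x - q₁ (lu x).hom
  w₂_δ (x : M) : R'.w₂ (F.δ x).hom = -qι - qχ x (one M) - q₁ (ru x).hom
  w₂_υ (x y : M) : R'.w₂ (F.υ x y).hom = qχ y x - qχ x y - q₁ (bt x y)

namespace Comparison

section

variable [SymMonBicatData M] [SymMonBicatData N] [SymMonBicatData P]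
  {R : Realization M d₁ d₂} {R' : Realization N d₁ d₂} {R'' : Realization P d₁ d₂}

section

variable {F : SymMonFunctorData M N} (c : Comparison R R' F)

lemma w₂_fun2 {x y z : M} (f : x ⟶ y) (g : y ⟶ z) :
    R'.w₂ (fun2 F.toPseudofunctor f g).hom = c.q₁ (f ≫ g) - c.q₁ f - c.q₁ g := by
  simp only [fun2, Iso.symm_hom, Realization.w₂_inv, c.w₂_mapComp]; abel

lemma w₂_fun3 {x y z t : M} (f : x ⟶ y) (g : y ⟶ z) (h : z ⟶ t) :
    R'.w₂ (fun3 F.toPseudofunctor f g h).hom =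
      c.q₁ (f ≫ g ≫ h) - c.q₁ f - c.q₁ g - c.q₁ h := by
  simp [fun3, c.w₂_fun2]; abel

lemma w₂_map₂Iso {x y : M} {f g : x ⟶ y} (η : f ≅ g) :
    R'.w₂ (F.toPseudofunctor.map₂Iso η).hom = R.w₂ η.hom + c.q₁ g - c.q₁ f := by
  simp [c.w₂_map₂]

lemma w₂_sqMap {a a' b b' : M} {f : a ⟶ a'} {t : a ⟶ b} {t' : a' ⟶ b'} {g : b ⟶ b'}
    (p : f ≫ t' ≅ t ≫ g) :
    R'.w₂ (sqMap F.toPseudofunctor p).hom =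
      R.w₂ p.hom + c.q₁ t + c.q₁ g - c.q₁ f - c.q₁ t' := by
  simp [sqMap, c.w₂_map₂, c.w₂_mapComp]; abel

lemma w₂_χA {x x' : M} (f : x ⟶ x') (y : M) :
    R'.w₂ (F.χA f y).hom = c.qχ x y + c.q₁ (f ▹ y) - c.q₁ f - c.qχ x' y := by
  simp [SymMonFunctorData.χA, c.w₂_χN, c.w₂_mapId]; abel

lemma w₂_χB (x : M) {y y' : M} (f : y ⟶ y') :
    R'.w₂ (F.χB x f).hom = c.qχ x y + c.q₁ (x ◂ f) - c.q₁ f - c.qχ x y' := by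
  simp [SymMonFunctorData.χB, c.w₂_χN, c.w₂_mapId]; abel

lemma w₂_ιN : R'.w₂ F.ιN.hom = c.q₁ (𝟙 (one M)) := by
  simp [SymMonFunctorData.ιN, c.w₂_mapId]

lemma w₂_funUnit_asc (x y z : M) :
    R'.w₂ (funUnit F.toPseudofunctor (asc x y z)).hom = - c.q₁ (as x y z) - c.q₁ (ai x y z) := by
  simp only [funUnit, Iso.trans_hom, Iso.symm_hom, Realization.w₂_comp, Realization.w₂_inv,
    c.w₂_fun2, c.w₂_map₂Iso, c.w₂_mapId, Realization.w₂_asc_unit]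
  abel

/-- The term `q₁ (as x y z)` contributed by the inverse of `ω` cancels against the one in `funUnit`,
which leaves `q₁ (ai x y z)`, as the rule target minus source predicts for the mate. -/
lemma w₂_ωI (x y z : M) :
    R'.w₂ (F.ωI x y z).hom =
      c.qχ x y + c.qχ (x ⊠ y) z - c.qχ y z - c.qχ x (y ⊠ z) - c.q₁ (ai x y z) := by
  simp [SymMonFunctorData.ωI, c.w₂_ω, c.w₂_funUnit_asc]; abel

end

/-- The comparison of the identity is zero. -/
def id (R : Realization M d₁ d₂) : Comparison R R (SymMonFunctorData.id M) where
  q₀ _ := 0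
  q₁ _ := 0
  qχ _ _ := 0
  qι := 0
  w₀_obj x := show R.w₀ x = _ by simp
  w₁_map f := show R.w₁ f = _ by simp
  w₂_map₂ η := show R.w₂ η = _ by simp
  w₂_mapId x := show R.w₂ (𝟙 (𝟙 x)) = _ by simp
  w₂_mapComp f g := show R.w₂ (𝟙 (f ≫ g)) = _ by simp
  w₁_χ x y := show R.w₁ (𝟙 (x ⊠ y)) = _ by simp
  w₁_ι := show R.w₁ (𝟙 (one M)) = _ by simp
  w₂_χN f g := show R.w₂ (sqId (f ⊠₁ g)).hom = _ by simp
  w₂_ω x y z := show R.w₂ (SymMonFunctorData.idω x y z).hom = _ by simp [SymMonFunctorData.idω]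
  w₂_γ x := show R.w₂ (SymMonFunctorData.idγ x).hom = _ by simp [SymMonFunctorData.idγ]
  w₂_δ x := show R.w₂ (SymMonFunctorData.idδ x).hom = _ by simp [SymMonFunctorData.idδ]
  w₂_υ x y := show R.w₂ (sqOne (bt x y)).hom = _ by simp

/-- The comparison of a composite. -/
def comp {F : SymMonFunctorData M N} {G : SymMonFunctorData N P} (c : Comparison R R' F)
    (c' : Comparison R' R'' G) : Comparison R R'' (F.comp G) where
  q₀ x := c.q₀ x + c'.q₀ (F.obj x)
  q₁ f := c.q₁ f + c'.q₁ (F.map f)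
  -- The last term appears because the composite `χ` contains `G.map (F.χ x y)`, on which `G` acts
  -- as on any 1-morphism. The same happens for `ι`.
  qχ x y := c.qχ x y + c'.qχ (F.obj x) (F.obj y) + c'.q₁ (F.χ x y)
  qι := c.qι + c'.qι + c'.q₁ F.ι
  w₀_obj x := show R''.w₀ (G.obj (F.obj x)) = _ by
    simp only [c.w₀_obj, c'.w₀_obj, map_add]; abel
  w₁_map f := show R''.w₁ (G.map (F.map f)) = _ by
    simp only [c.w₁_map, c'.w₁_map, map_add]; abel
  w₂_map₂ η := show R''.w₂ (G.map₂ (F.map₂ η)) = _ by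
    simp only [c.w₂_map₂, c'.w₂_map₂]; abel
  w₂_mapId x := show R''.w₂ (G.map₂Iso (F.mapId x) ≪≫ G.mapId (F.obj x)).hom = _ by
    simp only [Iso.trans_hom, Realization.w₂_comp, c'.w₂_map₂Iso, c.w₂_mapId, c'.w₂_mapId]; abel
  w₂_mapComp f g :=
    show R''.w₂ (G.map₂Iso (F.mapComp f g) ≪≫ G.mapComp (F.map f) (F.map g)).hom = _ by
    simp only [Iso.trans_hom, Realization.w₂_comp, c'.w₂_map₂Iso, c.w₂_mapComp, c'.w₂_mapComp]
    abel
  w₁_χ x y := show R''.w₁ (G.χ (F.obj x) (F.obj y) ≫ G.map (F.χ x y)) = _ by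
    simp only [Realization.w₁_comp, c.w₁_χ, c'.w₁_χ, c'.w₁_map, map_add]; abel
  w₁_ι := show R''.w₁ (G.ι ≫ G.map F.ι) = _ by
    simp only [Realization.w₁_comp, c.w₁_ι, c'.w₁_ι, c'.w₁_map, map_add]; abel
  w₂_χN f g :=
    show R''.w₂ (sqV (G.χN (F.map f) (F.map g)) (sqMap G.toPseudofunctor (F.χN f g))).hom = _ by
    simp only [Realization.w₂_sqV, c.w₂_χN, c'.w₂_χN, c'.w₂_sqMap]; abel
  w₂_ω x y z := show R''.w₂ (SymMonFunctorData.compω F G x y z).hom = _ by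
    simp [SymMonFunctorData.compω, c.w₂_ω, c'.w₂_ω, c'.w₂_χA, c'.w₂_χB, c'.w₂_fun3, c'.w₂_map₂]
    abel
  w₂_γ x := show R''.w₂ (SymMonFunctorData.compγ F G x).hom = _ by
    simp [SymMonFunctorData.compγ, c.w₂_γ, c'.w₂_γ, c'.w₂_χA, c'.w₂_fun3, c'.w₂_map₂]; abel
  w₂_δ x := show R''.w₂ (SymMonFunctorData.compδ F G x).hom = _ by
    simp [SymMonFunctorData.compδ, c.w₂_δ, c'.w₂_δ, c'.w₂_χB, c'.w₂_fun3, c'.w₂_map₂]; abel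
  w₂_υ x y := show R''.w₂ (SymMonFunctorData.compυ F G x y).hom = _ by
    simp [SymMonFunctorData.compυ, c.w₂_υ, c'.w₂_υ, c'.w₂_fun2, c'.w₂_map₂]; abel

end

end Comparison

end Realizations

/-! ### Transport between bicategories realized in the same complex -/

section Transport

universe uQ

variable {Q₁ Q₂ Q₃ : Type uQ} [AddCommGroup Q₁] [AddCommGroup Q₂] [AddCommGroup Q₃]
  {M : Type u₁} [Bicategory.{w₁, v₁} M] {N : Type u₂} [Bicategory.{w₂, v₂} N]
  {d₁ : Q₁ →+ Q₂} {d₂ : Q₂ →+ Q₃}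

namespace Realization

section

variable [SymMonBicatData M] [SymMonBicatData N]
  (R : Realization M d₁ d₂) (R' : Realization N d₁ d₂)

/-- The 2-morphism of given weight. -/
noncomputable def hom {x y : M} {f g : x ⟶ y} (q : Q₁) (h : R.w₁ g = R.w₁ f + d₁ q) : f ⟶ g :=
  (R.iso q h).hom

@[simp] lemma w₂_hom {x y : M} {f g : x ⟶ y} (q : Q₁) (h : R.w₁ g = R.w₁ f + d₁ q) :
    R.w₂ (R.hom q h) = q :=
  R.w₂_iso q h

/-- A 1-morphism whose weight is given up to a coboundary. -/
noncomputable def lift₁ {x y : M} (q : Q₂) (h : R.w₀ y = R.w₀ x + d₂ q) : x ⟶ y :=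
  (R.full₁ x y q h).choose

/-- The cochain that corrects the weight of `lift₁`. -/
noncomputable def corr₁ {x y : M} (q : Q₂) (h : R.w₀ y = R.w₀ x + d₂ q) : Q₁ :=
  (R.full₁ x y q h).choose_spec.choose

lemma w₁_lift₁ {x y : M} (q : Q₂) (h : R.w₀ y = R.w₀ x + d₂ q) :
    R.w₁ (R.lift₁ q h) = q + d₁ (R.corr₁ q h) :=
  (R.full₁ x y q h).choose_spec.choose_spec

/-- An object whose weight is given up to a coboundary. -/
noncomputable def lift₀ (q : Q₃) : M := (R.surj₀ q).choose

/-- The cochain that corrects the weight of `lift₀`. -/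
noncomputable def corr₀ (q : Q₃) : Q₂ := (R.surj₀ q).choose_spec.choose

lemma w₀_lift₀ (q : Q₃) : R.w₀ (R.lift₀ q) = q + d₂ (R.corr₀ q) :=
  (R.surj₀ q).choose_spec.choose_spec

/-- The image of an object under the transport pseudofunctor. -/
noncomputable def tObj (x : M) : N := R'.lift₀ (R.w₀ x)

noncomputable def tCorr₀ (x : M) : Q₂ := R'.corr₀ (R.w₀ x)

lemma w₀_tObj (x : M) : R'.w₀ (tObj R R' x) = R.w₀ x + d₂ (tCorr₀ R R' x) :=
  R'.w₀_lift₀ _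

/-- The chosen objects have the required weights only up to `tCorr₀`, so the weight of `f` has to be
shifted by the corrections at its two ends before it can be lifted. -/
lemma tMap_aux {x y : M} (f : x ⟶ y) : R'.w₀ (tObj R R' y) =
    R'.w₀ (tObj R R' x) + d₂ (R.w₁ f + tCorr₀ R R' y - tCorr₀ R R' x) := by
  simp only [w₀_tObj, R.w₁_prop f, map_add, map_sub]; abel

/-- The image of a 1-morphism under the transport pseudofunctor. -/
noncomputable def tMap {x y : M} (f : x ⟶ y) : tObj R R' x ⟶ tObj R R' y :=
  R'.lift₁ _ (tMap_aux R R' f)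

noncomputable def tCorr₁ {x y : M} (f : x ⟶ y) : Q₁ := R'.corr₁ _ (tMap_aux R R' f)

lemma w₁_tMap {x y : M} (f : x ⟶ y) : R'.w₁ (tMap R R' f) =
    R.w₁ f + tCorr₀ R R' y - tCorr₀ R R' x + d₁ (tCorr₁ R R' f) :=
  R'.w₁_lift₁ _ _

/-- The transport pseudofunctor between two bicategories realized in the same complex. -/
noncomputable def tFunctor : M ⥤ᵖ N where
  obj := tObj R R'
  map := tMap R R'
  -- The chosen lifts are not strictly functorial. Each 2-cell is given the weight that the
  -- corrections of its target and source force, and the axioms follow by telescoping.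
  map₂ {_ _ f g} η := R'.hom (R.w₂ η + tCorr₁ R R' g - tCorr₁ R R' f) (by
    simp only [w₁_tMap, R.w₂_prop η, map_add, map_sub]; abel)
  map₂_id _ := R'.faithful (by simp)
  map₂_comp _ _ := R'.faithful (by simp; abel)
  mapId x := R'.iso (-tCorr₁ R R' (𝟙 x)) (by simp [w₁_tMap])
  mapComp f g := R'.iso (tCorr₁ R R' f + tCorr₁ R R' g - tCorr₁ R R' (f ≫ g)) (by
    simp only [w₁_tMap, w₁_comp, map_add, map_sub]; abel)
  map₂_whisker_left _ _ _ _ := R'.faithful (by simp; abel)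
  map₂_whisker_right _ _ := R'.faithful (by simp; abel)
  map₂_associator _ _ _ := R'.faithful (by simp; abel)
  map₂_left_unitor _ := R'.faithful (by simp; abel)
  map₂_right_unitor _ := R'.faithful (by simp; abel)

lemma tχ_aux (x y : M) : R'.w₀ (tObj R R' (x ⊠ y)) = R'.w₀ (tObj R R' x ⊠ tObj R R' y) +
    d₂ (tCorr₀ R R' (x ⊠ y) - tCorr₀ R R' x - tCorr₀ R R' y) := by
  simp only [w₀_tObj, w₀_tensor, map_sub]; abel

noncomputable def tχ (x y : M) : tObj R R' x ⊠ tObj R R' y ⟶ tObj R R' (x ⊠ y) :=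
  R'.lift₁ _ (tχ_aux R R' x y)

noncomputable def tCorrχ (x y : M) : Q₁ := R'.corr₁ _ (tχ_aux R R' x y)

lemma w₁_tχ (x y : M) : R'.w₁ (tχ R R' x y) =
    tCorr₀ R R' (x ⊠ y) - tCorr₀ R R' x - tCorr₀ R R' y + d₁ (tCorrχ R R' x y) :=
  R'.w₁_lift₁ _ _

lemma tι_aux : R'.w₀ (tObj R R' (one M)) = R'.w₀ (one N) + d₂ (tCorr₀ R R' (one M)) := by
  simp [w₀_tObj]

noncomputable def tι : one N ⟶ tObj R R' (one M) := R'.lift₁ _ (tι_aux R R')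

noncomputable def tCorrι : Q₁ := R'.corr₁ _ (tι_aux R R')

lemma w₁_tι : R'.w₁ (tι R R') = tCorr₀ R R' (one M) + d₁ (tCorrι R R') := R'.w₁_lift₁ _ _

/-- This weight and those of `tω`, `tγ`, `tδ`, `tυ` are the ones demanded by `Comparison`. Existence
of the cell only requires that `d₁` of the weight be the difference of the weights of the two
1-morphisms. -/
noncomputable def tχN {x x' y y' : M} (f : x ⟶ x') (g : y ⟶ y') :
    tMap R R' f ⊠₁ tMap R R' g ≫ tχ R R' x' y' ≅ tχ R R' x y ≫ tMap R R' (f ⊠₁ g) :=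
  R'.iso (tCorrχ R R' x y + tCorr₁ R R' (f ⊠₁ g) - tCorr₁ R R' f - tCorr₁ R R' g - tCorrχ R R' x' y') (by
    simp only [w₁_comp, w₁_tensor, w₁_tMap, w₁_tχ, map_add, map_sub]; abel)

lemma w₂_tχN {x x' y y' : M} (f : x ⟶ x') (g : y ⟶ y') : R'.w₂ (tχN R R' f g).hom =
    tCorrχ R R' x y + tCorr₁ R R' (f ⊠₁ g) - tCorr₁ R R' f - tCorr₁ R R' g - tCorrχ R R' x' y' :=
  R'.w₂_iso _ _

noncomputable def tω (x y z : M) :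
    tχ R R' x y ▹ tObj R R' z ≫ tχ R R' (x ⊠ y) z ≫ tMap R R' (as x y z) ≅
      as (tObj R R' x) (tObj R R' y) (tObj R R' z) ≫ tObj R R' x ◂ tχ R R' y z ≫
        tχ R R' x (y ⊠ z) :=
  R'.iso (tCorrχ R R' y z + tCorrχ R R' x (y ⊠ z) - tCorrχ R R' x y - tCorrχ R R' (x ⊠ y) z -
      tCorr₁ R R' (as x y z)) (by
    simp only [w₁_comp, w₁_tensor, w₁_tMap, w₁_tχ, w₁_id, w₁_asc, map_add, map_sub]; abel)

lemma w₂_tω (x y z : M) : R'.w₂ (tω R R' x y z).hom =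
    tCorrχ R R' y z + tCorrχ R R' x (y ⊠ z) - tCorrχ R R' x y - tCorrχ R R' (x ⊠ y) z -
      tCorr₁ R R' (as x y z) :=
  R'.w₂_iso _ _

noncomputable def tγ (x : M) :
    tι R R' ▹ tObj R R' x ≫ tχ R R' (one M) x ≫ tMap R R' (lu x).hom ≅ (lu (tObj R R' x)).hom :=
  R'.iso (-tCorrι R R' - tCorrχ R R' (one M) x - tCorr₁ R R' (lu x).hom) (by
    simp only [w₁_comp, w₁_tensor, w₁_tMap, w₁_tχ, w₁_tι, w₁_id, w₁_lu, map_neg, map_sub]; abel)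

lemma w₂_tγ (x : M) : R'.w₂ (tγ R R' x).hom =
    -tCorrι R R' - tCorrχ R R' (one M) x - tCorr₁ R R' (lu x).hom :=
  R'.w₂_iso _ _

noncomputable def tδ (x : M) :
    tObj R R' x ◂ tι R R' ≫ tχ R R' x (one M) ≫ tMap R R' (ru x).hom ≅ (ru (tObj R R' x)).hom :=
  R'.iso (-tCorrι R R' - tCorrχ R R' x (one M) - tCorr₁ R R' (ru x).hom) (by
    simp only [w₁_comp, w₁_tensor, w₁_tMap, w₁_tχ, w₁_tι, w₁_id, w₁_ru, map_neg, map_sub]; abel)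

lemma w₂_tδ (x : M) : R'.w₂ (tδ R R' x).hom =
    -tCorrι R R' - tCorrχ R R' x (one M) - tCorr₁ R R' (ru x).hom :=
  R'.w₂_iso _ _

noncomputable def tυ (x y : M) :
    tχ R R' x y ≫ tMap R R' (bt x y) ≅ bt (tObj R R' x) (tObj R R' y) ≫ tχ R R' y x :=
  R'.iso (tCorrχ R R' y x - tCorrχ R R' x y - tCorr₁ R R' (bt x y)) (by
    simp only [w₁_comp, w₁_tMap, w₁_tχ, w₁_br, map_sub]; abel)

lemma w₂_tυ (x y : M) : R'.w₂ (tυ R R' x y).hom =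
    tCorrχ R R' y x - tCorrχ R R' x y - tCorr₁ R R' (bt x y) :=
  R'.w₂_iso _ _

/-- The structure cells of the transport pseudofunctor. -/
noncomputable def tFunctorData : SymMonFunctorData M N where
  toPseudofunctor := tFunctor R R'
  χ := tχ R R'
  χN := tχN R R'
  ι := tι R R'
  ω := tω R R'
  γ := tγ R R'
  δ := tδ R R'
  υ := tυ R R'

/-- The comparison of the transport pseudofunctor. -/
noncomputable def tComparison : Comparison R R' (tFunctorData R R') where
  q₀ := tCorr₀ R R'
  q₁ := tCorr₁ R R'
  qχ := tCorrχ R R'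
  qι := tCorrι R R'
  w₀_obj := w₀_tObj R R'
  w₁_map := w₁_tMap R R'
  w₂_map₂ _ := R'.w₂_hom _ _
  w₂_mapId _ := by simp only [tFunctorData, tFunctor, w₂_iso]
  w₂_mapComp _ _ := by simp only [tFunctorData, tFunctor, w₂_iso]
  w₁_χ := w₁_tχ R R'
  w₁_ι := w₁_tι R R'
  w₂_χN := w₂_tχN R R'
  w₂_ω := w₂_tω R R'
  w₂_γ := w₂_tγ R R'
  w₂_δ := w₂_tδ R R'
  w₂_υ := w₂_tυ R R'

end

end Realization

namespace Comparison

set_option maxHeartbeats 2000000 in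
/-- Structure cells that admit a comparison satisfy the axioms of a symmetric monoidal
pseudofunctor. -/
def toFunctor [SymMonBicat M] [SymMonBicat N] {R : Realization M d₁ d₂}
    {R' : Realization N d₁ d₂} {F : SymMonFunctorData M N} (c : Comparison R R' F) :
    SymMonFunctor M N where
  toSymMonFunctorData := F
  χ_equiv _ _ := R'.isEquiv _
  ι_equiv := R'.isEquiv _
  -- In every axiom the two sides are pastings between the same 1-morphisms. Corrections of
  -- intermediate 1-morphisms cancel, so both sides have the correction of the common target minus
  -- that of the common source, plus equal contributions from `M`.
  χN_naturality _ _ := R'.faithful (by simp [c.w₂_map₂, c.w₂_χN]; abel)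
  χN_id _ _ := R'.iso_ext (by simp [c.w₂_map₂, c.w₂_χN, c.w₂_mapId]; abel)
  χN_comp _ _ _ _ := R'.iso_ext (by simp [c.w₂_map₂, c.w₂_χN, c.w₂_mapComp]; abel)
  ω_mod _ _ _ := R'.iso_ext (by simp [c.w₂_χN, c.w₂_ω, c.w₂_sqMap]; abel)
  γ_mod _ := R'.iso_ext (by simp [c.w₂_χN, c.w₂_γ, c.w₂_sqMap, c.w₂_ιN]; abel)
  δ_mod _ := R'.iso_ext (by simp [c.w₂_χN, c.w₂_δ, c.w₂_sqMap, c.w₂_ιN]; abel)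
  υ_mod _ _ := R'.iso_ext (by simp [c.w₂_χN, c.w₂_υ, c.w₂_sqMap]; abel)
  pent_coh _ _ _ _ := R'.iso_ext (by
    simp [c.w₂_ω, c.w₂_χA, c.w₂_χB, c.w₂_fun2, c.w₂_fun3, c.w₂_map₂]; abel)
  mid_coh _ _ := R'.iso_ext (by
    simp [c.w₂_ω, c.w₂_γ, c.w₂_δ, c.w₂_χA, c.w₂_χB, c.w₂_fun2, c.w₂_map₂]; abel)
  hexR_coh _ _ _ := R'.iso_ext (by
    simp [c.w₂_ω, c.w₂_υ, c.w₂_χA, c.w₂_χB, c.w₂_fun3, c.w₂_map₂]; abel)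
  hexS_coh _ _ _ := R'.iso_ext (by
    simp [c.w₂_ωI, c.w₂_υ, c.w₂_χA, c.w₂_χB, c.w₂_fun3, c.w₂_map₂]; abel)
  syl_coh _ _ := R'.iso_ext (by
    simp [c.w₂_υ, c.w₂_fun2, c.w₂_map₂, c.w₂_mapId]; abel)

section

variable [SymMonBicatData M] [SymMonBicatData N] {R : Realization M d₁ d₂}
  {R' : Realization N d₁ d₂} {F G : SymMonFunctorData M N} (c : Comparison R R' F)
  (c' : Comparison R R' G)

/-- Both images of `x` are compared with the same weight `R.w₀ x`. The component undoes the
correction of `F` and applies that of `G`. -/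
lemma transApp_aux (x : M) :
    R'.w₀ (G.obj x) = R'.w₀ (F.obj x) + d₂ (c'.q₀ x - c.q₀ x) := by
  simp only [c.w₀_obj, c'.w₀_obj, map_sub]; abel

/-- The components of the transformation between two compared pseudofunctors. -/
noncomputable def transApp (x : M) : F.obj x ⟶ G.obj x := R'.lift₁ _ (transApp_aux c c' x)

noncomputable def transCorr (x : M) : Q₁ := R'.corr₁ _ (transApp_aux c c' x)

lemma w₁_transApp (x : M) :
    R'.w₁ (transApp c c' x) = c'.q₀ x - c.q₀ x + d₁ (transCorr c c' x) :=
  R'.w₁_lift₁ _ _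

set_option maxHeartbeats 2000000 in
/-- Any two pseudofunctors with comparisons are related by a symmetric monoidal transformation. -/
noncomputable def trans : SymMonTrans F G where
  app := transApp c c'
  naturality {x y} f :=
    -- With `transCorr` as the correction of the components, this is again target minus source. The
    -- cells `m₂` and `m₀` follow the same rule.
    R'.iso (transCorr c c' x + c'.q₁ f - c.q₁ f - transCorr c c' y) (by
      simp only [Realization.w₁_comp, c.w₁_map, c'.w₁_map, w₁_transApp, map_add, map_sub]; abel)
  naturality_naturality _ := R'.faithful (by simp [c.w₂_map₂, c'.w₂_map₂]; abel)
  naturality_id _ := R'.faithful (by simp [c.w₂_mapId, c'.w₂_mapId]; abel)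
  naturality_comp _ _ := R'.faithful (by simp [c.w₂_mapComp, c'.w₂_mapComp]; abel)
  m₂ x y := R'.iso (transCorr c c' x + transCorr c c' y + c'.qχ x y - c.qχ x y -
      transCorr c c' (x ⊠ y)) (by
    simp only [Realization.w₁_comp, Realization.w₁_tensor, c.w₁_χ, c'.w₁_χ, w₁_transApp, map_add,
      map_sub]
    abel)
  m₀ := R'.iso (c'.qι - c.qι - transCorr c c' (one M)) (by
    simp only [Realization.w₁_comp, c.w₁_ι, c'.w₁_ι, w₁_transApp, map_sub]; abel)
  m₂_mod _ _ := R'.iso_ext (by simp [c.w₂_χN, c'.w₂_χN]; abel)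
  ω_coh _ _ _ := R'.iso_ext (by simp [c.w₂_ω, c'.w₂_ω]; abel)
  γ_coh _ := R'.iso_ext (by simp [c.w₂_γ, c'.w₂_γ]; abel)
  δ_coh _ := R'.iso_ext (by simp [c.w₂_δ, c'.w₂_δ]; abel)
  υ_coh _ _ := R'.iso_ext (by simp [c.w₂_υ, c'.w₂_υ]; abel)

end

end Comparison

/-- Symmetric monoidal bicategories that are realized in the same complex are equivalent. -/
noncomputable def Realization.equivalence [SymMonBicat M] [SymMonBicat N]
    (R : Realization M d₁ d₂) (R' : Realization N d₁ d₂) : SymMonEquivalence M N where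
  F := (tComparison R R').toFunctor
  G := (tComparison R' R).toFunctor
  -- The identity and the round trip both carry a comparison from `R` to `R`, which is all that a
  -- transformation between them needs.
  unit := (Comparison.id R).trans ((tComparison R R').comp (tComparison R' R))
  unit_equiv _ := R.isEquiv _
  counit := ((tComparison R' R).comp (tComparison R R')).trans (Comparison.id R')
  counit_equiv _ := R'.isEquiv _

end Transport

/-! ### Realizations from quasi-isomorphisms -/

section RealizationOfComplexes

universe uQ

open CochainBicat

variable {Q₁ Q₂ Q₃ : Type uQ} [AddCommGroup Q₁] [AddCommGroup Q₂] [AddCommGroup Q₃]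
  {d₁ : Q₁ →+ Q₂} {d₂ : Q₂ →+ Q₃}

/-- A cochain map to `Q₁ ⟶ Q₂ ⟶ Q₃` that induces isomorphisms on cohomology is a realization. -/
def CochainBicat.realization {S : ShortComplex Ab.{u}} (f₁ : S.X₁ →+ Q₁) (f₂ : S.X₂ →+ Q₂)
    (f₃ : S.X₃ →+ Q₃) (dd : ∀ q, d₂ (d₁ q) = 0) (comm₁ : ∀ e, f₂ (S.f.hom e) = d₁ (f₁ e))
    (comm₂ : ∀ c, f₃ (S.g.hom c) = d₂ (f₂ c)) (inj : ∀ e, S.f.hom e = 0 → f₁ e = 0 → e = 0)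
    -- The four conditions package the isomorphisms on cohomology by adjacent degrees: `inj` is
    -- injectivity on `H¹`, `full₂` joins surjectivity on `H¹` to injectivity on `H²`, `full₁` joins
    -- surjectivity on `H²` to injectivity on `H³`, and `surj` is surjectivity on `H³`.
    (full₂ : ∀ c q, S.g.hom c = 0 → f₂ c = d₁ q → ∃ e, S.f.hom e = c ∧ f₁ e = q)
    (full₁ : ∀ x q, f₃ x = d₂ q → ∃ c p, S.g.hom c = x ∧ f₂ c = q + d₁ p)
    (surj : ∀ q, ∃ x p, f₃ x = q + d₂ p) : Realization (CochainBicat S) d₁ d₂ where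
  w₀ x := f₃ x.val
  w₁ f := f₂ (v₁ f)
  w₂ η := f₁ (v₂ η)
  d_d := dd
  w₁_prop f := by rw [v₁_prop f, map_add, comm₂]
  w₂_prop η := by rw [v₂_prop η, map_add, comm₁]
  w₁_id _ := map_zero f₂
  w₁_comp _ _ := map_add f₂ _ _
  w₂_id _ := map_zero f₁
  w₂_comp _ _ := map_add f₁ _ _
  w₂_whiskerLeft _ _ _ _ := rfl
  w₂_whiskerRight _ _ := rfl
  w₂_associator _ _ _ := map_zero f₁
  w₂_leftUnitor _ := map_zero f₁
  w₂_rightUnitor _ := map_zero f₁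
  w₀_tensor _ _ := map_add f₃ _ _
  w₀_one := map_zero f₃
  w₁_tensor _ _ := map_add f₂ _ _
  w₂_tensor _ _ := map_add f₁ _ _
  w₂_tensorId _ _ := map_zero f₁
  w₂_tensorComp _ _ _ _ := map_zero f₁
  w₁_asc _ _ _ := map_zero f₂
  w₁_asc_inv _ _ _ := map_zero f₂
  w₂_asc_unit _ _ _ := map_zero f₁
  w₂_asc_counit _ _ _ := map_zero f₁
  w₁_lu _ := map_zero f₂
  w₁_ru _ := map_zero f₂
  w₁_br _ _ := map_zero f₂
  w₂_ascN _ _ _ := map_zero f₁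
  w₂_luN _ := map_zero f₁
  w₂_ruN _ := map_zero f₁
  w₂_brN _ _ := map_zero f₁
  w₂_pent _ _ _ _ := map_zero f₁
  w₂_mid _ _ := map_zero f₁
  w₂_hexR _ _ _ := map_zero f₁
  w₂_hexS _ _ _ := map_zero f₁
  w₂_syl _ _ := map_zero f₁
  -- Parallel 2-morphisms differ by a cocycle in `C¹`, to which injectivity on `H¹` applies.
  faithful {_ _ f g η θ} h := hom₂_ext (sub_eq_zero.1 (inj _
    (by rw [map_sub, sub_eq_zero]; exact add_left_cancel ((v₂_prop η).symm.trans (v₂_prop θ)))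
    (by rw [map_sub, sub_eq_zero]; exact h)))
  full₂ f g q h := by
    obtain ⟨e, he, hq⟩ := full₂ (v₁ g - v₁ f) q
      (by rw [map_sub, sub_eq_zero]; exact add_left_cancel ((v₁_prop g).symm.trans (v₁_prop f)))
      (by rw [map_sub, h, add_sub_cancel_left])
    exact ⟨mk₂ e (by rw [he, add_sub_cancel]), hq⟩
  full₁ x y q h := by
    obtain ⟨c, p, hc, hq⟩ := full₁ (y.val - x.val) q (by rw [map_sub, h, add_sub_cancel_left])
    exact ⟨mk₁ c (by rw [hc, add_sub_cancel]), p, hq⟩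
  surj₀ q := by
    obtain ⟨x, p, h⟩ := surj q
    exact ⟨⟨x⟩, p, h⟩

/-- Maps of the groups `A₁`, `A₂`, `A₃` to `Q₁ ⟶ Q₂ ⟶ Q₃` that identify them with its cohomology
give a realization of `A₃ × A₂[1] × A₁[2]`. -/
def splitRealization {A₁ A₂ A₃ : Type u} [AddCommGroup A₁] [AddCommGroup A₂] [AddCommGroup A₃]
    (f₁ : A₁ →+ Q₁) (f₂ : A₂ →+ Q₂) (f₃ : A₃ →+ Q₃) (dd : ∀ q, d₂ (d₁ q) = 0)
    (comm₁ : ∀ a, d₁ (f₁ a) = 0) (comm₂ : ∀ a, d₂ (f₂ a) = 0) (inj : Function.Injective f₁)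
    (full₂ : ∀ a q, f₂ a = d₁ q → a = 0 ∧ ∃ e, f₁ e = q)
    (full₁ : ∀ a q, f₃ a = d₂ q → a = 0 ∧ ∃ c p, f₂ c = q + d₁ p)
    (surj : ∀ q, ∃ x p, f₃ x = q + d₂ p) :
    Realization (Disc A₃ × Shift1 A₂ × Shift2 A₁) d₁ d₂ where
  w₀ x := f₃ x.1.val
  w₁ f := f₂ (v₁ f.2.1)
  w₂ η := f₁ (v₂ η.2.2)
  d_d := dd
  w₁_prop {x y} f := by
    have h : y.1.val = x.1.val := (v₁_prop f.1).trans (add_zero _)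
    rw [comm₂, add_zero, h]
  w₂_prop {_ _ f g} η := by
    have h : v₁ g.2.1 = v₁ f.2.1 := (v₂_prop η.2.1).trans (add_zero _)
    rw [comm₁, add_zero, h]
  w₁_id _ := map_zero f₂
  w₁_comp _ _ := map_add f₂ _ _
  w₂_id _ := map_zero f₁
  w₂_comp _ _ := map_add f₁ _ _
  w₂_whiskerLeft _ _ _ _ := rfl
  w₂_whiskerRight _ _ := rfl
  w₂_associator _ _ _ := map_zero f₁
  w₂_leftUnitor _ := map_zero f₁
  w₂_rightUnitor _ := map_zero f₁
  w₀_tensor _ _ := map_add f₃ _ _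
  w₀_one := map_zero f₃
  w₁_tensor _ _ := map_add f₂ _ _
  w₂_tensor _ _ := map_add f₁ _ _
  w₂_tensorId _ _ := map_zero f₁
  w₂_tensorComp _ _ _ _ := map_zero f₁
  w₁_asc _ _ _ := map_zero f₂
  w₁_asc_inv _ _ _ := map_zero f₂
  w₂_asc_unit _ _ _ := map_zero f₁
  w₂_asc_counit _ _ _ := map_zero f₁
  w₁_lu _ := map_zero f₂
  w₁_ru _ := map_zero f₂
  w₁_br _ _ := map_zero f₂
  w₂_ascN _ _ _ := map_zero f₁
  w₂_luN _ := map_zero f₁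
  w₂_ruN _ := map_zero f₁
  w₂_brN _ _ := map_zero f₁
  w₂_pent _ _ _ _ := map_zero f₁
  w₂_mid _ _ := map_zero f₁
  w₂_hexR _ _ _ := map_zero f₁
  w₂_hexS _ _ _ := map_zero f₁
  w₂_syl _ _ := map_zero f₁
  faithful h := Prod.ext (hom₂_ext (Subsingleton.elim (α := PUnit) _ _))
    (Prod.ext (hom₂_ext (Subsingleton.elim (α := PUnit) _ _)) (hom₂_ext (inj h)))
  -- All differentials of the split complex vanish, so a 2-morphism exists only between 1-morphisms
  -- with equal `A₂`-component. This is why the hypothesis must yield `a = 0`, and likewise in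
  -- `full₁` for objects.
  full₂ f g q h := by
    obtain ⟨h₀, e, he⟩ := full₂ (v₁ g.2.1 - v₁ f.2.1) q (by rw [map_sub, h, add_sub_cancel_left])
    exact ⟨Prod.mkHom (mk₂ 0 (Subsingleton.elim (α := PUnit) _ _)) (Prod.mkHom
      (mk₂ 0 ((sub_eq_zero.1 h₀).trans (add_zero _).symm))
      (mk₂ e (Subsingleton.elim (α := PUnit) _ _))), he⟩
  full₁ x y q h := by
    obtain ⟨h₀, c, p, hq⟩ := full₁ (y.1.val - x.1.val) q
      (by rw [map_sub, h, add_sub_cancel_left])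
    exact ⟨Prod.mkHom (mk₁ 0 ((sub_eq_zero.1 h₀).trans (add_zero _).symm)) (Prod.mkHom
      (mk₁ c (Subsingleton.elim (α := PUnit) _ _))
      (mk₁ 0 (Subsingleton.elim (α := PUnit) _ _))), p, hq⟩
  surj₀ q := by
    obtain ⟨x, p, h⟩ := surj q
    exact ⟨(⟨x⟩, ⟨0⟩, ⟨0⟩), p, h⟩

end RealizationOfComplexes

/-! ### Divisible groups and the common complex for `C` and its cohomology -/

section Divisible

variable {A B E : Type u} [AddCommGroup A] [AddCommGroup B] [AddCommGroup E]

/-- Every abelian group embeds into a divisible one. -/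
lemma exists_injective_to_divisible (A : Type u) [AddCommGroup A] :
    ∃ (E : Type u) (_ : AddCommGroup E) (_ : DivisibleBy E ℤ) (i : A →+ E),
      Function.Injective i :=
  -- The embedding is evaluation into a power of `ℚ/ℤ`. It is injective because characters separate
  -- points.
  ⟨CharacterModule A → AddCircle (1 : ℚ), inferInstance, inferInstance,
    AddMonoidHom.mk' (fun a c => c a) fun a b => funext fun c => map_add c a b,
    (injective_iff_map_eq_zero _).2 fun _ h =>
      CharacterModule.eq_zero_of_character_apply fun c => congrFun h c⟩

/-- A homomorphism to a divisible group extends along a homomorphism whose kernel it kills. -/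
lemma exists_extension [DivisibleBy E ℤ] (p : A →+ B) (φ : A →+ E)
    (h : ∀ a, p a = 0 → φ a = 0) : ∃ ψ : B →+ E, ∀ a, ψ (p a) = φ a := by
  -- Both maps factor through `A ⧸ p.ker`, where `p` becomes injective, so Baer's criterion applies.
  obtain ⟨ψ, hψ⟩ := (Module.Baer.of_divisible E).extension_property_addMonoidHom
    (QuotientAddGroup.kerLift p) (QuotientAddGroup.kerLift_injective p)
    (QuotientAddGroup.lift p.ker φ h)
  exact ⟨ψ, fun a => DFunLike.congr_fun hψ (a : A ⧸ p.ker)⟩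

-- This is the point where global dimension one of `ℤ` enters: the second term of the resolution is
-- divisible too, so maps into it also extend.
@[reducible] noncomputable def divisibleQuotient [DivisibleBy E ℤ] (H : AddSubgroup E) :
    DivisibleBy (E ⧸ H) ℤ :=
  (QuotientAddGroup.mk_surjective (s := H)).divisibleBy (QuotientAddGroup.mk' H) fun _ _ => rfl

end Divisible

open QuotientAddGroup in
/-- The bicategory of a complex is equivalent to the product of its shifted cohomology groups:
both are realized in the sum of `H³` and of divisible resolutions of `H²` and `H¹`. -/
theorem nonempty_equivalence_split (S : ShortComplex Ab.{u}) :
    Nonempty (SymMonEquivalence (CochainBicat S) (Split S)) := by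
  obtain ⟨E₁, _, _, i₁, hi₁⟩ := exists_injective_to_divisible (H1 S)
  obtain ⟨E₂, _, _, i₂, hi₂⟩ := exists_injective_to_divisible (H2 S)
  let _ := divisibleQuotient i₁.range
  let _ := divisibleQuotient i₂.range
  -- The embedding of `H¹` extends to `C¹`. Modulo `H¹` this extension kills the kernel of the
  -- differential, hence extends further along it to `C²`. The maps `k₂` and `k₃` repeat this for
  -- `H²`, one degree higher.
  obtain ⟨f₁, hf₁⟩ := exists_extension S.f.hom.ker.subtype i₁ (by
    intro a ha; rw [show a = 0 from Subtype.ext ha, map_zero])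
  obtain ⟨f₂, hf₂⟩ := exists_extension S.f.hom ((mk' i₁.range).comp f₁) (by
    intro a ha
    exact (eq_zero_iff _).2 ⟨⟨a, ha⟩, (hf₁ ⟨a, ha⟩).symm⟩)
  obtain ⟨k₂, hk₂⟩ := exists_extension S.g.hom.ker.subtype (i₂.comp (mk' S.abToCycles.range)) (by
    intro a ha; rw [show a = 0 from Subtype.ext ha, map_zero])
  obtain ⟨k₃, hk₃⟩ := exists_extension S.g.hom ((mk' i₂.range).comp k₂) (by
    intro a ha
    exact (eq_zero_iff _).2 ⟨mk' S.abToCycles.range ⟨a, ha⟩, (hk₂ ⟨a, ha⟩).symm⟩)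
  have gf (e : S.X₁) : S.g.hom (S.f.hom e) = 0 := ConcreteCategory.congr_hom S.zero e
  -- On cocycles `k₂` is the embedding of the cohomology class, which vanishes for a coboundary.
  have k₂f (e : S.X₁) : k₂ (S.f.hom e) = 0 :=
    (hk₂ ⟨S.f.hom e, gf e⟩).trans ((congrArg i₂ ((eq_zero_iff _).2 ⟨e, rfl⟩)).trans (map_zero i₂))
  -- The target complex is the direct sum of the resolution `E₁ ⟶ E₁/H¹` in degrees 1 and 2, the
  -- resolution `E₂ ⟶ E₂/H²` in degrees 2 and 3, and `H³` in degree 3.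
  let d₁ : E₁ →+ (E₁ ⧸ i₁.range) × E₂ := (mk' i₁.range).prod 0
  let d₂ : (E₁ ⧸ i₁.range) × E₂ →+ H3 S × (E₂ ⧸ i₂.range) :=
    (0 : _ →+ H3 S).prod ((mk' i₂.range).comp (AddMonoidHom.snd _ _))
  have dd (q) : d₂ (d₁ q) = 0 := Prod.ext rfl (map_zero (mk' i₂.range))
  have mk₁_eq (q : E₁) : mk' i₁.range q = 0 ↔ ∃ a, i₁ a = q := eq_zero_iff q
  have mk₂_eq (q : E₂) : mk' i₂.range q = 0 ↔ ∃ a, i₂ a = q := eq_zero_iff q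
  refine ⟨(CochainBicat.realization (d₁ := d₁) (d₂ := d₂) f₁ (f₂.prod k₂)
    ((mk' S.g.hom.range).prod k₃) dd ?_ ?_ ?_ ?_ ?_ ?_).equivalence
    (splitRealization i₁ ((AddMonoidHom.inr _ _).comp i₂) (AddMonoidHom.inl _ _) dd
      ?_ ?_ hi₁ ?_ ?_ ?_)⟩
  · exact fun e => Prod.ext (hf₂ e) (k₂f e)
  · exact fun c => Prod.ext ((eq_zero_iff _).2 ⟨c, rfl⟩) (hk₃ c)
  · intro e he h
    exact congrArg Subtype.val (hi₁ (((hf₁ ⟨e, he⟩).symm.trans h).trans (map_zero i₁).symm))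
  · intro c q hc h
    have h₂ : k₂ c = 0 := congrArg Prod.snd h
    have hz : mk' S.abToCycles.range ⟨c, hc⟩ = 0 :=
      hi₂ (((hk₂ ⟨c, hc⟩).symm.trans h₂).trans (map_zero i₂).symm)
    obtain ⟨e, he⟩ := (eq_zero_iff _).1 hz
    have he' : S.f.hom e = c := congrArg Subtype.val he
    have h₁ : f₂ c = mk' i₁.range q := congrArg Prod.fst h
    -- The primitive `e` of `c` may miss the prescribed value `q`, but only by an element of `H¹`,
    -- and adding this cocycle to `e` repairs it.
    obtain ⟨a, ha⟩ := (mk₁_eq (q - f₁ e)).1 (by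
      rw [map_sub, ← h₁, ← he', hf₂]; exact sub_self _)
    refine ⟨e + a, ?_, ?_⟩
    · rw [map_add, he', show S.f.hom a = 0 from a.2, add_zero]
    · rw [map_add, show f₁ a = i₁ a from hf₁ a, ha, add_sub_cancel]
  · intro x q h
    obtain ⟨c, hc⟩ := (eq_zero_iff _).1 (show mk' S.g.hom.range x = 0 from congrArg Prod.fst h)
    have h₂ : k₃ x = mk' i₂.range q.2 := congrArg Prod.snd h
    -- The error of `c` in `E₂` is a class in `H²`, corrected by adding a representing cocycle `z`.
    -- The remaining error lies in `E₁/H¹`, which `d₁` covers, so the witness `p` absorbs it.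
    obtain ⟨a, ha⟩ := (mk₂_eq (q.2 - k₂ c)).1 (by
      rw [map_sub, ← h₂, ← hc, hk₃]; exact sub_self _)
    obtain ⟨z, rfl⟩ := mk'_surjective _ a
    obtain ⟨p, hp⟩ := mk'_surjective i₁.range (f₂ (c + z) - q.1)
    refine ⟨c + z, p, ?_, Prod.ext ?_ ?_⟩
    · rw [map_add, hc, show S.g.hom z = 0 from z.2, add_zero]
    · change f₂ (c + z) = q.1 + mk' i₁.range p
      rw [hp, add_sub_cancel]
    · change k₂ (c + z) = q.2 + 0
      rw [map_add, show k₂ z = _ from hk₂ z, add_zero, ← add_sub_cancel (k₂ c) q.2, ← ha]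
      rfl
  · intro q
    obtain ⟨x, hx⟩ := mk'_surjective S.g.hom.range q.1
    obtain ⟨p, hp⟩ := mk'_surjective i₂.range (k₃ x - q.2)
    refine ⟨x, (0, p), Prod.ext ?_ ?_⟩
    -- The `H³` coordinate is hit exactly, while the coordinate in `E₂/H²` is a coboundary and is
    -- absorbed by `(0, p)`.
    · exact hx.trans (add_zero _).symm
    · change k₃ x = q.2 + mk' i₂.range p
      rw [hp, add_sub_cancel]
  · exact fun a => Prod.ext ((mk₁_eq _).2 ⟨a, rfl⟩) rfl
  · exact fun a => Prod.ext rfl ((mk₂_eq _).2 ⟨a, rfl⟩)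
  · intro a q h
    exact ⟨hi₂ ((show i₂ a = 0 from congrArg Prod.snd h).trans (map_zero i₂).symm),
      (mk₁_eq q).1 (congrArg Prod.fst h).symm⟩
  · intro a q h
    obtain ⟨c, hc⟩ := (mk₂_eq q.2).1 (congrArg Prod.snd h).symm
    obtain ⟨p, hp⟩ := mk'_surjective i₁.range (-q.1)
    refine ⟨congrArg Prod.fst h, c, p, Prod.ext ?_ ?_⟩
    · change 0 = q.1 + mk' i₁.range p
      rw [hp, add_neg_cancel]
    · exact hc.trans (add_zero _).symm
  · intro q
    obtain ⟨p, hp⟩ := mk'_surjective i₂.range (-q.2)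
    refine ⟨q.1, (0, p), Prod.ext (add_zero _).symm ?_⟩
    change 0 = q.2 + mk' i₂.range p
    rw [hp, add_neg_cancel]

/-! ### The obstruction to naturality -/

section NonNaturality

open CochainBicat

/-- Parallel 1-morphisms of `A[2]` are equal. -/
lemma shift2_hom_eq {A : Type u} [AddCommGroup A] {x y : Shift2 A} (a b : x ⟶ y) : a = b :=
  Hom₁.ext (Subsingleton.elim (α := PUnit) _ _)

/-- An equivalence `A[2] ≃ Split (A[2])` reflects divisibility by two of 2-morphisms. -/
lemma even_of_even_map₂ {A : Type u} [AddCommGroup A]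
    (Φ : SymMonEquivalence (Shift2 A) (Split (conc1 A))) {x y : Shift2 A} {a b : x ⟶ y}
    (e : a ⟶ b) (t : H1 (conc1 A)) (h : v₂ (Φ.F.map₂ e).2.2 = t + t) :
    ∃ z : A, v₂ e = z + z := by
  obtain rfl := shift2_hom_eq a b
  -- With source and target identified, half of the image of `e` is itself a 2-endomorphism. The
  -- other two factors of the product have no nonzero 2-morphisms, so the image is `ζ ≫ ζ`.
  let ζ : Φ.F.map a ⟶ Φ.F.map a := Prod.mkHom (𝟙 _) (Prod.mkHom (𝟙 _)
    (mk₂ t (Subsingleton.elim (α := PUnit) _ _)))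
  have hζ : Φ.F.map₂ e = ζ ≫ ζ :=
    Prod.ext (hom₂_ext (Subsingleton.elim (α := PUnit) _ _))
      (Prod.ext (hom₂_ext (Subsingleton.elim (α := PUnit) _ _)) (hom₂_ext h))
  have nat : v₂ e + v₂ (Φ.unit.naturality a).hom =
      v₂ (Φ.unit.naturality a).hom + v₂ (Φ.G.map₂ (Φ.F.map₂ e)) :=
    congrArg v₂ (Φ.unit.naturality_naturality e)
  -- The constraint of the unit cancels because 2-morphisms add commutatively. Thus `e` has the
  -- weight of its round trip, which is twice that of `Φ.G.map₂ ζ`.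
  rw [add_comm, add_left_cancel_iff, hζ, Φ.G.map₂_comp] at nat
  exact ⟨v₂ (Φ.G.map₂ ζ), nat⟩

/-- The complex `ℤ ⟶ ℤ ⟶ 0` with first differential multiplication by two. -/
abbrev multTwo : ShortComplex Ab.{u} :=
  ShortComplex.mk (X₁ := .of (ULift.{u} ℤ)) (X₂ := .of (ULift.{u} ℤ)) (X₃ := .of PUnit)
    (AddCommGrpCat.ofHom (nsmulAddMonoidHom 2)) 0 (by simp)

/-- The identity in degree 1. -/
def multTwoMap : multTwo.{u} ⟶ conc1 (ULift.{u} ℤ) where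
  τ₁ := 𝟙 _
  τ₂ := 0
  τ₃ := 0

lemma ulift_int_eq_zero {x : ULift.{u} ℤ} (h : x + x = 0) : x = 0 := by
  have h' : x.down + x.down = 0 := congrArg ULift.down h
  exact ULift.ext _ _ (show x.down = 0 by omega)

lemma H1_multTwo_eq_zero (x : H1 multTwo.{u}) : x = 0 :=
  Subtype.ext (ulift_int_eq_zero ((two_nsmul _).symm.trans x.2))

/-- Multiplication by two is injective on `ℤ`, so the source has no `H¹`. This removes every
contribution of `Φ` for the source complex from the pseudonaturality equations. -/
lemma H1map_multTwoMap (x : H1 multTwo.{u}) : H1map multTwoMap x = 0 := by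
  rw [H1_multTwo_eq_zero x, map_zero]

/-- In the application `a` is the weight of the image of the generator, `r` and `r'` are constraints
at two doubled 1-morphisms with halves `n` and `n'`, and `m`, `m'` are compositor weights. Equality
of the latter leaves only even terms. -/
lemma eq_add_self_of_add_eq {A : Type u} [AddCommGroup A] {a m m' n n' r r' : A}
    (h : a + r = r' + 0) (hr : r = m + (n + n)) (hr' : r' = m' + (n' + n')) (hm : m = m') :
    a = (n' - n) + (n' - n) := by
  subst hm hr hr'
  rw [← sub_eq_zero] at h ⊢
  rw [← h]
  abel

/-- No pair of equivalences `D(C) ≃ Split C` is compatible with `multTwoMap`, which is zero on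
cohomology: the pseudonaturality constraints would make the generator of `ℤ` even. -/
lemma multTwoMap_not_natural
    (Φ : SymMonEquivalence (CochainBicat multTwo.{u}) (Split multTwo.{u}))
    (Φ' : SymMonEquivalence (Shift2 (ULift.{u} ℤ)) (Split (conc1 (ULift.{u} ℤ))))
    (θ : Pseudofunctor.StrongTrans
      ((CochainBicat.map multTwoMap).comp Φ'.F.toPseudofunctor)
      (Φ.F.toPseudofunctor.comp (Split.map multTwoMap))) : False := by
  let pt : CochainBicat multTwo.{u} := ⟨0⟩
  let D := CochainBicat.map multTwoMap.{u}
  -- Only the factor `H¹[2]` of the target has nontrivial 2-morphisms, so this component is all of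
  -- the constraint.
  let ν {x y : CochainBicat multTwo.{u}} (c : x ⟶ y) : H1 (conc1 (ULift.{u} ℤ)) :=
    v₂ (θ.naturality c).hom.2.2
  -- This is the compositor of `D` followed by `Φ'`. Letting `c` be any 1-morphism of the same value
  -- as `a ≫ b` makes the compositors at different 1-morphisms comparable.
  let m {x y z : Shift2 (ULift.{u} ℤ)} (a : x ⟶ y) (b : y ⟶ z) (c : x ⟶ z)
      (h : v₁ (a ≫ b) = v₁ c) : H1 (conc1 (ULift.{u} ℤ)) :=
    v₂ (Φ'.F.toPseudofunctor.map₂Iso (eqIso h) ≪≫ Φ'.F.mapComp a b).hom.2.2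
  have hm {x y z : Shift2 (ULift.{u} ℤ)} (a a' : x ⟶ y) (b b' : y ⟶ z) (c c' : x ⟶ z) (h h') :
      m a b c h = m a' b' c' h' := by
    obtain rfl := shift2_hom_eq a a'
    obtain rfl := shift2_hom_eq b b'
    obtain rfl := shift2_hom_eq c c'
    rfl
  have comp (c : pt ⟶ pt) :
      ν (c ≫ c) = m (D.map c) (D.map c) (D.map (c ≫ c)) rfl + (ν c + ν c) := by
    have h : ν (c ≫ c) + (H1map multTwoMap (v₂ (Φ.F.mapComp c c).hom.2.2) + 0) =
        m (D.map c) (D.map c) (D.map (c ≫ c)) rfl + (0 + (ν c + (0 + (ν c + 0)))) :=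
      congrArg (fun η => v₂ η.2.2) (θ.naturality_comp c c)
    simpa only [H1map_multTwoMap, add_zero, zero_add] using h
  -- The 1-morphism `1` represents the generator of `H² = ℤ/2`. Its double is the coboundary of `1`,
  -- which provides the 2-morphism `e`. The source is written `𝟙 pt ≫ 𝟙 pt` so that `comp` applies
  -- at both ends.
  let c₁ : pt ⟶ pt := mk₁ ⟨1⟩ rfl
  let e : (𝟙 pt ≫ 𝟙 pt) ⟶ c₁ ≫ c₁ := mk₂ ⟨1⟩
    (show (⟨1⟩ + ⟨1⟩ : ULift.{u} ℤ) = 0 + 0 + 2 • ⟨1⟩ by rw [two_nsmul, add_zero, zero_add])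
  have nat : v₂ (Φ'.F.map₂ (D.map₂ e)).2.2 + ν (c₁ ≫ c₁) =
      ν (𝟙 pt ≫ 𝟙 pt) + H1map multTwoMap (v₂ (Φ.F.map₂ e).2.2) :=
    congrArg (fun η => v₂ η.2.2) (θ.naturality_naturality e)
  rw [H1map_multTwoMap] at nat
  obtain ⟨z, hz⟩ := even_of_even_map₂ Φ' (D.map₂ e) (ν (𝟙 pt) - ν c₁)
    (eq_add_self_of_add_eq nat (comp c₁) (comp (𝟙 pt)) (hm _ _ _ _ _ _ _ _))
  -- The cochain map is the identity in degree 1, so `D.map₂ e` still has weight `1`.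
  have h : (1 : ℤ) = z.down + z.down := congrArg ULift.down hz
  omega

end NonNaturality

/-! ### Equivalence classes of objects -/

section Components

open CochainBicat

variable {S : ShortComplex Ab.{u}}

/-- Objects of the bicategory of a complex are equivalent if they are cohomologous. -/
lemma nonempty_equivalence_iff (x y : CochainBicat S) :
    Nonempty (x ≌ y) ↔ (x.val : H3 S) = y.val := by
  rw [QuotientAddGroup.eq]
  constructor
  · rintro ⟨e⟩
    exact ⟨v₁ e.hom, by rw [v₁_prop e.hom, neg_add_cancel_left]⟩
  · rintro ⟨c, hc⟩
    exact ⟨Bicategory.Equivalence.mkOfAdjointifyCounit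
      (f := mk₁ c (by rw [hc, add_neg_cancel_left]))
      (g := mk₁ (-c) (by rw [map_neg, hc, neg_add_rev, neg_neg, add_neg_cancel_left]))
      (eqIso (by simp)) (eqIso (by simp))⟩

/-- `π₀` of the bicategory of a complex is `H³`. -/
noncomputable def pi0Equiv (S : ShortComplex Ab.{u}) : Pi0 (CochainBicat S) ≃+ H3 S :=
  AddEquiv.ofBijective
    (AddHom.mk (M := Pi0 (CochainBicat S)) (Quotient.lift (fun x : CochainBicat S => (x.val : H3 S))
      fun x y h => (nonempty_equivalence_iff x y).1 h) (by rintro ⟨a⟩ ⟨b⟩; rfl))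
    ⟨by
      rintro ⟨a⟩ ⟨b⟩ h
      exact Quotient.sound ((nonempty_equivalence_iff a b).2 h),
    fun y => by
      obtain ⟨x, rfl⟩ := QuotientAddGroup.mk_surjective y
      exact ⟨Quotient.mk _ ⟨x⟩, rfl⟩⟩

end Components

end SymBicat

/-! ### The three statements together -/

open CategoryTheory SymBicat in
theorem mainTheorem7 :
    (∀ S : ShortComplex Ab.{u}, Nonempty (SymMonEquivalence (CochainBicat S) (Split S))) ∧
    (¬ ∃ Φ : ∀ S : ShortComplex Ab.{u}, SymMonEquivalence (CochainBicat S) (Split S),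
      ∀ (S S' : ShortComplex Ab.{u}) (f : S ⟶ S'),
        ∃ θ : Pseudofunctor.StrongTrans
            ((CochainBicat.map f).comp (Φ S').F.toPseudofunctor)
            ((Φ S).F.toPseudofunctor.comp (Split.map f)),
          ∀ x, IsEquiv (θ.app x)) ∧
    (∃ φ : ∀ S : ShortComplex Ab.{u}, Pi0 (CochainBicat S) ≃+ H3 S,
      ∀ (S S' : ShortComplex Ab.{u}) (f : S ⟶ S') (x : Pi0 (CochainBicat S)),
        φ S' (Pi0.map (CochainBicat.map f) x) = H3map f (φ S x)) := by
  refine ⟨nonempty_equivalence_split, ?_, pi0Equiv, ?_⟩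
  · rintro ⟨Φ, h⟩
    obtain ⟨θ, -⟩ := h _ _ multTwoMap
    exact multTwoMap_not_natural _ _ θ
  · rintro S S' f ⟨x⟩
    -- Both sides are the class of the image of `x` under the degree 3 component of `f`.
    rfl
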